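/- **Setting.** Let $G$ be a (discrete) group, $\mathcal T\in\mathrm{Aut}(G)$ and $L\ge 1$ with $\mathcal T^L=\mathrm{id}$. A *symmetric injective MPS* consists of a unitary representation $U:G\to U(d)$ on a site and matrices $A^1,\dots,A^d\in M_\chi(\mathbb C)$ such that - $A$ is left-canonical and injective: $\sum_s A^{s\dagger}A^s=1$; the transfer map $\mathbb E(X)=\sum_sA^sXA^{s\dagger}$ has a positive definite fixed point $\rho$; its eigenvalue $1$ is nondegenerate and all its other eigenvalues have modulus $<1$; - for all $k\ge1$ and $g\in G$ the periodic state $|\psi_{kL}\rangle=\sum_{s}\mathrm{Tr}(A^{s_0}\cdots A^{s_{kL-1}})|s_0\dots s_{kL-1}\rangle$ satisfies $\bigotimes_{j=0}^{kL-1}U_{\mathcal T^{j}(g)}|\psi_{kL}\rangle=e^{i\theta}|\psi_{kL}\rangle$ for some phase $e^{i\theta}$ depending on $k$ and $g$. *Phases* are the classes of the equivalence relation generated by the following elementary deformations. The local spaces of two symmetric MPS are embedded isometrically and $G$-equivariantly in a common unitary representation $R$ of $G$, and there is a continuous path $(A_t)_{t\in[0,1]}$ of tensors of fixed size which, for $0<t<1$,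 are left-canonical, injective and symmetric with respect to $R$, such that $A_0$ and $A_1$ generate the two embedded states on all periodic chains of $n\ge1$ sites. *Push-through data* of a symmetric MPS are unitaries $v(g)\in U(\chi)$ and phases $e^{i\phi(g)}$ such that, with $v_j(g)=v(\mathcal T^j(g))$ and $\phi_j(g)=\phi(\mathcal T^j(g))$, $$U_{\mathcal T^j(g)}\cdot A=e^{i\phi_j(g)}\,v_j(g)^\dagger A\,v_{j+1}(g)\qquad\text{for all } j\ge0,\ g\in G .$$ A *weak SPT* is a symmetric MPS with trivial strong class, that is, $v$ can be chosen to be a linear representation of $G$. A *weak SPT phase* is a phase that contains a weak SPT. **Theorem (classification of weak SPT phases with modulated symmetry).** 1. Every symmetric injective MPS has push-through data, and being a weak SPT depends only on the phase. Any two symmetric MPS can be stacked (tensor product on physical and virtual legs) to a symmetric injective MPS. 2. If $v$ is linear, the push-through phase $e^{i\phi}$ can be taken to be a character of $G$, and its class in $$W=H^1(G,U(1))\big/\{e^{i\phi(g)}\sim e^{i\phi(\mathcal T(g))}\}$$ (the quotient of $H^1(G,U(1))=\mathrm{Hom}(G,U(1))$ by the subgroup of all $\phi\circ\mathcal T/\phi$)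 depends only on the phase of the MPS. This defines a bijection from the set of weak SPT phases to $W$, under which stacking corresponds to the group law of $W$. 3. (Agreement with the crystalline equivalence principle.) Let $\mathbb Z$ act on $G$ through $\mathcal T$ and let $t$ be the generator of $\mathbb Z$. For every symmetric MPS there are push-through data with $v(g)v(h)=\omega(g,h)v(gh)$ and a 2-cocycle $c$ of $G\rtimes_{\mathcal T}\mathbb Z$ with $c|_{G\times G}=\omega$ and $c(t,g)=e^{i\phi(g)}c(\mathcal T(g),t)$. The class of $c$ does not depend on the choices and depends only on the phase of the MPS. It defines an injection of the set of all phases into $H^2(G\rtimes_{\mathcal T}\mathbb Z,U(1))$, which is bijective if $G$ is finite. Moreover, there is an exact sequence $$0\to W\to H^2(G\rtimes_{\mathcal T}\mathbb Z,U(1))\to H^2(G,U(1))^{\mathcal T}\to0,$$ whose second map is restriction to $G$, with image the strong SPT classes $[\omega]=[\mathcal T^*\omega]$, and whose first map sends the weak index of part 2 to the class $[c]$ for every weak SPT. -/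

import Mathlib

noncomputable section

namespace ModulatedMPS

open scoped Matrix ComplexOrder
open CategoryTheory

/-! ### Matrix product states -/

/-- An MPS tensor with physical dimension `d` and bond dimension `χ`: matrices `A^s`. -/
abbrev MPSTensor (d χ : ℕ) := Fin d → Matrix (Fin χ) (Fin χ) ℂ

/-- The coefficient `Tr(A^{s_1} ⋯ A^{s_n})` of the periodic `n`-site state generated by `A`. -/
def amplitude {d χ : ℕ} (A : MPSTensor d χ) {n : ℕ} (s : Fin n → Fin d) : ℂ :=
  ((List.ofFn fun i => A (s i)).prod).trace

/-- The transfer matrix `∑ₛ A^s ⊗ (A^s)^*`, as a map on bond space matrices. -/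
def transfer {d χ : ℕ} (A : MPSTensor d χ) :
    Matrix (Fin χ) (Fin χ) ℂ →ₗ[ℂ] Matrix (Fin χ) (Fin χ) ℂ where
  toFun X := ∑ s, A s * X * (A s)ᴴ
  map_add' X Y := by simp [mul_add, add_mul, Finset.sum_add_distrib]
  map_smul' c X := by simp [Finset.smul_sum]

/-- A left-canonical injective MPS tensor: the identity is the left dominant eigenvector of the
transfer matrix, the right one `ρ` is positive definite, the dominant eigenvalue `1` is
nondegenerate, and it is separated from the other eigenvalues by a gap. -/
structure IsCanonicalInjective {d χ : ℕ} (A : MPSTensor d χ) : Prop where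
  left_canonical : ∑ s, (A s)ᴴ * A s = 1
  right_fixed : ∃ ρ : Matrix (Fin χ) (Fin χ) ℂ, ρ.PosDef ∧ transfer A ρ = ρ
  unique : Module.finrank ℂ (Module.End.eigenspace (transfer A) 1) = 1
  gap : ∀ μ : ℂ, Module.End.HasEigenvalue (transfer A) μ → μ ≠ 1 → ‖μ‖ < 1

/-- The action of a `d' × d` matrix on the physical leg: `(M · A)^s = ∑_{s'} M_{s s'} A^{s'}`. -/
def physAct {d d' χ : ℕ} (M : Matrix (Fin d') (Fin d) ℂ) (A : MPSTensor d χ) : MPSTensor d' χ :=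
  fun s => ∑ s', M s s' • A s'

/-- `A` and `B` generate the same state on every periodic chain of `n ≥ 1` sites. -/
def SameStates {d χ χ' : ℕ} (A : MPSTensor d χ) (B : MPSTensor d χ') : Prop :=
  ∀ n : ℕ, 1 ≤ n → ∀ s : Fin n → Fin d, amplitude A s = amplitude B s

/-! ### Modulated symmetries -/

variable {G : Type} [Group G]

/-- The states generated by `A` on chains of `k` unit cells of `L` sites, `k ≥ 1`, are
eigenstates of the modulated symmetry `⨂_j U_{T^j(g)}` for all `g`. -/
def IsSymmetric (T : MulAut G) (L : ℕ) {d χ : ℕ} (U : G →* Matrix.unitaryGroup (Fin d) ℂ)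
    (A : MPSTensor d χ) : Prop :=
  ∀ k : ℕ, 1 ≤ k → ∀ g : G, ∃ θ : Circle, ∀ s : Fin (k * L) → Fin d,
    ∑ s' : Fin (k * L) → Fin d,
      (∏ j : Fin (k * L), (U ((T ^ (j : ℕ)) g)).1 (s j) (s' j)) * amplitude A s' =
        (θ : ℂ) * amplitude A s

/-- A translation invariant injective MPS (in left-canonical form), with a linear unitary
representation `U` of `G` on each site, that is symmetric under the modulated symmetry. -/
structure SymMPS (T : MulAut G) (L : ℕ) where
  d : ℕ
  χ : ℕ
  U : G →* Matrix.unitaryGroup (Fin d) ℂ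
  A : MPSTensor d χ
  injective : IsCanonicalInjective A
  symmetric : IsSymmetric T L U A

variable {T : MulAut G} {L : ℕ}

/-- The generalized push-through condition at all sites `j`,
`U_{T^j(g)} · A = φ_j(g) v_j(g)† A v_{j+1}(g)`, with bond unitaries `v_j(g) = v(T^j(g))` and
push-through phases `φ_j(g) = φ(T^j(g))`. -/
def SymMPS.PushThrough (S : SymMPS T L) (v : G → Matrix.unitaryGroup (Fin S.χ) ℂ)
    (φ : G → Circle) : Prop :=
  ∀ (j : ℕ) (g : G) (s : Fin S.d),
    physAct (S.U ((T ^ j) g)).1 S.A s =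
      (φ ((T ^ j) g) : ℂ) • ((v ((T ^ j) g)).1ᴴ * S.A s * (v ((T ^ (j + 1)) g)).1)

/-! ### Phases -/

/-- An elementary deformation of symmetric MPS. The sites of `S₀` and `S₁` are embedded,
compatibly with the symmetry, in sites carrying a common representation `R` (adding ancillary
levels), and the embedded states are the end points of a continuous path of tensors whose
interior consists of symmetric injective MPS. The tensors of the path have a fixed size; those
at the end points need not be the minimal ones, which allows the bond dimension to change. -/
def Deformation (S₀ S₁ : SymMPS T L) : Prop :=
  ∃ (d χ : ℕ) (R : G →* Matrix.unitaryGroup (Fin d) ℂ)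
    (J₀ : Matrix (Fin d) (Fin S₀.d) ℂ) (J₁ : Matrix (Fin d) (Fin S₁.d) ℂ)
    (A : ℝ → MPSTensor d χ),
    J₀ᴴ * J₀ = 1 ∧ J₁ᴴ * J₁ = 1 ∧
    (∀ g, (R g).1 * J₀ = J₀ * (S₀.U g).1) ∧ (∀ g, (R g).1 * J₁ = J₁ * (S₁.U g).1) ∧
    ContinuousOn A (Set.Icc 0 1) ∧
    (∀ t ∈ Set.Ioo (0 : ℝ) 1, IsCanonicalInjective (A t) ∧ IsSymmetric T L R (A t)) ∧
    SameStates (A 0) (physAct J₀ S₀.A) ∧ SameStates (A 1) (physAct J₁ S₁.A)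

/-- SPT phases: classes of symmetric injective MPS under the equivalence relation generated by
elementary deformations. -/
def Phase (T : MulAut G) (L : ℕ) : Type := Quot (Deformation (T := T) (L := L))

def SymMPS.phase (S : SymMPS T L) : Phase T L := Quot.mk _ S

/-- The strong SPT class is trivial: the bond unitaries can be chosen to form linear
representations of `G`. -/
def SymMPS.IsWeak (S : SymMPS T L) : Prop :=
  ∃ (v : G →* Matrix.unitaryGroup (Fin S.χ) ℂ) (φ : G → Circle), S.PushThrough v φ

/-- Weak SPT phases: the phases of the symmetric MPS with trivial strong SPT class. -/
def WeakPhase (T : MulAut G) (L : ℕ) : Type :=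
  {p : Phase T L // ∃ S : SymMPS T L, S.IsWeak ∧ S.phase = p}

def SymMPS.weakPhase (S : SymMPS T L) (h : S.IsWeak) : WeakPhase T L := ⟨S.phase, S, h, rfl⟩

/-- `S` is the stack of `S₁` and `S₂`: tensor product on physical and on virtual legs. -/
def IsStack (S₁ S₂ S : SymMPS T L) : Prop :=
  ∃ (e : Fin S₁.d × Fin S₂.d ≃ Fin S.d) (f : Fin S₁.χ × Fin S₂.χ ≃ Fin S.χ),
    (∀ a b i k j l, S.A (e (a, b)) (f (i, k)) (f (j, l)) = S₁.A a i j * S₂.A b k l) ∧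
    (∀ g a b a' b',
      (S.U g).1 (e (a, b)) (e (a', b')) = (S₁.U g).1 a a' * (S₂.U g).1 b b')

/-! ### The classifying groups -/

/-- The endomorphism `φ ↦ (φ ∘ T) / φ` of `H¹(G, U(1)) = Hom(G, U(1))`. -/
def translationDefect (T : MulAut G) : (G →* Circle) →* (G →* Circle) where
  toFun φ := φ.comp T.toMonoidHom / φ
  map_one' := by ext g; simp
  map_mul' φ ψ := by ext g; simp [mul_div_mul_comm]

/-- The group `H¹(G, U(1)) / {φ ∼ φ ∘ T}`. -/
abbrev WeakSPTGroup (T : MulAut G) : Type := (G →* Circle) ⧸ (translationDefect T).range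

/-- The weak SPT index of `S` is `x`: for bond unitaries that form a linear representation,
the push-through phases are a character with class `x`. -/
def SymMPS.HasWeakIndex (S : SymMPS T L) (x : WeakSPTGroup T) : Prop :=
  ∃ (v : G →* Matrix.unitaryGroup (Fin S.χ) ℂ) (φ : G →* Circle),
    S.PushThrough v φ ∧ (QuotientGroup.mk φ : WeakSPTGroup T) = x

/-- `U(1)` with trivial `G`-action, written additively. -/
abbrev U1 (G : Type) [Group G] : Rep ℤ G := Rep.trivial ℤ G (Additive Circle)

/-- The pullback `H²(G, U(1)) → H²(H, U(1))` along `f : H → G`. -/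
def H2pullback {H : Type} [Group H] (f : H →* G) :
    groupCohomology.H2 (U1 G) →+ groupCohomology.H2 (U1 H) :=
  (groupCohomology.map (A := U1 G) (B := U1 H) f (𝟙 (U1 H)) 2).hom.toAddMonoidHom

/-- The full symmetry group `G ⋊ ℤ` of the infinite chain, the generator of `ℤ` (translation by
one site) acting on `G` by `T`. -/
abbrev FullGroup (T : MulAut G) : Type := G ⋊[zpowersHom (MulAut G) T] (Multiplicative ℤ)

/-- The value of a `U(1)`-valued `2`-cocycle, as a complex phase. -/
def phaseOf {H : Type} [Group H] (c : groupCohomology.cocycles₂ (U1 H)) (x y : H) : Circle :=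
  Additive.toMul (c (x, y) : Additive Circle)

/-- The class in `H²(G ⋊ ℤ, U(1))` encoded in the push-through data `(v, φ)` of `S`: it is
represented by a cocycle `c` which restricts on `G` to the bond cocycle, and for which
translation `t` multiplies by `φ(g)` when it is moved past `g`, that is `[t][g] = φ(g) [T(g)][t]`
in the extension with multiplication `[x][y] = c(x, y) [x y]`. -/
def SymMPS.HasCrystallineClass (S : SymMPS T L)
    (x : groupCohomology.H2 (U1 (FullGroup T))) : Prop :=
  ∃ (v : G → Matrix.unitaryGroup (Fin S.χ) ℂ) (φ : G → Circle)
    (c : groupCohomology.cocycles₂ (U1 (FullGroup T))),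
    S.PushThrough v φ ∧
    (∀ g h : G, (v g).1 * (v h).1 =
      (phaseOf c (SemidirectProduct.inl g) (SemidirectProduct.inl h) : ℂ) • (v (g * h)).1) ∧
    (∀ g : G, phaseOf c (SemidirectProduct.inr (Multiplicative.ofAdd 1)) (SemidirectProduct.inl g) =
      φ g * phaseOf c (SemidirectProduct.inl (T g))
        (SemidirectProduct.inr (Multiplicative.ofAdd 1))) ∧
    groupCohomology.H2π (U1 (FullGroup T)) c = x

end ModulatedMPS

end

open ModulatedMPS

/-!
A cocycle of `G ⋊ ℤ` is the same as a cocycle `ω` of `G` together with a phase `φ` trivializing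
`ω / T^*ω`: in the central extension of `G` by `ω`, the phase `φ` is what is needed to lift `T` to
an automorphism, and a choice of lift of the generator of `ℤ` completes the extension of `G ⋊ ℤ`.
Push-through data `v`, `φ` are exactly of this form. Characters `φ` are the case `ω = 1`, and they
give a trivial class when `φ = (ψ ∘ T) / ψ`.

Two injective tensors are compared through their mixed transfer operator
`X ↦ ∑ₛ (A^s)† X B^s`, the traces of whose powers are the overlaps of the periodic states. If the
states are proportional along a subsequence of lengths, then it has an eigenvalue of modulus one,
and an eigenvector is, up to a scalar, a unitary gauge transformation between the tensors. Applied
to `A` and to the images of `A` under the on-site symmetries of one period, this produces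
push-through data.

An endpoint of a deformation path need not be injective, so there it only has a dominant eigenline
in common with the injective tensor `B` that generates the same states: some power of the mixed
transfer operator with `B` is a rank-one idempotent up to a small error. This is an open condition,
and the dominant eigenvector intertwines push-through data of nearby tensors with those of `B` up
to a phase. Hence the class is locally constant up to the endpoints.

Conversely, if two tensors have the same class, then their data can be chosen with the same `ω` and
`φ`. Bonds then carry projective representations with the same cocycle, so that matrix units between
the two bond spaces, as additional physical levels, transform linearly, and they connect the two
tensors by a path of block tensors. Classes are realized by the tensor of all matrix units on a
projective representation, which exists with finite dimension if `ω` is trivial or `G` is finite.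
-/

noncomputable section

namespace ModulatedMPS

open scoped Matrix ComplexOrder Topology
open Filter

section Cocycles

variable {H M : Type*} [Group H] [CommGroup M]

/-- The multiplicative 2-cocycle identity for trivial coefficients, i.e.
`groupCohomology.IsMulCocycle₂` for the trivial action of `H` on `M` and in curried form. -/
def IsCocycle (f : H → H → M) : Prop :=
  ∀ g h j, f (g * h) j * f g h = f h j * f g (h * j)

/-- The coboundary of a 1-cochain, for trivial coefficients. -/
def coboundary (b : H → M) (g h : H) : M := b g * b h / b (g * h)

lemma IsCocycle.one_left {f : H → H → M} (hf : IsCocycle f) (h : H) : f 1 h = f 1 1 := by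
  simpa using (hf 1 1 h).symm

lemma IsCocycle.one_right {f : H → H → M} (hf : IsCocycle f) (h : H) : f h 1 = f 1 1 := by
  simpa [mul_comm (f 1 1)] using hf h 1 1

lemma IsCocycle.mul {f f' : H → H → M} (hf : IsCocycle f) (hf' : IsCocycle f') :
    IsCocycle (f * f') := fun g h j => by
  simp only [Pi.mul_apply, mul_mul_mul_comm, hf g h j, hf' g h j]

lemma IsCocycle.div {f f' : H → H → M} (hf : IsCocycle f) (hf' : IsCocycle f') :
    IsCocycle (f / f') := fun g h j => by
  simp only [Pi.div_apply, div_mul_div_comm, hf g h j, hf' g h j]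

lemma isCocycle_one : IsCocycle (1 : H → H → M) := fun _ _ _ => rfl

lemma isCocycle_coboundary (b : H → M) : IsCocycle (coboundary b) := fun g h j => by
  simp only [coboundary, mul_assoc, div_mul_div_comm]
  rw [div_eq_div_iff_mul_eq_mul]
  generalize b (g * (h * j)) = c
  ac_rfl

lemma coboundary_inv (b : H → M) : coboundary b⁻¹ = (coboundary b)⁻¹ := by
  funext g h
  simp [coboundary, div_eq_mul_inv, mul_comm]

@[simp]
lemma coboundary_one : coboundary (1 : H → M) = 1 := by
  funext g h
  simp [coboundary]

/-- Associativity of products in `E` is the cocycle identity for the factor set of a projective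
section `s`. -/
lemma isCocycle_of_mul_eq {E : Type*} [Monoid E] {i : M → E} {s : H → E} {f : H → H → M}
    (hi : ∀ a b h, i a * (i b * s h) = i (a * b) * s h) (hcomm : ∀ a h, s h * i a = i a * s h)
    (hinj : ∀ h, Function.Injective fun a => i a * s h)
    (hs : ∀ g h, s g * s h = i (f g h) * s (g * h)) : IsCocycle f := fun g h j => by
  refine hinj (g * h * j) ?_
  calc i (f (g * h) j * f g h) * s (g * h * j)
      = s g * s h * s j := by rw [hs, mul_assoc (i _), hs, hi, mul_comm (f g h)]
    _ = s g * i (f h j) * s (h * j) := by rw [mul_assoc, hs, mul_assoc]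
    _ = i (f h j * f g (h * j)) * s (g * h * j) := by
      rw [hcomm, mul_assoc, hs, hi, mul_assoc g]

/-- The central extension of `H` by `M` with factor set `f`, as pairs multiplied by
`(a, g) (b, h) = (a b f(g, h), g h)`. The proof `hf` is a parameter so that the group structure
is an instance. -/
@[ext]
structure CentralExtension {f : H → H → M} (hf : IsCocycle f) where
  phase : M
  base : H

namespace CentralExtension

variable {f : H → H → M} {hf : IsCocycle f}

instance : Mul (CentralExtension hf) :=
  ⟨fun x y => ⟨x.phase * y.phase * f x.base y.base, x.base * y.base⟩⟩

instance : One (CentralExtension hf) := ⟨⟨(f 1 1)⁻¹, 1⟩⟩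

instance : Inv (CentralExtension hf) :=
  ⟨fun x => ⟨x.phase⁻¹ * (f x.base⁻¹ x.base)⁻¹ * (f 1 1)⁻¹, x.base⁻¹⟩⟩

@[simp]
lemma mul_phase (x y : CentralExtension hf) :
    (x * y).phase = x.phase * y.phase * f x.base y.base := rfl

@[simp]
lemma mul_base (x y : CentralExtension hf) : (x * y).base = x.base * y.base := rfl

@[simp]
lemma one_phase : (1 : CentralExtension hf).phase = (f 1 1)⁻¹ := rfl

@[simp]
lemma one_base : (1 : CentralExtension hf).base = 1 := rfl

instance : Group (CentralExtension hf) :=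
  Group.ofLeftAxioms
    (fun x y z => CentralExtension.ext
      (by
        calc x.phase * y.phase * f x.base y.base * z.phase * f (x.base * y.base) z.base
            = x.phase * y.phase * z.phase * (f (x.base * y.base) z.base * f x.base y.base) := by
              ac_rfl
          _ = x.phase * (y.phase * z.phase * f y.base z.base) * f x.base (y.base * z.base) := by
              rw [hf]; ac_rfl)
      (mul_assoc _ _ _))
    (fun x => CentralExtension.ext (by simp [hf.one_left]) (one_mul _))
    (fun x => CentralExtension.ext
      (by
        change x.phase⁻¹ * (f x.base⁻¹ x.base)⁻¹ * (f 1 1)⁻¹ * x.phase * f x.base⁻¹ x.base =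
          (f 1 1)⁻¹
        rw [← mul_inv, ← mul_inv, mul_assoc, inv_mul_eq_iff_eq_mul, mul_inv_cancel_right])
      (inv_mul_cancel _))

/-- The projection of the central extension onto its quotient. -/
def proj (hf : IsCocycle f) : CentralExtension hf →* H where
  toFun := base
  map_one' := rfl
  map_mul' _ _ := rfl

end CentralExtension

lemma IsCocycle.exists_eq_coboundary {f : H → H → M} (hf : IsCocycle f)
    (s : H →* CentralExtension hf) (hs : ∀ h, (s h).base = h) : ∃ b, f = coboundary b := by
  refine ⟨fun h => (s h).phase⁻¹, funext₂ fun g h => ?_⟩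
  have hgh := congrArg CentralExtension.phase (map_mul s g h)
  simp only [CentralExtension.mul_phase, hs] at hgh
  simp only [coboundary, hgh, ← mul_inv, div_inv_eq_mul, inv_mul_cancel_left]

end Cocycles

section FullGroup

variable {G : Type} [Group G] {T : MulAut G}

open SemidirectProduct

namespace FullGroup

variable (T) in
/-- The translation by one site, i.e. the generator of `ℤ` in `G ⋊ ℤ`. -/
abbrev translation : FullGroup T := inr (Multiplicative.ofAdd 1)

lemma translation_mul_inl (g : G) : translation T * inl g = inl (T g) * translation T := by
  ext <;> simp

variable {E : Type*} [Group E]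

lemma map_zpow_apply_eq_conj (f : G →* E) (t : E) (h : ∀ g, t * f g = f (T g) * t) (n : ℤ)
    (g : G) : f ((T ^ n) g) = t ^ n * f g * (t ^ n)⁻¹ := by
  induction n generalizing g with
  | zero => simp
  | succ n ih =>
    rw [zpow_add_one, MulAut.mul_apply, ih, zpow_add_one, eq_mul_inv_of_mul_eq (h g).symm]
    group
  | pred n ih =>
    have hinv := h (T⁻¹ g)
    rw [MulAut.apply_inv_self] at hinv
    rw [zpow_sub_one, MulAut.mul_apply, ih, zpow_sub_one, eq_inv_mul_of_mul_eq hinv]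
    group

/-- The universal property of `G ⋊ ℤ`. -/
def lift (f : G →* E) (t : E) (h : ∀ g, t * f g = f (T g) * t) : FullGroup T →* E :=
  SemidirectProduct.lift f (zpowersHom E t) fun n => by
    ext g
    exact map_zpow_apply_eq_conj f t h n.toAdd g

@[simp]
lemma lift_inl (f : G →* E) (t : E) (h : ∀ g, t * f g = f (T g) * t) (g : G) :
    lift f t h (inl g) = f g := by
  simp [lift]

@[simp]
lemma lift_translation (f : G →* E) (t : E) (h : ∀ g, t * f g = f (T g) * t) :
    lift f t h (translation T) = t := by
  simp [lift]

lemma hom_ext {f f' : FullGroup T →* E} (hG : ∀ g, f (inl g) = f' (inl g))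
    (ht : f (translation T) = f' (translation T)) : f = f' :=
  SemidirectProduct.hom_ext (MonoidHom.ext hG) (MonoidHom.ext_mint ht)

end FullGroup

open FullGroup

variable {M : Type*} [CommGroup M]

/-- The restriction of `f` to `G` is `ω`, and moving a translation past `g` costs `φ g`: the two
conditions on cocycles in `SymMPS.HasCrystallineClass`. -/
structure Extends (T : MulAut G) (f : FullGroup T → FullGroup T → M) (ω : G → G → M)
    (φ : G → M) : Prop where
  inl_inl : ∀ g h, f (inl g) (inl h) = ω g h
  translation_inl : ∀ g, f (translation T) (inl g) = φ g * f (inl (T g)) (translation T)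

section Extends

variable {f f' : FullGroup T → FullGroup T → M} {ω ω' : G → G → M} {φ φ' : G → M}

lemma extends_self (f : FullGroup T → FullGroup T → M) :
    Extends T f (fun g h => f (inl g) (inl h))
      (fun g => f (translation T) (inl g) / f (inl (T g)) (translation T)) :=
  ⟨fun _ _ => rfl, fun _ => (div_mul_cancel _ _).symm⟩

namespace Extends

lemma unique (h : Extends T f ω φ) (h' : Extends T f ω' φ') : ω = ω' ∧ φ = φ' :=
  ⟨funext₂ fun g k => (h.inl_inl g k).symm.trans (h'.inl_inl g k),
    funext fun g => mul_right_cancel ((h.translation_inl g).symm.trans (h'.translation_inl g))⟩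

lemma mul (h : Extends T f ω φ) (h' : Extends T f' ω' φ') :
    Extends T (f * f') (ω * ω') (φ * φ') where
  inl_inl g k := by simp only [Pi.mul_apply, h.inl_inl, h'.inl_inl]
  translation_inl g := by
    simp only [Pi.mul_apply, h.translation_inl, h'.translation_inl, mul_mul_mul_comm]

lemma div (h : Extends T f ω φ) (h' : Extends T f' ω' φ') :
    Extends T (f / f') (ω / ω') (φ / φ') where
  inl_inl g k := by simp only [Pi.div_apply, h.inl_inl, h'.inl_inl]
  translation_inl g := by
    simp only [Pi.div_apply, h.translation_inl, h'.translation_inl, mul_div_mul_comm]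

lemma mul_coboundary (h : Extends T f ω φ) (b : FullGroup T → M) :
    Extends T (f * coboundary b) (ω * coboundary (b ∘ inl))
      (φ * (b ∘ inl / b ∘ inl ∘ T)) := by
  refine h.mul ⟨fun g k => ?_, fun g => ?_⟩
  · simp only [coboundary, Function.comp_apply, map_mul]
  · simp only [coboundary, Pi.div_apply, Function.comp_apply, ← translation_mul_inl,
      div_mul_div_comm]
    rw [mul_left_comm (b (inl g)), mul_div_mul_left_eq_div, mul_comm]

end Extends

/-- As `ℤ` is free, a splitting of the central extension over `G` that is equivariant under
translation extends to `G ⋊ ℤ`. -/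
lemma IsCocycle.exists_eq_coboundary_of_extends_one (hf : IsCocycle f) (h : Extends T f 1 1) :
    ∃ b, f = coboundary b := by
  let σ : G →* CentralExtension hf := MonoidHom.mk' (fun g => ⟨1, inl g⟩) fun g k =>
    CentralExtension.ext (by simp [h.inl_inl]) (map_mul _ _ _)
  let τ : CentralExtension hf := ⟨1, translation T⟩
  have hστ (g : G) : τ * σ g = σ (T g) * τ := CentralExtension.ext
    (by simp [σ, τ, h.translation_inl]) (translation_mul_inl g)
  have hsection : (CentralExtension.proj hf).comp (FullGroup.lift σ τ hστ) = MonoidHom.id _ :=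
    FullGroup.hom_ext (fun g => by simp [CentralExtension.proj, σ])
      (by simp [CentralExtension.proj, τ])
  exact hf.exists_eq_coboundary _ (DFunLike.congr_fun hsection)

end Extends

/-- A pair of a 2-cocycle `ω` of `G` and a 1-cochain `φ` that trivializes `ω / T^*ω`. Such pairs
are the 2-cocycles of the double complex `C^*(ℤ, C^*(G))` computing the cohomology of `G ⋊ ℤ`;
the bond cocycle and the push-through phases of a symmetric MPS form one. -/
structure IsCrystallineCocycle (T : MulAut G) (ω : G → G → M) (φ : G → M) : Prop where
  isCocycle : IsCocycle ω
  translate : ∀ g h, φ (g * h) * ω g h = φ g * φ h * ω (T g) (T h)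

lemma isCrystallineCocycle_one_left_iff {φ : G → M} :
    IsCrystallineCocycle T 1 φ ↔ ∀ g h, φ (g * h) = φ g * φ h :=
  ⟨fun h a b => by simpa using h.translate a b, fun h => ⟨isCocycle_one, by simpa using h⟩⟩

namespace IsCrystallineCocycle

variable {ω : G → G → M} {φ : G → M}

lemma map_one (h : IsCrystallineCocycle T ω φ) : φ 1 = 1 := by
  simpa using h.translate 1 1

/-- The lift of the automorphism `T` to the central extension of `G` by `ω`. -/
def translateAut (h : IsCrystallineCocycle T ω φ) : MulAut (CentralExtension h.isCocycle) where
  toFun x := ⟨x.phase * φ x.base, T x.base⟩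
  invFun x := ⟨x.phase * (φ (T⁻¹ x.base))⁻¹, T⁻¹ x.base⟩
  left_inv x := by simp
  right_inv x := by simp
  map_mul' x y := CentralExtension.ext
    (by
      simp only [CentralExtension.mul_phase, CentralExtension.mul_base]
      calc x.phase * y.phase * ω x.base y.base * φ (x.base * y.base)
          = x.phase * y.phase * (φ (x.base * y.base) * ω x.base y.base) := by ac_rfl
        _ = _ := by rw [h.translate]; ac_rfl)
    (map_mul _ _ _)

lemma base_translateAut_zpow (h : IsCrystallineCocycle T ω φ) (n : ℤ)
    (x : CentralExtension h.isCocycle) : ((h.translateAut ^ n) x).base = (T ^ n) x.base := by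
  induction n generalizing x with
  | zero => rfl
  | succ n ih => rw [zpow_add_one, zpow_add_one, MulAut.mul_apply, ih]; rfl
  | pred n ih => rw [zpow_sub_one, zpow_sub_one, MulAut.mul_apply, ih]; rfl

lemma translateAut_zpow_apply_central (h : IsCrystallineCocycle T ω φ) (n : ℤ) (a : M) :
    (h.translateAut ^ n) ⟨a, 1⟩ = ⟨a, 1⟩ := by
  have hfix : h.translateAut ⟨a, 1⟩ = ⟨a, 1⟩ :=
    CentralExtension.ext (by simp [translateAut, h.map_one]) (_root_.map_one T)
  exact MulAction.mem_stabilizer_iff.1 <| zpow_mem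
    (MulAction.mem_stabilizer_iff.2 hfix : h.translateAut ∈ MulAction.stabilizer _ _) n

/-- The canonical set-theoretic section of the extension of `G ⋊ ℤ` obtained by letting `ℤ` act
on the central extension of `G`. -/
def canonicalSection (h : IsCrystallineCocycle T ω φ) (x : FullGroup T) :
    CentralExtension h.isCocycle ⋊[zpowersHom _ h.translateAut] Multiplicative ℤ :=
  ⟨⟨1, x.left⟩, x.right⟩

/-- The factor set of `canonicalSection`. -/
def toFullGroup (h : IsCrystallineCocycle T ω φ) (x y : FullGroup T) : M :=
  (h.canonicalSection x * h.canonicalSection y).left.phase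

lemma isCocycle_toFullGroup (h : IsCrystallineCocycle T ω φ) : IsCocycle h.toFullGroup := by
  let i (a : M) : CentralExtension h.isCocycle ⋊[zpowersHom _ h.translateAut] Multiplicative ℤ :=
    inl ⟨a * (ω 1 1)⁻¹, 1⟩
  have hi (a : M) (x : CentralExtension h.isCocycle) (n : Multiplicative ℤ) :
      i a * ⟨x, n⟩ = ⟨⟨a * x.phase, x.base⟩, n⟩ :=
    SemidirectProduct.ext
      (CentralExtension.ext (by simp [i, h.isCocycle.one_left, mul_right_comm a])
        (by simp [i]))
      (by simp [i])
  refine isCocycle_of_mul_eq (i := i) (s := h.canonicalSection) (fun a b x => ?_) (fun a x => ?_)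
    (fun x a b hab => ?_) (fun x y => ?_)
  · simp only [canonicalSection, hi, mul_one]
  · rw [canonicalSection, hi]
    refine SemidirectProduct.ext ?_ (by simp [i])
    simp only [i, mul_left, left_inl, zpowersHom_apply, h.translateAut_zpow_apply_central]
    exact CentralExtension.ext (by simp [h.isCocycle.one_right, mul_comm]) (by simp)
  · simpa [canonicalSection, hi] using congrArg (fun y => y.left.phase) hab
  · rw [canonicalSection.eq_def h (x * y), hi]
    refine SemidirectProduct.ext (CentralExtension.ext (by simp [toFullGroup]) ?_) rfl
    simp [canonicalSection, h.base_translateAut_zpow]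

lemma toFullGroup_apply (h : IsCrystallineCocycle T ω φ) (x y : FullGroup T) :
    h.toFullGroup x y = ((⟨1, x.left⟩ : CentralExtension h.isCocycle) *
      (h.translateAut ^ x.right.toAdd) ⟨1, y.left⟩).phase := rfl

lemma toFullGroup_inl (h : IsCrystallineCocycle T ω φ) (g k : G) :
    h.toFullGroup (inl g) (inl k) = ω g k := by
  simp [toFullGroup_apply]

lemma toFullGroup_translation_inl (h : IsCrystallineCocycle T ω φ) (g : G) :
    h.toFullGroup (translation T) (inl g) =
      φ g * h.toFullGroup (inl (T g)) (translation T) := by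
  simp [toFullGroup_apply, translateAut, h.isCocycle.one_left, h.isCocycle.one_right]

end IsCrystallineCocycle

variable {f : FullGroup T → FullGroup T → M} {ω : G → G → M} {φ : G → M}

/-- Evaluate the cocycle identity along the three ways of moving the translation past `a b`. -/
lemma Extends.isCrystallineCocycle (hf : IsCocycle f) (h : Extends T f ω φ) :
    IsCrystallineCocycle T ω φ where
  isCocycle a b c := by simpa only [← map_mul, h.inl_inl] using hf (inl a) (inl b) (inl c)
  translate a b := by
    have h₁ := hf (translation T) (inl a) (inl b)
    have h₂ := hf (inl (T a)) (translation T) (inl b)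
    have h₃ := hf (inl (T a)) (inl (T b)) (translation T)
    rw [translation_mul_inl, ← map_mul, h.inl_inl, h.translation_inl, h.translation_inl] at h₁
    rw [translation_mul_inl, h.translation_inl] at h₂
    rw [← map_mul, ← map_mul, h.inl_inl] at h₃
    refine mul_right_cancel (b := f (inl (T (a * b))) (translation T)) ?_
    calc φ (a * b) * ω a b * f (inl (T (a * b))) (translation T)
        = ω a b * (φ (a * b) * f (inl (T (a * b))) (translation T)) := by ac_rfl
      _ = φ a * (f (inl (T a) * translation T) (inl b) * f (inl (T a)) (translation T)) := by
        rw [← h₁]; ac_rfl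
      _ = φ a * φ b *
          (f (inl (T b)) (translation T) * f (inl (T a)) (inl (T b) * translation T)) := by
        rw [h₂]; ac_rfl
      _ = _ := by rw [← h₃]; ac_rfl

end FullGroup

section Cohomology

open groupCohomology CategoryTheory

variable {H : Type} [Group H]

/-- The class `x ∈ H²(H, U(1))` is represented by the multiplicative cocycle `f`. -/
def Represents (f : H → H → Circle) (x : H2 (U1 H)) : Prop :=
  ∃ c : cocycles₂ (U1 H), phaseOf c = f ∧ H2π (U1 H) c = x

lemma isCocycle_phaseOf (c : cocycles₂ (U1 H)) : IsCocycle (phaseOf c) :=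
  (mem_cocycles₂_iff c.1).1 c.2

lemma IsCocycle.exists_represents {f : H → H → Circle} (hf : IsCocycle f) :
    ∃ x, Represents f x :=
  ⟨_, ⟨fun p => Additive.ofMul (f p.1 p.2), (mem_cocycles₂_iff (A := U1 H) _).2 hf⟩, rfl, rfl⟩

lemma exists_represents (x : H2 (U1 H)) : ∃ f, Represents f x := by
  induction x using H2_induction_on with
  | h c => exact ⟨phaseOf c, c, rfl, rfl⟩

lemma represents_one : Represents (1 : H → H → Circle) 0 :=
  ⟨0, rfl, map_zero _⟩

namespace Represents

variable {f f' : H → H → Circle} {x x' : H2 (U1 H)}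

lemma isCocycle (h : Represents f x) : IsCocycle f := by
  obtain ⟨c, rfl, -⟩ := h
  exact isCocycle_phaseOf c

lemma eq_iff (h : Represents f x) (h' : Represents f' x') :
    x = x' ↔ ∃ b, f = f' * coboundary b := by
  obtain ⟨c, rfl, rfl⟩ := h
  obtain ⟨c', rfl, rfl⟩ := h'
  rw [H2π_eq_iff]
  refine (Equiv.arrowCongr (Equiv.refl H) Additive.toMul).exists_congr fun b => ?_
  rw [funext_iff, Prod.forall, funext_iff]
  refine forall_congr' fun g => ?_
  rw [funext_iff]
  refine forall_congr' fun h => ?_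
  have hd : coboundary (fun g => Additive.toMul (α := Circle) (b g)) g h =
      Additive.toMul (α := Circle) (d₁₂ (U1 H) b (g, h)) :=
    (congrArg (· / _) (mul_comm _ _)).trans (mul_div_right_comm _ _ _)
  rw [Pi.mul_apply, Pi.mul_apply, mul_comm, ← div_eq_iff_eq_mul, eq_comm]
  exact (Eq.congr_right hd).symm

lemma unique (h : Represents f x) (h' : Represents f x') : x = x' :=
  (h.eq_iff h').2 ⟨1, by simp⟩

lemma add (h : Represents f x) (h' : Represents f' x') : Represents (f * f') (x + x') := by
  obtain ⟨c, rfl, rfl⟩ := h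
  obtain ⟨c', rfl, rfl⟩ := h'
  exact ⟨c + c', rfl, map_add _ _ _⟩

lemma mul_coboundary (h : Represents f x) (b : H → Circle) : Represents (f * coboundary b) x := by
  obtain ⟨y, hy⟩ := (h.isCocycle.mul (isCocycle_coboundary b)).exists_represents
  exact (hy.eq_iff h).2 ⟨b, rfl⟩ ▸ hy

lemma pullback {K : Type} [Group K] (p : K →* H) (h : Represents f x) :
    Represents (fun g k => f (p g) (p k)) (H2pullback p x) := by
  obtain ⟨c, rfl, rfl⟩ := h
  exact ⟨mapCocycles₂ (A := U1 H) (B := U1 K) p (𝟙 (U1 K)) c, rfl,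
    (H2π_comp_map_apply (A := U1 H) (B := U1 K) p (𝟙 (U1 K)) c).symm⟩

end Represents

end Cohomology

section Crystalline

open groupCohomology SemidirectProduct FullGroup

variable {G : Type} [Group G] {T : MulAut G}

/-- The class `x ∈ H²(G ⋊ ℤ, U(1))` is the one of the crystalline cocycle `(ω, φ)`. -/
def Encodes (T : MulAut G) (ω : G → G → Circle) (φ : G → Circle) (x : H2 (U1 (FullGroup T))) :
    Prop :=
  ∃ f, Represents f x ∧ Extends T f ω φ

lemma IsCrystallineCocycle.exists_encodes {ω : G → G → Circle} {φ : G → Circle}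
    (h : IsCrystallineCocycle T ω φ) : ∃ x, Encodes T ω φ x := by
  obtain ⟨x, hx⟩ := h.isCocycle_toFullGroup.exists_represents
  exact ⟨x, _, hx, h.toFullGroup_inl, h.toFullGroup_translation_inl⟩

lemma exists_encodes (x : H2 (U1 (FullGroup T))) : ∃ ω φ, Encodes T ω φ x := by
  obtain ⟨f, hf⟩ := exists_represents x
  exact ⟨_, _, f, hf, extends_self f⟩

namespace Encodes

variable {x x' : H2 (U1 (FullGroup T))} {ω ω' : G → G → Circle} {φ φ' : G → Circle}

lemma isCrystallineCocycle (h : Encodes T ω φ x) : IsCrystallineCocycle T ω φ := by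
  obtain ⟨f, hf, h⟩ := h
  exact h.isCrystallineCocycle hf.isCocycle

lemma add (h : Encodes T ω φ x) (h' : Encodes T ω' φ' x') :
    Encodes T (ω * ω') (φ * φ') (x + x') := by
  obtain ⟨f, hf, h⟩ := h
  obtain ⟨f', hf', h'⟩ := h'
  exact ⟨_, hf.add hf', h.mul h'⟩

lemma mul_coboundary (h : Encodes T ω φ x) (z : G → Circle) :
    Encodes T (ω * coboundary z) (φ * (z / z ∘ T)) x := by
  obtain ⟨f, hf, h⟩ := h
  exact ⟨_, hf.mul_coboundary (z ∘ SemidirectProduct.left), h.mul_coboundary _⟩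

lemma eq_iff (h : Encodes T ω φ x) (h' : Encodes T ω' φ' x') :
    x = x' ↔ ∃ z, ω = ω' * coboundary z ∧ φ = φ' * (z / z ∘ T) := by
  constructor
  · rintro rfl
    obtain ⟨f, hf, h⟩ := h
    obtain ⟨f', hf', h'⟩ := h'
    obtain ⟨b, rfl⟩ := (hf.eq_iff hf').1 rfl
    exact ⟨b ∘ inl, h.unique (h'.mul_coboundary b)⟩
  · rintro ⟨z, rfl, rfl⟩
    obtain ⟨f, hf, h⟩ := h
    obtain ⟨f', hf', h'⟩ := h'.mul_coboundary z
    obtain ⟨b, hb⟩ := (hf.isCocycle.div hf'.isCocycle).exists_eq_coboundary_of_extends_one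
      (by simpa only [div_self'] using h.div h')
    exact (hf.eq_iff hf').2 ⟨b, by rw [← hb, mul_div_cancel]⟩

lemma unique (h : Encodes T ω φ x) (h' : Encodes T ω φ x') : x = x' :=
  (h.eq_iff h').2 ⟨1, by simp, funext fun g => by simp⟩

lemma pullback_inl (h : Encodes T ω φ x) :
    Represents ω (H2pullback (inl : G →* FullGroup T) x) := by
  obtain ⟨f, hf, h⟩ := h
  simpa only [h.inl_inl] using hf.pullback (inl : G →* FullGroup T)

lemma exists_character (h : Encodes T ω φ x)
    (hx : H2pullback (inl : G →* FullGroup T) x = 0) :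
    ∃ (z : G → Circle) (χ : G →* Circle), ω * coboundary z = 1 ∧ φ * (z / z ∘ T) = χ := by
  obtain ⟨b, rfl⟩ := (h.pullback_inl.eq_iff represents_one).1 hx
  have htwist := h.mul_coboundary b⁻¹
  rw [one_mul, coboundary_inv, mul_inv_cancel] at htwist
  exact ⟨b⁻¹, MonoidHom.mk' _ (isCrystallineCocycle_one_left_iff.1 htwist.isCrystallineCocycle),
    by rw [one_mul, coboundary_inv, mul_inv_cancel], rfl⟩

end Encodes

lemma exists_encodes_character (φ : G →* Circle) :
    ∃ x : H2 (U1 (FullGroup T)), Encodes T 1 φ x :=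
  (isCrystallineCocycle_one_left_iff.2 φ.map_mul).exists_encodes

variable (T) in
/-- The class in `H²(G ⋊ ℤ, U(1))` of the crystalline cocycle `(1, φ)`, for a character `φ`. -/
def characterClass : (G →* Circle) →* Multiplicative (H2 (U1 (FullGroup T))) :=
  MonoidHom.mk' (fun φ => .ofAdd (exists_encodes_character φ).choose) fun φ ψ =>
    congrArg Multiplicative.ofAdd <| (exists_encodes_character (φ * ψ)).choose_spec.unique <| by
      have h := (exists_encodes_character (T := T) φ).choose_spec.add
        (exists_encodes_character ψ).choose_spec
      rwa [one_mul] at h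

lemma encodes_characterClass (φ : G →* Circle) : Encodes T 1 φ (characterClass T φ).toAdd :=
  (exists_encodes_character φ).choose_spec

lemma characterClass_eq_iff {φ ψ : G →* Circle} :
    characterClass T φ = characterClass T ψ ↔
      (QuotientGroup.mk φ : WeakSPTGroup T) = QuotientGroup.mk ψ := by
  rw [← Multiplicative.toAdd.injective.eq_iff,
    (encodes_characterClass φ).eq_iff (encodes_characterClass ψ), QuotientGroup.eq]
  constructor
  · rintro ⟨z, hz, hφ⟩
    have hmul (g h : G) : z (g * h) = z g * z h := by
      simpa [coboundary, eq_comm, div_eq_one] using congrFun₂ hz g h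
    refine ⟨MonoidHom.mk' z hmul, MonoidHom.ext fun g => ?_⟩
    simp [translationDefect, hφ]
  · rintro ⟨z, hz⟩
    refine ⟨z, ?_, funext fun g => ?_⟩
    · funext g h
      simp [coboundary]
    · have hzg : z (T g) / z g = (φ g)⁻¹ * ψ g := DFunLike.congr_fun hz g
      change φ g = ψ g * (z g / z (T g))
      rw [← inv_div (z (T g)), hzg, mul_inv_rev, inv_inv, mul_inv_cancel_left]

variable (T) in
/-- The homomorphism `W → H²(G ⋊ ℤ, U(1))` induced by the classes of the crystalline cocycles
`(1, φ)`. -/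
def inflation : Additive (WeakSPTGroup T) →+ H2 (U1 (FullGroup T)) :=
  MonoidHom.toAdditiveLeft <| QuotientGroup.lift _ (characterClass T) fun φ hφ => by
    rw [MonoidHom.mem_ker, ← map_one (characterClass T), characterClass_eq_iff, QuotientGroup.eq]
    simpa using hφ

lemma encodes_inflation (φ : G →* Circle) :
    Encodes T 1 φ (inflation T (.ofMul (φ : WeakSPTGroup T))) :=
  encodes_characterClass φ

lemma inflation_injective : Function.Injective (inflation T) := by
  intro a b hab
  obtain ⟨φ, hφ⟩ := QuotientGroup.mk_surjective a.toMul
  obtain ⟨ψ, hψ⟩ := QuotientGroup.mk_surjective b.toMul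
  rw [← ofMul_toMul a, ← ofMul_toMul b, ← hφ, ← hψ] at hab ⊢
  exact congrArg Additive.ofMul (characterClass_eq_iff.1 hab)

lemma H2pullback_inl_eq_zero_iff (x : H2 (U1 (FullGroup T))) :
    H2pullback (inl : G →* FullGroup T) x = 0 ↔ ∃ y, inflation T y = x := by
  constructor
  · intro hx
    obtain ⟨ω, φ, h⟩ := exists_encodes x
    obtain ⟨z, χ, hω, hχ⟩ := h.exists_character hx
    have htwist := h.mul_coboundary z
    rw [hω, hχ] at htwist
    exact ⟨_, (encodes_inflation χ).unique htwist⟩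
  · rintro ⟨y, rfl⟩
    obtain ⟨φ, hφ⟩ := QuotientGroup.mk_surjective y.toMul
    rw [← ofMul_toMul y, ← hφ]
    exact (encodes_inflation φ).pullback_inl.unique represents_one

lemma H2pullback_eq_self_iff (z : H2 (U1 G)) :
    H2pullback T.toMonoidHom z = z ↔ ∃ x, H2pullback (inl : G →* FullGroup T) x = z := by
  constructor
  · intro hz
    obtain ⟨ω, hω⟩ := exists_represents z
    obtain ⟨φ, hφ⟩ := (hω.eq_iff (hω.pullback T.toMonoidHom)).1 hz.symm
    have h : IsCrystallineCocycle T ω φ := ⟨hω.isCocycle, fun a b => by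
      rw [congrFun₂ hφ a b, Pi.mul_apply, Pi.mul_apply, coboundary, mul_left_comm, mul_div_cancel,
        mul_comm]
      rfl⟩
    obtain ⟨x, hx⟩ := h.exists_encodes
    exact ⟨x, hx.pullback_inl.unique hω⟩
  · rintro ⟨x, rfl⟩
    obtain ⟨ω, φ, h⟩ := exists_encodes x
    refine ((h.pullback_inl.pullback T.toMonoidHom).eq_iff h.pullback_inl).2
      ⟨φ⁻¹, funext₂ fun a b => ?_⟩
    have htranslate := h.isCrystallineCocycle.translate a b
    rw [coboundary_inv, ← div_eq_mul_inv, Pi.div_apply, Pi.div_apply, eq_div_iff_mul_eq',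
      coboundary, MulEquiv.coe_toMonoidHom, ← mul_div_assoc,
      mul_comm (ω _ _), ← htranslate, mul_div_cancel_left]

end Crystalline

section Powers

lemma tendsto_pow_zero_of_spectralRadius_lt_one {A : Type*} [NormedRing A] [NormedAlgebra ℂ A]
    [CompleteSpace A] {a : A} (h : spectralRadius ℂ a < 1) :
    Tendsto (fun n => a ^ n) atTop (𝓝 0) := by
  obtain ⟨r, hr, hr1⟩ := ENNReal.lt_iff_exists_nnreal_btwn.1 h
  have hgelfand :=
    (spectrum.pow_nnnorm_pow_one_div_tendsto_nhds_spectralRadius a).eventually_lt_const hr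
  refine squeeze_zero_norm' (a := fun n => (r : ℝ) ^ n) ?_
    (tendsto_pow_atTop_nhds_zero_of_lt_one r.2 (by exact_mod_cast hr1))
  filter_upwards [hgelfand, eventually_gt_atTop 0] with n hn h0
  have hle := ENNReal.rpow_le_rpow hn.le (Nat.cast_nonneg (α := ℝ) n)
  rw [← ENNReal.rpow_mul, one_div, inv_mul_cancel₀ (by positivity), ENNReal.rpow_one,
    ENNReal.rpow_natCast] at hle
  exact_mod_cast hle

variable {V : Type*} [NormedAddCommGroup V] [NormedSpace ℂ V]

lemma tendsto_pow_zero_of_eigenvalues [FiniteDimensional ℂ V] (f : V →L[ℂ] V)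
    (hf : ∀ (μ : ℂ) (x : V), x ≠ 0 → f x = μ • x → ‖μ‖ < 1) :
    Tendsto (fun n => f ^ n) atTop (𝓝 0) := by
  have : CompleteSpace V := FiniteDimensional.complete ℂ V
  rcases subsingleton_or_nontrivial V with hV | hV
  · simp [fun n => (ContinuousLinearMap.ext fun _ => Subsingleton.elim _ _ : f ^ n = 0)]
  refine tendsto_pow_zero_of_spectralRadius_lt_one
    (spectrum.spectralRadius_lt_of_forall_lt (r := 1) f fun z hz => ?_)
  have hz' : z ∈ spectrum ℂ (f : V →ₗ[ℂ] V) := by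
    rw [← AlgEquiv.spectrum_eq (Module.End.toContinuousLinearMap V (𝕜 := ℂ)) (f : V →ₗ[ℂ] V)]
    exact hz
  obtain ⟨x, hx⟩ := (Module.End.hasEigenvalue_iff_mem_spectrum.2 hz').exists_hasEigenvector
  exact_mod_cast hf z x hx.2 hx.apply_eq_smul

lemma tendsto_trace_pow_zero_of_eigenvalues [FiniteDimensional ℂ V] {f : Module.End ℂ V}
    (hf : ∀ (μ : ℂ) (x : V), x ≠ 0 → f x = μ • x → ‖μ‖ < 1) :
    Tendsto (fun n => LinearMap.trace ℂ V (f ^ n)) atTop (𝓝 0) := by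
  let Φ := Module.End.toContinuousLinearMap V (𝕜 := ℂ)
  let tr : (V →L[ℂ] V) →ₗ[ℂ] ℂ := LinearMap.trace ℂ V ∘ₗ Φ.symm.toLinearMap
  have htr := (LinearMap.continuous_of_finiteDimensional tr).tendsto 0
  rw [map_zero] at htr
  refine (htr.comp (tendsto_pow_zero_of_eigenvalues (Φ f) hf)).congr fun n => ?_
  rw [Function.comp_apply, ← map_pow]
  exact congrArg _ (Φ.symm_apply_apply _)

/-- Off the fixed line, `f` acts as its restriction to the invariant hyperplane `ker ℓ`, hence as
the deflated operator `f - ℓ(·) e`. -/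
lemma tendsto_pow_apply_of_eigenvalues [FiniteDimensional ℂ V] {f : Module.End ℂ V}
    {ℓ : Module.Dual ℂ V} {e : V} (hfe : f e = e) (hℓf : ∀ x, ℓ (f x) = ℓ x) (hℓe : ℓ e = 1)
    (hf : ∀ (μ : ℂ) (x : V), x ≠ 0 → ℓ x = 0 → f x = μ • x → ‖μ‖ < 1) (x : V) :
    Tendsto (fun n => (f ^ n) x) atTop (𝓝 (ℓ x • e)) := by
  let g : V →L[ℂ] V := LinearMap.toContinuousLinearMap (f - LinearMap.smulRight ℓ e)
  have hg (y : V) : g y = f y - ℓ y • e := rfl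
  have hℓg (y : V) : ℓ (g y) = 0 := by rw [hg, map_sub, hℓf, map_smul, hℓe]; simp
  have hlim : Tendsto (fun n => g ^ n) atTop (𝓝 0) := by
    refine tendsto_pow_zero_of_eigenvalues g fun μ y hy hgy => ?_
    rcases eq_or_ne μ 0 with rfl | hμ
    · simp
    have hℓy : ℓ y = 0 := by
      have := hℓg y
      rw [hgy, map_smul, smul_eq_mul] at this
      exact (mul_eq_zero.1 this).resolve_left hμ
    exact hf μ y hy hℓy (by rw [← hgy, hg, hℓy, zero_smul, sub_zero])
  have hpow (n : ℕ) : (g ^ n) (x - ℓ x • e) = (f ^ n) x - ℓ x • e ∧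
      ℓ ((g ^ n) (x - ℓ x • e)) = 0 := by
    induction n with
    | zero => simp [hℓe]
    | succ n ih =>
      rw [pow_succ' g, mul_apply_eq_comp, pow_succ' f, Module.End.mul_apply]
      refine ⟨?_, hℓg _⟩
      rw [hg, ih.2, zero_smul, sub_zero, ih.1, map_sub, map_smul, hfe]
  have happly : Tendsto (fun n => (g ^ n) (x - ℓ x • e)) atTop (𝓝 0) :=
    ((continuous_eval_const (x - ℓ x • e)).tendsto (0 : V →L[ℂ] V)).comp hlim
  simpa [hpow] using happly.add_const (ℓ x • e)

section NearIdempotent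

variable {G P : V →L[ℂ] V}

lemma norm_sub_apply_add_le (hG : (1 + ‖P‖) * ‖G - P‖ ≤ 1 / 8) (x : V) :
    ‖(G - P) x‖ + ‖P ((G - P) x)‖ ≤ 1 / 8 * ‖x‖ :=
  calc ‖(G - P) x‖ + ‖P ((G - P) x)‖
      ≤ ‖(G - P) x‖ + ‖P‖ * ‖(G - P) x‖ := by gcongr; exact P.le_opNorm _
    _ = (1 + ‖P‖) * ‖(G - P) x‖ := by ring
    _ ≤ (1 + ‖P‖) * (‖G - P‖ * ‖x‖) := by gcongr; exact (G - P).le_opNorm x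
    _ ≤ 1 / 8 * ‖x‖ := by rw [← mul_assoc]; gcongr

lemma norm_le_norm_apply_add (P : V →L[ℂ] V) (x : V) : ‖x‖ ≤ ‖P x‖ + ‖x - P x‖ := by
  simpa using norm_add_le (P x) (x - P x)

lemma norm_sub_apply_le_of_eigenvector (hP : IsIdempotentElem P)
    (hG : (1 + ‖P‖) * ‖G - P‖ ≤ 1 / 8) {ν : ℂ} (hν : 1 / 2 < ‖ν‖) {z : V} (hz : G z = ν • z) :
    ‖z - P z‖ ≤ 1 / 3 * ‖P z‖ := by
  have hP' (x : V) : P (P x) = P x := DFunLike.congr_fun hP x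
  have hdefect : ν • (z - P z) = (G - P) z - P ((G - P) z) := by
    simp [hz, hP', smul_sub]
  have hle : ‖ν‖ * ‖z - P z‖ ≤ 1 / 8 * ‖z‖ := by
    rw [← norm_smul, hdefect]
    exact (norm_sub_le _ _).trans (norm_sub_apply_add_le hG z)
  nlinarith [norm_le_norm_apply_add P z, norm_nonneg (z - P z)]

lemma eq_of_eigenvectors (hP : IsIdempotentElem P) (hG : (1 + ‖P‖) * ‖G - P‖ ≤ 1 / 8) {μ ν : ℂ}
    (hμ : 1 / 2 < ‖μ‖) (hν : 1 / 2 < ‖ν‖) {y z : V} (hy : G y = μ • y) (hz : G z = ν • z)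
    (h : P y = P z) : y = z := by
  have hz' : ‖z‖ ≤ 4 / 3 * ‖P z‖ := by
    linarith [norm_le_norm_apply_add P z, norm_sub_apply_le_of_eigenvector hP hG hν hz]
  have heigenvalues : ‖μ - ν‖ * ‖P z‖ = ‖P ((G - P) (y - z))‖ := by
    rw [← norm_smul]
    congr 1
    simp [hy, hz, h, sub_smul]
  have hdiff : ‖μ‖ * ‖y - z‖ ≤ ‖(G - P) (y - z)‖ + ‖μ - ν‖ * ‖z‖ := by
    have : μ • (y - z) = (G - P) (y - z) - (μ - ν) • z := by
      simp only [sub_apply, map_sub, hy, hz, h, smul_sub, sub_smul]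
      abel
    rw [← norm_smul, ← norm_smul, this]
    exact norm_sub_le _ _
  have hsmall := norm_sub_apply_add_le hG (y - z)
  have hzero : ‖y - z‖ ≤ 0 := by
    nlinarith [norm_nonneg (μ - ν), norm_nonneg (y - z), norm_nonneg ((G - P) (y - z))]
  exact sub_eq_zero.1 (norm_le_zero_iff.1 hzero)

lemma norm_sub_apply_le_of_mem_cone (hP : IsIdempotentElem P)
    (hG : (1 + ‖P‖) * ‖G - P‖ ≤ 1 / 8) {x : V} (hx : ‖x - P x‖ ≤ ‖P x‖) :
    ‖G x - P (G x)‖ ≤ ‖P (G x)‖ ∧ 3 / 4 * ‖P x‖ ≤ ‖P (G x)‖ := by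
  have hP' (x : V) : P (P x) = P x := DFunLike.congr_fun hP x
  have hsmall : ‖(G - P) x‖ + ‖P ((G - P) x)‖ ≤ 1 / 4 * ‖P x‖ := by
    linarith [norm_sub_apply_add_le hG x, norm_le_norm_apply_add P x]
  have hout : ‖G x - P (G x)‖ ≤ ‖(G - P) x‖ + ‖P ((G - P) x)‖ := by
    have : G x - P (G x) = (G - P) x - P ((G - P) x) := by simp [hP']
    exact this ▸ norm_sub_le _ _
  have hin : ‖P x‖ ≤ ‖P (G x)‖ + ‖P ((G - P) x)‖ := by
    have : P x = P (G x) - P ((G - P) x) := by simp [hP']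
    exact this.symm ▸ norm_sub_le (P (G x)) (P ((G - P) x))
  constructor <;> linarith [norm_nonneg ((G - P) x), norm_nonneg (P x)]

lemma pow_mul_norm_le_norm_apply_pow (hP : IsIdempotentElem P)
    (hG : (1 + ‖P‖) * ‖G - P‖ ≤ 1 / 8) {e : V} (hPe : P e = e) (n : ℕ) :
    (3 / 4) ^ n * ‖e‖ ≤ ‖P ((G ^ n) e)‖ := by
  have hcone : ∀ n, ‖(G ^ n) e - P ((G ^ n) e)‖ ≤ ‖P ((G ^ n) e)‖ := fun n => by
    induction n with
    | zero => simp [hPe]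
    | succ n ih =>
      rw [pow_succ', mul_apply_eq_comp]
      exact (norm_sub_apply_le_of_mem_cone hP hG ih).1
  induction n with
  | zero => simp [hPe]
  | succ n ih =>
    calc (3 / 4) ^ (n + 1) * ‖e‖ = 3 / 4 * ((3 / 4) ^ n * ‖e‖) := by ring
      _ ≤ 3 / 4 * ‖P ((G ^ n) e)‖ := by gcongr
      _ ≤ ‖P ((G ^ (n + 1)) e)‖ := by
          rw [pow_succ' G, mul_apply_eq_comp]
          exact (norm_sub_apply_le_of_mem_cone hP hG (hcone n)).2

/-- If all eigenvalues were at most `1 / 2`, the powers of `(5 / 3) G` would tend to zero, whereas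
by the cone estimate `P (5 / 3 G)ⁿ e` grows like `(5 / 4)ⁿ`. -/
lemma exists_eigenvector_of_near_idempotent [FiniteDimensional ℂ V] (hP : IsIdempotentElem P)
    (hG : (1 + ‖P‖) * ‖G - P‖ ≤ 1 / 8) {e : V} (he : e ≠ 0) (hPe : P e = e) :
    ∃ (μ : ℂ) (y : V), y ≠ 0 ∧ G y = μ • y ∧ 1 / 2 < ‖μ‖ := by
  by_contra! hcon
  have hlim : Tendsto (fun n => ((5 / 3 : ℂ) • G) ^ n) atTop (𝓝 0) := by
    refine tendsto_pow_zero_of_eigenvalues _ fun μ x hx hxe => ?_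
    have hx' : G x = ((3 / 5 : ℂ) * μ) • x := by
      rw [mul_smul, ← hxe, smul_apply, smul_smul]
      norm_num
    have hle := hcon _ x hx hx'
    rw [norm_mul] at hle
    norm_num at hle
    linarith
  have hlimP : Tendsto (fun n => ‖P ((((5 / 3 : ℂ) • G) ^ n) e)‖) atTop (𝓝 0) := by
    have hc : Continuous fun F : V →L[ℂ] V => ‖P (F e)‖ := by fun_prop
    have h := (hc.tendsto 0).comp hlim
    rwa [zero_apply, map_zero, norm_zero] at h
  have hlow (n : ℕ) : ‖e‖ ≤ ‖P ((((5 / 3 : ℂ) • G) ^ n) e)‖ := by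
    rw [smul_pow, smul_apply, map_smul, norm_smul, norm_pow]
    calc ‖e‖ ≤ (5 / 4) ^ n * ‖e‖ := le_mul_of_one_le_left (norm_nonneg e)
          (one_le_pow₀ (by norm_num))
      _ = (5 / 3) ^ n * ((3 / 4) ^ n * ‖e‖) := by rw [← mul_assoc, ← mul_pow]; norm_num
      _ ≤ ‖(5 / 3 : ℂ)‖ ^ n * ‖P ((G ^ n) e)‖ := by
          gcongr
          · norm_num
          · exact pow_mul_norm_le_norm_apply_pow hP hG hPe n
  exact he (norm_le_zero_iff.1 (ge_of_tendsto' hlimP hlow))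

end NearIdempotent

/-- An operator with a nonzero eigenvalue whose eigenvectors are, up to scalars, the only
eigenvectors with an eigenvalue of that modulus. -/
def HasDominantEigenline {V : Type*} [AddCommGroup V] [Module ℂ V] (f : Module.End ℂ V) : Prop :=
  ∃ (μ : ℂ) (y : V), μ ≠ 0 ∧ y ≠ 0 ∧ f y = μ • y ∧
    ∀ (ν : ℂ) (z : V), f z = ν • z → ‖ν‖ = ‖μ‖ → ∃ c : ℂ, z = c • y

lemma exists_isIdempotentElem_mapClusterPt_pow {M : Type*} [Monoid M] [TopologicalSpace M]
    [T2Space M] [ContinuousMul M] {K : Set M} (hK : IsCompact K) {a : M} (ha : ∀ n, a ^ n ∈ K) :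
    ∃ p, IsIdempotentElem p ∧ MapClusterPt p atTop (a ^ · : ℕ → M) := by
  let S : Set M := {p | MapClusterPt p atTop (a ^ · : ℕ → M)}
  have hcompact : IsCompact S := hK.of_isClosed_subset isClosed_setOfPred_clusterPt fun p hp =>
    hK.isClosed.mem_of_mapClusterPt hp (Eventually.of_forall ha)
  have hne : S.Nonempty :=
    (hK.exists_mapClusterPt (tendsto_principal.2 (Eventually.of_forall ha))).imp fun _ h => h.2
  have hmul : ∀ᵉ (p ∈ S) (q ∈ S), p * q ∈ S := by
    intro p hp q hq
    refine mapClusterPt_iff_frequently.2 fun s hs => frequently_atTop.2 fun m => ?_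
    have hs' : ∀ᶠ x : M × M in 𝓝 p ×ˢ 𝓝 q, x.1 * x.2 ∈ s := by
      rw [← nhds_prod_eq]
      exact (continuous_mul.tendsto (p, q)).eventually hs
    obtain ⟨_, hu, _, hv, huv⟩ := eventually_prod_iff.1 hs'
    obtain ⟨k, hk, hku⟩ := frequently_atTop.1 (hp.frequently hu) m
    obtain ⟨l, -, hlv⟩ := frequently_atTop.1 (hq.frequently hv) m
    exact ⟨k + l, by omega, by simpa only [pow_add] using huv hku hlv⟩
  obtain ⟨p, hpS, hp⟩ :=
    exists_idempotent_in_compact_subsemigroup continuous_mul_const S hne hcompact hmul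
  exact ⟨p, hp, hpS⟩

lemma exists_forall_apply_eq_smul_of_trace_eq_one {K W : Type*} [Field K] [CharZero K]
    [AddCommGroup W] [Module K W] [FiniteDimensional K W] {P : Module.End K W}
    (hP : IsIdempotentElem P) (htr : LinearMap.trace K W P = 1) :
    ∃ e, e ≠ 0 ∧ P e = e ∧ ∀ x, ∃ c : K, P x = c • e := by
  have hrank : Module.finrank K (LinearMap.range P) = 1 := by
    have := (LinearMap.IsIdempotentElem.isProj_range _ hP).trace
    rw [htr] at this
    exact_mod_cast this.symm
  obtain ⟨⟨_, x, rfl⟩, hne, hspan⟩ := finrank_eq_one_iff'.1 hrank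
  refine ⟨P x, fun h => hne (Subtype.ext h), DFunLike.congr_fun hP x, fun y => ?_⟩
  obtain ⟨c, hc⟩ := hspan ⟨P y, ⟨y, rfl⟩⟩
  exact ⟨c, (congrArg Subtype.val hc).symm⟩

lemma hasDominantEigenline_of_near_idempotent [FiniteDimensional ℂ V] {G P : V →L[ℂ] V}
    (hP : IsIdempotentElem P) (htr : LinearMap.trace ℂ V P = 1)
    (hG : (1 + ‖P‖) * ‖G - P‖ ≤ 1 / 8) : HasDominantEigenline (G : Module.End ℂ V) := by
  obtain ⟨e, he, hPe, hspan⟩ := exists_forall_apply_eq_smul_of_trace_eq_one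
    (LinearMap.ext fun x => DFunLike.congr_fun hP x : IsIdempotentElem (P : Module.End ℂ V)) htr
  obtain ⟨μ, y, hy0, hy, hμ⟩ := exists_eigenvector_of_near_idempotent hP hG he hPe
  refine ⟨μ, y, norm_pos_iff.1 (by linarith), hy0, hy, fun ν z hz hν => ?_⟩
  obtain ⟨a, ha : P y = a • e⟩ := hspan y
  obtain ⟨b, hb : P z = b • e⟩ := hspan z
  have ha0 : a ≠ 0 := by
    rintro rfl
    refine hy0 (eq_of_eigenvectors hP hG hμ hμ hy (z := 0) (by simp) ?_)
    rw [ha, zero_smul, map_zero]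
  refine ⟨b / a, eq_of_eigenvectors hP hG (hν ▸ hμ) hμ hz (z := (b / a) • y) ?_ ?_⟩
  · rw [map_smul, hy, smul_comm]
  · rw [map_smul, ha, hb, smul_smul, div_mul_cancel₀ _ ha0]

/-- The powers of `F₀ ^ L` cluster at an idempotent, necessarily of trace and hence of rank one, so
some power of every operator near `F₀` is close to a rank-one idempotent. -/
theorem exists_hasDominantEigenline_pow [FiniteDimensional ℂ V] {F₀ : V →L[ℂ] V} {C : ℝ}
    (hC : ∀ n, ‖F₀ ^ n‖ ≤ C)
    (htr : Tendsto (fun n => LinearMap.trace ℂ V (F₀ ^ n : V →L[ℂ] V)) atTop (𝓝 1)) {L : ℕ}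
    (hL : 1 ≤ L) :
    ∃ N : ℕ, 1 ≤ N ∧ L ∣ N ∧
      ∀ᶠ F : V →L[ℂ] V in 𝓝 F₀, HasDominantEigenline ((F ^ N : V →L[ℂ] V) : Module.End ℂ V) := by
  have : ProperSpace (V →L[ℂ] V) := FiniteDimensional.proper ℂ _
  obtain ⟨P, hP, hcluster⟩ := exists_isIdempotentElem_mapClusterPt_pow (a := F₀ ^ L)
    (isCompact_closedBall (0 : V →L[ℂ] V) C) fun n => by simpa [← pow_mul] using hC _
  have htrP : LinearMap.trace ℂ V P = 1 := by
    let τ : (V →L[ℂ] V) →ₗ[ℂ] ℂ := LinearMap.trace ℂ V ∘ₗ ContinuousLinearMap.coeLM ℂ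
    have hτ : Continuous τ := LinearMap.continuous_of_finiteDimensional τ
    have hτ_cluster := hcluster.continuousAt_comp hτ.continuousAt
    have hτ_tendsto : Tendsto (τ ∘ ((F₀ ^ L) ^ ·)) atTop (𝓝 1) :=
      (htr.comp (tendsto_id.const_mul_atTop' (by omega : 0 < L))).congr fun n => by
        simp [τ, ← pow_mul]
    exact eq_of_nhds_neBot (hτ_cluster.clusterPt.mono hτ_tendsto)
  have hnear : ∀ᶠ Q : V →L[ℂ] V in 𝓝 P, (1 + ‖P‖) * ‖Q - P‖ < 1 / 8 := by
    have : ContinuousAt (fun Q : V →L[ℂ] V => (1 + ‖P‖) * ‖Q - P‖) P := by fun_prop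
    exact this.eventually_lt_const (by simp)
  obtain ⟨k, hk, hk2⟩ := frequently_atTop.1 (hcluster.frequently hnear) 1
  rw [← pow_mul] at hk2
  refine ⟨L * k, Nat.mul_pos hL hk, dvd_mul_right _ _, ?_⟩
  have hcont : ContinuousAt (fun F : V →L[ℂ] V => (1 + ‖P‖) * ‖F ^ (L * k) - P‖) F₀ := by fun_prop
  filter_upwards [hcont.eventually_lt_const hk2] with F hF
  exact hasDominantEigenline_of_near_idempotent hP htrP hF.le

theorem exists_eventually_hasDominantEigenline {α : Type*} [FiniteDimensional ℂ V]
    [TopologicalSpace α] {F : α → Module.End ℂ V} (hF : ∀ x, Continuous fun a => F a x) {a₀ : α}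
    (hC : ∀ x, ∃ C, ∀ n, ‖(F a₀ ^ n) x‖ ≤ C)
    (htr : Tendsto (fun n => LinearMap.trace ℂ V (F a₀ ^ n)) atTop (𝓝 1)) {L : ℕ} (hL : 1 ≤ L) :
    ∃ N : ℕ, 1 ≤ N ∧ L ∣ N ∧ ∀ᶠ a in 𝓝 a₀, HasDominantEigenline (F a ^ N) := by
  have : CompleteSpace V := FiniteDimensional.complete ℂ _
  let Φ := Module.End.toContinuousLinearMap V (𝕜 := ℂ)
  have hΦ (f : Module.End ℂ V) (n : ℕ) : ((Φ f ^ n : V →L[ℂ] V) : Module.End ℂ V) = f ^ n := by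
    rw [← map_pow]
    rfl
  obtain ⟨C, hC⟩ := banach_steinhaus (g := fun n => Φ (F a₀) ^ n) fun x => by
    refine (hC x).imp fun C hC n => ?_
    have := hC n
    rwa [← hΦ] at this
  obtain ⟨N, hN, hLN, hev⟩ := exists_hasDominantEigenline_pow hC (by simpa only [hΦ] using htr) hL
  have hc : Continuous fun a => Φ (F a) := continuous_clm_apply.2 hF
  refine ⟨N, hN, hLN, ((hc.tendsto a₀).eventually hev).mono fun a ha => ?_⟩
  rwa [hΦ] at ha

end Powers

section Transfer

variable {ι κ κ' : Type*} [Fintype ι] [Fintype κ] [Fintype κ']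

/-- The mixed transfer map `X ↦ ∑ₛ (A^s)† X B^s` of two tensors. -/
def mixedTransfer (A : ι → Matrix κ κ ℂ) (B : ι → Matrix κ' κ' ℂ) :
    Module.End ℂ (Matrix κ κ' ℂ) where
  toFun X := ∑ s, (A s)ᴴ * X * B s
  map_add' X Y := by simp [Matrix.mul_add, Matrix.add_mul, Finset.sum_add_distrib]
  map_smul' c X := by simp [Finset.smul_sum]

/-- The transfer map `X ↦ ∑ₛ A^s X (A^s)†` of a tensor with arbitrary index types; it agrees
definitionally with `transfer`. -/
def transferMap (A : ι → Matrix κ κ ℂ) : Module.End ℂ (Matrix κ κ ℂ) where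
  toFun X := ∑ s, A s * X * (A s)ᴴ
  map_add' X Y := by simp [mul_add, add_mul, Finset.sum_add_distrib]
  map_smul' c X := by simp [Finset.smul_sum]

lemma mixedTransfer_apply (A : ι → Matrix κ κ ℂ) (B : ι → Matrix κ' κ' ℂ) (X : Matrix κ κ' ℂ) :
    mixedTransfer A B X = ∑ s, (A s)ᴴ * X * B s := rfl

lemma transferMap_apply (A : ι → Matrix κ κ ℂ) (X : Matrix κ κ ℂ) :
    transferMap A X = ∑ s, A s * X * (A s)ᴴ := rfl

lemma conjTranspose_mixedTransfer (A : ι → Matrix κ κ ℂ) (B : ι → Matrix κ' κ' ℂ)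
    (X : Matrix κ κ' ℂ) : (mixedTransfer A B X)ᴴ = mixedTransfer B A Xᴴ := by
  simp [mixedTransfer_apply, Matrix.conjTranspose_sum, Matrix.mul_assoc]

lemma trace_mul_transferMap (A : ι → Matrix κ κ ℂ) (X Y : Matrix κ κ ℂ) :
    (Y * transferMap A X).trace = (mixedTransfer A A Y * X).trace := by
  simp only [mixedTransfer_apply, transferMap_apply, Matrix.mul_sum, Matrix.sum_mul,
    Matrix.trace_sum]
  refine Finset.sum_congr rfl fun s _ => ?_
  rw [← Matrix.mul_assoc, Matrix.trace_mul_comm]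
  simp only [Matrix.mul_assoc]

lemma trace_mul_mixedTransfer {A : ι → Matrix κ κ ℂ} {ρ : Matrix κ κ ℂ}
    (hρ : transferMap A ρ = ρ) (Z : Matrix κ κ ℂ) :
    (ρ * mixedTransfer A A Z).trace = (ρ * Z).trace := by
  rw [Matrix.trace_mul_comm, ← trace_mul_transferMap, hρ, Matrix.trace_mul_comm]

lemma trace_mul_transferMap_pow (A : ι → Matrix κ κ ℂ) (X Y : Matrix κ κ ℂ) (n : ℕ) :
    (Y * (transferMap A ^ n) X).trace = ((mixedTransfer A A ^ n) Y * X).trace := by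
  induction n generalizing Y with
  | zero => simp
  | succ n ih =>
    rw [pow_succ', Module.End.mul_apply, trace_mul_transferMap, ih, ← Module.End.mul_apply,
      ← pow_succ]

lemma trace_transferMap [DecidableEq κ] {A : ι → Matrix κ κ ℂ} (hA : ∑ s, (A s)ᴴ * A s = 1)
    (X : Matrix κ κ ℂ) :
    (transferMap A X).trace = X.trace := by
  have := trace_mul_transferMap A X 1
  rwa [mixedTransfer_apply, funext fun s => congrArg (· * A s) (mul_one (A s)ᴴ), hA, one_mul,
    one_mul] at this

end Transfer

section WeightedNorm

variable {κ κ' : Type*} [Fintype κ] [Fintype κ'] {ρ : Matrix κ' κ' ℂ}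

/-- The squared Hilbert–Schmidt norm of `Z` with weight `ρ`. -/
def weightedNormSq (ρ : Matrix κ' κ' ℂ) (Z : Matrix κ κ' ℂ) : ℝ := (ρ * (Zᴴ * Z)).trace.re

lemma weightedNormSq_smul (ρ : Matrix κ' κ' ℂ) (c : ℂ) (Z : Matrix κ κ' ℂ) :
    weightedNormSq ρ (c • Z) = ‖c‖ ^ 2 * weightedNormSq ρ Z := by
  have hc : c * star c = ((‖c‖ ^ 2 : ℝ) : ℂ) := by exact_mod_cast Complex.mul_conj' c
  simp only [weightedNormSq, Matrix.conjTranspose_smul, Matrix.smul_mul, Matrix.mul_smul,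
    smul_smul, Matrix.trace_smul, smul_eq_mul, hc, Complex.re_ofReal_mul]

attribute [local instance] Matrix.frobeniusNormedAddCommGroup

lemma exists_trace_mul_eq_norm_sq (hρ : ρ.PosDef) :
    ∃ K K' : Matrix κ' κ' ℂ, (∀ Z : Matrix κ κ' ℂ, Z * K * K' = Z) ∧
      ∀ Z : Matrix κ κ' ℂ, (ρ * (Zᴴ * Z)).trace = ((‖Z * K‖ ^ 2 : ℝ) : ℂ) := by
  classical
  open scoped MatrixOrder in
  obtain ⟨C, rfl : ρ = Cᴴ * C⟩ := CStarAlgebra.nonneg_iff_eq_star_mul_self.1 hρ.posSemidef.nonneg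
  obtain ⟨D, hD⟩ := hρ.isUnit.exists_right_inv
  refine ⟨Cᴴ, C * D, fun Z => by rw [Matrix.mul_assoc, ← Matrix.mul_assoc Cᴴ, hD, Matrix.mul_one],
    fun Z => ?_⟩
  have hHS : (Cᴴ * C * (Zᴴ * Z)).trace = ((Z * Cᴴ) * (Z * Cᴴ)ᴴ).trace := by
    rw [Matrix.trace_mul_comm, Matrix.mul_assoc, Matrix.trace_mul_comm,
      Matrix.conjTranspose_mul, Matrix.conjTranspose_conjTranspose]
    simp only [Matrix.mul_assoc]
  have hnorm (W : Matrix κ κ' ℂ) : ‖W‖ ^ 2 = ∑ i, ∑ j, ‖W i j‖ ^ 2 := by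
    rw [Matrix.frobenius_norm_def, ← Real.sqrt_eq_rpow, Real.sq_sqrt (by positivity)]
    simp only [Real.rpow_two]
  rw [hHS, hnorm, Matrix.trace]
  simp only [Matrix.diag, Matrix.mul_apply (M := Z * Cᴴ), Matrix.conjTranspose_apply (Z * Cᴴ),
    RCLike.star_def, Complex.mul_conj']
  push_cast
  rfl

lemma weightedNormSq_nonneg (hρ : ρ.PosDef) (Z : Matrix κ κ' ℂ) : 0 ≤ weightedNormSq ρ Z := by
  obtain ⟨K, K', -, h⟩ := exists_trace_mul_eq_norm_sq (κ := κ) hρ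
  rw [weightedNormSq, h, Complex.ofReal_re]
  positivity

lemma exists_norm_sq_le_weightedNormSq (hρ : ρ.PosDef) :
    ∃ C, 0 ≤ C ∧ ∀ Z : Matrix κ κ' ℂ, ‖Z‖ ^ 2 ≤ C * weightedNormSq ρ Z := by
  obtain ⟨K, K', hK, h⟩ := exists_trace_mul_eq_norm_sq (κ := κ) hρ
  refine ⟨‖K'‖ ^ 2, by positivity, fun Z => ?_⟩
  calc ‖Z‖ ^ 2 = ‖Z * K * K'‖ ^ 2 := by rw [hK]
    _ ≤ (‖Z * K‖ * ‖K'‖) ^ 2 := by gcongr; exact Matrix.frobenius_norm_mul _ _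
    _ = ‖K'‖ ^ 2 * weightedNormSq ρ Z := by
      rw [weightedNormSq, h, Complex.ofReal_re, mul_pow, mul_comm]

lemma weightedNormSq_le_zero_iff (hρ : ρ.PosDef) {Z : Matrix κ κ' ℂ} :
    weightedNormSq ρ Z ≤ 0 ↔ Z = 0 := by
  refine ⟨fun hZ => ?_, by rintro rfl; simp [weightedNormSq]⟩
  obtain ⟨C, hC0, hC⟩ := exists_norm_sq_le_weightedNormSq (κ := κ) hρ
  have hZ0 := (hC Z).trans (mul_nonpos_of_nonneg_of_nonpos hC0 hZ)
  exact norm_eq_zero.1 (sq_eq_zero_iff.1 (le_antisymm hZ0 (sq_nonneg _)))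

end WeightedNorm

section Contraction

variable {ι κ κ' : Type*} [Fintype ι] [Fintype κ] [Fintype κ'] [DecidableEq κ]
  {A : ι → Matrix κ κ ℂ} {B : ι → Matrix κ' κ' ℂ} {ρ : Matrix κ' κ' ℂ}

/-- The operator Cauchy–Schwarz inequality, with its defect. -/
lemma sum_conjTranspose_mul_self_eq_mixedTransfer_sub (hA : ∑ s, (A s)ᴴ * A s = 1)
    (B : ι → Matrix κ' κ' ℂ) (X : Matrix κ κ' ℂ) :
    ∑ s, (A s * mixedTransfer A B X - X * B s)ᴴ * (A s * mixedTransfer A B X - X * B s) =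
      mixedTransfer B B (Xᴴ * X) - (mixedTransfer A B X)ᴴ * mixedTransfer A B X := by
  set Y := mixedTransfer A B X with hY
  have hAA : ∑ s, Yᴴ * ((A s)ᴴ * A s) * Y = Yᴴ * Y := by
    rw [← Matrix.sum_mul, ← Matrix.mul_sum, hA, Matrix.mul_one]
  have hAB : ∑ s, Yᴴ * ((A s)ᴴ * X * B s) = Yᴴ * Y := by
    rw [← Matrix.mul_sum, hY, mixedTransfer_apply]
  have hBA : ∑ s, ((B s)ᴴ * Xᴴ * A s) * Y = Yᴴ * Y := by
    rw [← Matrix.sum_mul, hY, conjTranspose_mixedTransfer, mixedTransfer_apply B A]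
  have hexpand : ∑ s, (A s * Y - X * B s)ᴴ * (A s * Y - X * B s) =
      ∑ s, (Yᴴ * ((A s)ᴴ * A s) * Y - Yᴴ * ((A s)ᴴ * X * B s) - ((B s)ᴴ * Xᴴ * A s) * Y +
        (B s)ᴴ * (Xᴴ * X) * B s) := by
    refine Finset.sum_congr rfl fun s _ => ?_
    simp only [Matrix.conjTranspose_sub, Matrix.conjTranspose_mul, Matrix.sub_mul, Matrix.mul_sub,
      Matrix.mul_assoc]
    abel
  rw [hexpand, Finset.sum_add_distrib, Finset.sum_sub_distrib, Finset.sum_sub_distrib, hAA, hAB,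
    hBA, mixedTransfer_apply]
  abel

lemma weightedNormSq_eq_mixedTransfer_add (hA : ∑ s, (A s)ᴴ * A s = 1)
    (hB : transferMap B ρ = ρ) (X : Matrix κ κ' ℂ) :
    weightedNormSq ρ X = weightedNormSq ρ (mixedTransfer A B X) +
      ∑ s, weightedNormSq ρ (A s * mixedTransfer A B X - X * B s) := by
  have h := congrArg (fun Z => (ρ * Z).trace.re)
    (sum_conjTranspose_mul_self_eq_mixedTransfer_sub hA B X)
  simp only [Matrix.mul_sum, Matrix.trace_sum, Matrix.mul_sub ρ, Matrix.trace_sub,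
    trace_mul_mixedTransfer hB, Complex.re_sum, Complex.sub_re] at h
  simp only [weightedNormSq]
  linarith

lemma weightedNormSq_mixedTransfer_le (hA : ∑ s, (A s)ᴴ * A s = 1) (hρ : ρ.PosDef)
    (hB : transferMap B ρ = ρ) (X : Matrix κ κ' ℂ) :
    weightedNormSq ρ (mixedTransfer A B X) ≤ weightedNormSq ρ X := by
  rw [weightedNormSq_eq_mixedTransfer_add hA hB X]
  exact le_add_of_nonneg_right (Finset.sum_nonneg fun s _ => weightedNormSq_nonneg hρ _)

lemma mul_mixedTransfer_eq_of_weightedNormSq_le (hA : ∑ s, (A s)ᴴ * A s = 1) (hρ : ρ.PosDef)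
    (hB : transferMap B ρ = ρ) {X : Matrix κ κ' ℂ}
    (h : weightedNormSq ρ X ≤ weightedNormSq ρ (mixedTransfer A B X)) (s : ι) :
    A s * mixedTransfer A B X = X * B s := by
  rw [weightedNormSq_eq_mixedTransfer_add hA hB X] at h
  have hle := Finset.single_le_sum (fun s _ => weightedNormSq_nonneg hρ
    (A s * mixedTransfer A B X - X * B s)) (Finset.mem_univ s)
  exact sub_eq_zero.1 ((weightedNormSq_le_zero_iff hρ).1 (by linarith))

attribute [local instance] Matrix.frobeniusNormedAddCommGroup in
lemma exists_norm_mixedTransfer_pow_le (hA : ∑ s, (A s)ᴴ * A s = 1) (hρ : ρ.PosDef)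
    (hB : transferMap B ρ = ρ) (X : Matrix κ κ' ℂ) :
    ∃ C, ∀ n, ‖(mixedTransfer A B ^ n) X‖ ≤ C := by
  obtain ⟨C, hC0, hC⟩ := exists_norm_sq_le_weightedNormSq (κ := κ) hρ
  have hle (n : ℕ) : weightedNormSq ρ ((mixedTransfer A B ^ n) X) ≤ weightedNormSq ρ X := by
    induction n with
    | zero => simp
    | succ n ih =>
      rw [pow_succ', Module.End.mul_apply]
      exact (weightedNormSq_mixedTransfer_le hA hρ hB _).trans ih
  exact ⟨√(C * weightedNormSq ρ X), fun n =>
    Real.le_sqrt_of_sq_le ((hC _).trans (mul_le_mul_of_nonneg_left (hle n) hC0))⟩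

end Contraction

section Primitive

variable {ι κ : Type*} [Fintype ι] [Fintype κ] [DecidableEq κ] {A : ι → Matrix κ κ ℂ}
  {ρ : Matrix κ κ ℂ}

/-- A left-canonical tensor whose transfer map has the positive definite density matrix `ρ` as a
globally attracting fixed point. -/
structure Primitive (A : ι → Matrix κ κ ℂ) (ρ : Matrix κ κ ℂ) : Prop where
  left : ∑ s, (A s)ᴴ * A s = 1
  posDef : ρ.PosDef
  trace_eq : ρ.trace = 1
  tendsto : ∀ X, Tendsto (fun n => (transferMap A ^ n) X) atTop (𝓝 (X.trace • ρ))

lemma mixedTransfer_one (hA : ∑ s, (A s)ᴴ * A s = 1) : mixedTransfer A A 1 = 1 := by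
  simpa [mixedTransfer_apply] using hA

omit [DecidableEq κ] in
lemma tendsto_iff_forall_tendsto_trace_mul {α : Type*} {l : Filter α} {f : α → Matrix κ κ ℂ}
    {M : Matrix κ κ ℂ} : Tendsto f l (𝓝 M) ↔
      ∀ Y, Tendsto (fun a => (Y * f a).trace) l (𝓝 (Y * M).trace) := by
  classical
  refine ⟨fun h Y => ?_, fun h => tendsto_pi_nhds.2 fun i => tendsto_pi_nhds.2 fun j => ?_⟩
  · have hY : Continuous fun Z : Matrix κ κ ℂ => (Y * Z).trace := by fun_prop
    exact (hY.tendsto M).comp h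
  · simpa [Matrix.trace_single_mul] using h (Matrix.single j i 1)

lemma tendsto_transferMap_pow_iff_tendsto_mixedTransfer_pow :
    (∀ X, Tendsto (fun n => (transferMap A ^ n) X) atTop (𝓝 (X.trace • ρ))) ↔
      ∀ Y, Tendsto (fun n => (mixedTransfer A A ^ n) Y) atTop (𝓝 ((ρ * Y).trace • 1)) := by
  simp only [tendsto_iff_forall_tendsto_trace_mul, trace_mul_transferMap_pow, Matrix.mul_smul,
    Matrix.trace_smul, mul_one, smul_eq_mul]
  rw [forall_comm]
  refine forall₂_congr fun Y X => ?_
  rw [Matrix.trace_mul_comm ρ, mul_comm]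
  simp only [Matrix.trace_mul_comm X]

namespace Primitive

lemma fixed (h : Primitive A ρ) : transferMap A ρ = ρ := by
  have hlim := h.tendsto ρ
  rw [h.trace_eq, one_smul] at hlim
  have hcont : Continuous (transferMap A) := LinearMap.continuous_of_finiteDimensional _
  refine tendsto_nhds_unique ((hcont.tendsto ρ).comp hlim)
    ((hlim.comp (tendsto_add_atTop_nat 1)).congr fun n => ?_)
  simp only [Function.comp_apply, pow_succ', Module.End.mul_apply]

lemma tendsto_mixedTransfer_pow (h : Primitive A ρ) (Y : Matrix κ κ ℂ) :
    Tendsto (fun n => (mixedTransfer A A ^ n) Y) atTop (𝓝 ((ρ * Y).trace • 1)) :=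
  tendsto_transferMap_pow_iff_tendsto_mixedTransfer_pow.1 h.tendsto Y

lemma nonempty (h : Primitive A ρ) : Nonempty κ := by
  by_contra hne
  rw [not_nonempty_iff] at hne
  exact zero_ne_one ((Matrix.trace_eq_zero_of_isEmpty ρ).symm.trans h.trace_eq)

lemma eq_smul_one_of_mixedTransfer_pow_eq (h : Primitive A ρ) {L : ℕ} (hL : 1 ≤ L)
    {W : Matrix κ κ ℂ} (hW : (mixedTransfer A A ^ L) W = W) : W = (ρ * W).trace • 1 := by
  refine tendsto_nhds_unique (tendsto_const_nhds.congr fun n => ?_)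
    ((h.tendsto_mixedTransfer_pow W).comp (tendsto_id.const_mul_atTop' (by omega : 0 < L)))
  rw [Function.comp_apply, id, pow_mul, Module.End.pow_apply, Function.iterate_fixed hW]

/-- In the limit, the average `tr(ρ X₀)` has modulus one, which is the equality case of the
Cauchy–Schwarz inequality for the unitary `X₀`. -/
lemma eq_smul_one_of_forall_mixedTransfer_eq_smul (h : Primitive A ρ) {X : ℕ → Matrix κ κ ℂ}
    {a : ℕ → ℂ} (hX : ∀ n, (X n)ᴴ * X n = 1) (ha : ∀ n, ‖a n‖ = 1)
    (hstep : ∀ n, mixedTransfer A A (X n) = a n • X (n + 1)) : X 0 = (ρ * X 0).trace • 1 := by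
  set c := (ρ * X 0).trace with hc
  have hiter (n : ℕ) : ((mixedTransfer A A ^ n) (X 0))ᴴ * (mixedTransfer A A ^ n) (X 0) = 1 := by
    have hpow : ∃ p : ℂ, ‖p‖ = 1 ∧ (mixedTransfer A A ^ n) (X 0) = p • X n := by
      induction n with
      | zero => exact ⟨1, by simp⟩
      | succ n ih =>
        obtain ⟨p, hp, hn⟩ := ih
        refine ⟨p * a n, by rw [norm_mul, hp, ha, one_mul], ?_⟩
        rw [pow_succ', Module.End.mul_apply, hn, map_smul, hstep, smul_smul]
    obtain ⟨p, hp, hn⟩ := hpow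
    rw [hn, Matrix.conjTranspose_smul, Matrix.smul_mul, Matrix.mul_smul, smul_smul, hX,
      Complex.star_def, Complex.conj_mul', hp]
    simp
  have hcc : star c * c = 1 := by
    have hcont : Continuous fun Z : Matrix κ κ ℂ => (ρ * (Zᴴ * Z)).trace := by fun_prop
    have hlim := ((hcont.tendsto _).comp (h.tendsto_mixedTransfer_pow (X 0))).congr fun n => by
      rw [Function.comp_apply, hiter, mul_one, h.trace_eq]
    simpa [h.trace_eq, ← hc, mul_comm] using tendsto_nhds_unique hlim tendsto_const_nhds
  have htr : (ρ * (X 0)ᴴ).trace = star c := by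
    rw [hc, ← Matrix.trace_conjTranspose, Matrix.conjTranspose_mul, h.posDef.1,
      Matrix.trace_mul_comm]
  have hexpand : (X 0 - c • 1)ᴴ * (X 0 - c • 1) =
      1 - c • (X 0)ᴴ - star c • X 0 + (1 : Matrix κ κ ℂ) := by
    simp only [Matrix.conjTranspose_sub, Matrix.conjTranspose_smul, Matrix.conjTranspose_one,
      sub_mul, mul_sub, hX, Matrix.mul_smul, Matrix.smul_mul, mul_one, one_mul, smul_smul]
    rw [mul_comm c, hcc, one_smul]
    abel
  refine sub_eq_zero.1 ((weightedNormSq_le_zero_iff h.posDef).1 (le_of_eq ?_))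
  rw [weightedNormSq, hexpand]
  simp only [Matrix.mul_add, Matrix.mul_sub, Matrix.mul_smul, mul_one, Matrix.trace_add,
    Matrix.trace_sub, Matrix.trace_smul, h.trace_eq, htr, ← hc, smul_eq_mul, mul_comm c, hcc]
  norm_num

end Primitive

attribute [local instance] Matrix.normedAddCommGroup Matrix.normedSpace

lemma primitive_of_transferMap_eigenvalues (hA : ∑ s, (A s)ᴴ * A s = 1) (hρ : ρ.PosDef)
    (htr : ρ.trace = 1) (hfix : transferMap A ρ = ρ)
    (hgap : ∀ (μ : ℂ) (X : Matrix κ κ ℂ), X ≠ 0 → X.trace = 0 → transferMap A X = μ • X →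
      ‖μ‖ < 1) : Primitive A ρ :=
  ⟨hA, hρ, htr, tendsto_pow_apply_of_eigenvalues (ℓ := Matrix.traceLinearMap κ ℂ ℂ) hfix
    (trace_transferMap hA) htr hgap⟩

lemma primitive_of_mixedTransfer_eigenvalues (hA : ∑ s, (A s)ᴴ * A s = 1) (hρ : ρ.PosDef)
    (htr : ρ.trace = 1) (hfix : transferMap A ρ = ρ)
    (hgap : ∀ (μ : ℂ) (X : Matrix κ κ ℂ), X ≠ 0 → (ρ * X).trace = 0 →
      mixedTransfer A A X = μ • X → ‖μ‖ < 1) : Primitive A ρ :=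
  ⟨hA, hρ, htr, tendsto_transferMap_pow_iff_tendsto_mixedTransfer_pow.2 <|
    tendsto_pow_apply_of_eigenvalues (ℓ := Matrix.traceLinearMap κ ℂ ℂ ∘ₗ LinearMap.mulLeft ℂ ρ)
      (mixedTransfer_one hA) (trace_mul_mixedTransfer hfix)
      (by rw [LinearMap.comp_apply, LinearMap.mulLeft_apply, mul_one]; exact htr) hgap⟩

/-- The equality case of the contraction property turns an eigenvector of modulus at least one
into an intertwiner. -/
lemma primitive_of_forall_intertwiner_eq_smul_one (hA : ∑ s, (A s)ᴴ * A s = 1) (hρ : ρ.PosDef)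
    (htr : ρ.trace = 1) (hfix : transferMap A ρ = ρ)
    (hrigid : ∀ (μ : ℂ) (X : Matrix κ κ ℂ), (∀ s, μ • (A s * X) = X * A s) →
      ∃ c : ℂ, X = c • 1) : Primitive A ρ := by
  refine primitive_of_mixedTransfer_eigenvalues hA hρ htr hfix fun μ X hX0 hXtr hX => ?_
  by_contra! hμ
  have hle : weightedNormSq ρ X ≤ weightedNormSq ρ (mixedTransfer A A X) := by
    rw [hX, weightedNormSq_smul]
    exact le_mul_of_one_le_left (weightedNormSq_nonneg hρ X) (one_le_pow₀ hμ)
  have hinter := mul_mixedTransfer_eq_of_weightedNormSq_le hA hρ hfix hle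
  rw [hX] at hinter
  obtain ⟨c, rfl⟩ := hrigid μ X fun s => by rw [← hinter, Matrix.mul_smul]
  rw [Matrix.mul_smul, Matrix.mul_one, Matrix.trace_smul, htr, smul_eq_mul, mul_one] at hXtr
  exact hX0 (by rw [hXtr, zero_smul])

end Primitive

section CanonicalInjective

variable {d χ : ℕ} {A : MPSTensor d χ}

lemma IsCanonicalInjective.exists_trace_eq_one (h : IsCanonicalInjective A) :
    ∃ ρ : Matrix (Fin χ) (Fin χ) ℂ, ρ.PosDef ∧ ρ.trace = 1 ∧ transferMap A ρ = ρ := by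
  obtain ⟨ρ, hρ, hfix⟩ := h.right_fixed
  have : Nonempty (Fin χ) := by
    by_contra hne
    rw [not_nonempty_iff] at hne
    have hunique := h.unique
    rw [Module.finrank_zero_of_subsingleton] at hunique
    exact zero_ne_one hunique
  have htr : 0 < ρ.trace := hρ.trace_pos
  refine ⟨ρ.trace⁻¹ • ρ, hρ.smul (inv_pos_of_pos htr), ?_, ?_⟩
  · rw [Matrix.trace_smul, smul_eq_mul, inv_mul_cancel₀ htr.ne']
  · rw [map_smul]
    exact congrArg _ hfix

theorem IsCanonicalInjective.exists_primitive (h : IsCanonicalInjective A) :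
    ∃ ρ, Primitive A ρ := by
  obtain ⟨ρ, hρ, htr, hfix⟩ := h.exists_trace_eq_one
  refine ⟨ρ, primitive_of_transferMap_eigenvalues h.left_canonical hρ htr hfix
    fun μ X hX0 hXtr hX => ?_⟩
  have hmem : X ∈ Module.End.eigenspace (transfer A) μ := Module.End.mem_eigenspace_iff.2 hX
  refine h.gap μ (Module.End.hasEigenvalue_of_hasEigenvector ⟨hmem, hX0⟩) ?_
  rintro rfl
  have hρmem : ρ ∈ Module.End.eigenspace (transfer A) 1 :=
    Module.End.mem_eigenspace_iff.2 (by rw [one_smul]; exact hfix)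
  obtain ⟨c, hc⟩ := (finrank_eq_one_iff_of_nonzero' (⟨ρ, hρmem⟩ : Module.End.eigenspace _ _)
    fun h0 => by simp [(Submodule.mk_eq_zero _ _).1 h0] at htr).1 h.unique ⟨X, hmem⟩
  obtain rfl : c • ρ = X := congrArg Subtype.val hc
  rw [Matrix.trace_smul, htr, smul_eq_mul, mul_one] at hXtr
  exact hX0 (by rw [hXtr, zero_smul])

variable {ρ : Matrix (Fin χ) (Fin χ) ℂ}

lemma Primitive.tendsto_pow_smul (h : Primitive A ρ) {μ : ℂ} {X : Matrix (Fin χ) (Fin χ) ℂ}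
    (hX : transfer A X = μ • X) : Tendsto (fun n => μ ^ n • X) atTop (𝓝 (X.trace • ρ)) := by
  refine (h.tendsto X).congr fun n => ?_
  induction n with
  | zero => simp
  | succ n ih =>
    rw [pow_succ', Module.End.mul_apply, ih, map_smul, pow_succ, mul_smul, ← hX]
    rfl

attribute [local instance] Matrix.normedAddCommGroup Matrix.normedSpace in
theorem Primitive.isCanonicalInjective (h : Primitive A ρ) : IsCanonicalInjective A := by
  refine ⟨h.left, ⟨ρ, h.posDef, h.fixed⟩, ?_, fun μ hμ hμ1 => ?_⟩
  · have hρmem : ρ ∈ Module.End.eigenspace (transfer A) 1 :=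
      Module.End.mem_eigenspace_iff.2 (by rw [one_smul]; exact h.fixed)
    refine (finrank_eq_one_iff_of_nonzero' ⟨ρ, hρmem⟩ fun h0 => ?_).2 fun X => ?_
    · simpa [(Submodule.mk_eq_zero _ _).1 h0] using h.trace_eq
    · have hlim := h.tendsto_pow_smul (Module.End.mem_eigenspace_iff.1 X.2)
      simp only [one_pow, one_smul] at hlim
      exact ⟨_, Subtype.ext (tendsto_nhds_unique hlim tendsto_const_nhds)⟩
  · obtain ⟨X, hX⟩ := hμ.exists_hasEigenvector
    have htr : X.trace = 0 := by
      have := (congrArg Matrix.trace hX.apply_eq_smul).symm.trans (trace_transferMap h.left X)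
      rw [Matrix.trace_smul, smul_eq_mul] at this
      by_contra h0
      exact hμ1 (mul_right_cancel₀ h0 (this.trans (one_mul _).symm))
    have hlim := (h.tendsto_pow_smul hX.apply_eq_smul).norm
    simp only [htr, zero_smul, norm_smul, norm_pow, norm_zero] at hlim
    have hpow : Tendsto (fun n => ‖μ‖ ^ n) atTop (𝓝 0) := by
      simpa [mul_assoc, hX.2] using hlim.mul_const ‖X‖⁻¹
    exact (tendsto_pow_atTop_nhds_zero_iff.1 hpow).trans_eq' (abs_norm μ)

end CanonicalInjective

section Resolvent

lemma exists_eq_add_apply_of_tendsto_pow_zero {𝕜 V : Type*} [NontriviallyNormedField 𝕜]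
    [AddCommGroup V] [Module 𝕜 V] [TopologicalSpace V] [IsTopologicalAddGroup V] [T2Space V]
    [FiniteDimensional 𝕜 V] {f : Module.End 𝕜 V}
    (hf : ∀ x, Tendsto (fun n => (f ^ n) x) atTop (𝓝 0)) (y : V) :
    ∃ x, x = y + f x ∧ Tendsto (fun n => ∑ k ∈ Finset.range n, (f ^ k) y) atTop (𝓝 x) := by
  have hinj : Function.Injective (1 - f : Module.End 𝕜 V) := by
    rw [← LinearMap.ker_eq_bot, LinearMap.ker_eq_bot']
    intro x hx
    have hfix : f x = x := (sub_eq_zero.1 hx).symm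
    refine tendsto_nhds_unique (tendsto_const_nhds.congr fun n => ?_) (hf x)
    rw [Module.End.pow_apply, Function.iterate_fixed hfix]
  obtain ⟨x, hx⟩ := LinearMap.injective_iff_surjective.1 hinj y
  refine ⟨x, sub_eq_iff_eq_add.1 hx, ?_⟩
  have hsum (n : ℕ) : x - (f ^ n) x = ∑ k ∈ Finset.range n, (f ^ k) y := by
    rw [← hx, ← LinearMap.sum_apply, ← Module.End.mul_apply, geom_sum_mul_neg]
    rfl
  simpa [hsum] using tendsto_const_nhds.sub (hf x) (a := x)

variable {ι κ : Type*} [Fintype ι] [Fintype κ]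

omit [Fintype κ] in
lemma posSemidef_of_tendsto [Finite κ] {α : Type*} {l : Filter α} [l.NeBot] {f : α → Matrix κ κ ℂ}
    {M : Matrix κ κ ℂ} (hf : ∀ a, (f a).PosSemidef) (h : Tendsto f l (𝓝 M)) : M.PosSemidef := by
  have := Fintype.ofFinite κ
  refine Matrix.PosSemidef.of_dotProduct_mulVec_nonneg ?_ fun x => ?_
  · exact tendsto_nhds_unique
      (((continuous_id.matrix_conjTranspose.tendsto M).comp h).congr fun a => (hf a).1) h
  · have hcont : Continuous fun M : Matrix κ κ ℂ => star x ⬝ᵥ (M *ᵥ x) := by fun_prop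
    exact ge_of_tendsto' ((hcont.tendsto M).comp h) fun a => (hf a).dotProduct_mulVec_nonneg x

lemma posSemidef_transferMap (A : ι → Matrix κ κ ℂ) {X : Matrix κ κ ℂ} (hX : X.PosSemidef) :
    (transferMap A X).PosSemidef := by
  rw [transferMap_apply]
  exact Matrix.posSemidef_sum _ fun s _ => hX.mul_mul_conjTranspose_same (A s)

lemma Primitive.exists_posDef_eq_one_add_smul_transferMap [DecidableEq κ]
    {A : ι → Matrix κ κ ℂ} {ρ : Matrix κ κ ℂ} (h : Primitive A ρ) {r : ℝ} (h0 : 0 ≤ r)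
    (h1 : r < 1) : ∃ X : Matrix κ κ ℂ, X.PosDef ∧
      X = 1 + (r : ℂ) • transferMap A X ∧ (1 - (r : ℂ)) * X.trace = Fintype.card κ := by
  have hpow (n : ℕ) (X : Matrix κ κ ℂ) :
      (((r : ℂ) • transferMap A) ^ n) X = (r : ℂ) ^ n • (transferMap A ^ n) X := by
    rw [smul_pow, LinearMap.smul_apply]
  have hr : Tendsto (fun n => (r : ℂ) ^ n) atTop (𝓝 0) :=
    tendsto_pow_atTop_nhds_zero_of_norm_lt_one
      (by rwa [Complex.norm_real, Real.norm_of_nonneg h0])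
  have hsmul {X : Matrix κ κ ℂ} (hX : X.PosSemidef) : ((r : ℂ) • transferMap A X).PosSemidef :=
    (posSemidef_transferMap A hX).smul (by exact_mod_cast h0 : (0 : ℂ) ≤ (r : ℂ))
  have hpsd (n : ℕ) : ((((r : ℂ) • transferMap A) ^ n) 1).PosSemidef := by
    induction n with
    | zero => exact Matrix.PosSemidef.one
    | succ n ih => rw [pow_succ', Module.End.mul_apply]; exact hsmul ih
  obtain ⟨X, hX, hlim⟩ := exists_eq_add_apply_of_tendsto_pow_zero
    (f := (r : ℂ) • transferMap A) (fun X => by simpa [hpow] using hr.smul (h.tendsto X)) 1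
  rw [LinearMap.smul_apply] at hX
  refine ⟨X, ?_, hX, ?_⟩
  · rw [hX]
    exact Matrix.PosDef.one.add_posSemidef <| hsmul <|
      posSemidef_of_tendsto (fun n => Matrix.posSemidef_sum _ fun k _ => hpsd k) hlim
  · have htr := congrArg Matrix.trace hX
    rw [Matrix.trace_add, Matrix.trace_one, Matrix.trace_smul, trace_transferMap h.left,
      smul_eq_mul] at htr
    rw [sub_mul, one_mul, sub_eq_iff_eq_add]
    exact htr

end Resolvent

section Chain

/-- The product of `A 0 (s 0)`, …, `A (n - 1) (s (n - 1))`: the matrix of a spin configuration of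
a chain whose tensor depends on the site. -/
def word {ι M : Type*} [Monoid M] (A : ℕ → ι → M) {n : ℕ} (s : Fin n → ι) : M :=
  (List.ofFn fun i : Fin n => A i (s i)).prod

lemma word_succ_last {ι M : Type*} [Monoid M] (A : ℕ → ι → M) {n : ℕ} (s : Fin (n + 1) → ι) :
    word A s = word A (fun i => s i.castSucc) * A n (s (Fin.last n)) := by
  rw [word, List.ofFn_succ_last]
  simp [word]

lemma word_snocEquiv {ι M : Type*} [Monoid M] (A : ℕ → ι → M) {n : ℕ} (p : ι × (Fin n → ι)) :
    word A (Fin.snocEquiv (fun _ => ι) p) = word A p.2 * A n p.1 := by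
  simp [word_succ_last, Fin.snocEquiv]

variable {ι κ κ' : Type*} [Fintype ι] [Fintype κ] [Fintype κ']

/-- The composition of the mixed transfer maps of a tensor `A` and of a site-dependent tensor `B`
along sites `0, …, n - 1`. -/
def mixedTransferChain (A : ι → Matrix κ κ ℂ) (B : ℕ → ι → Matrix κ' κ' ℂ) :
    ℕ → Module.End ℂ (Matrix κ κ' ℂ)
  | 0 => 1
  | n + 1 => mixedTransfer A (B n) * mixedTransferChain A B n

lemma mixedTransferChain_const (A : ι → Matrix κ κ ℂ) (B : ι → Matrix κ' κ' ℂ) (n : ℕ) :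
    mixedTransferChain A (fun _ => B) n = mixedTransfer A B ^ n := by
  induction n with
  | zero => rfl
  | succ n ih => rw [mixedTransferChain, ih, pow_succ']

lemma mixedTransferChain_add (A : ι → Matrix κ κ ℂ) (B : ℕ → ι → Matrix κ' κ' ℂ) (m n : ℕ) :
    mixedTransferChain A B (m + n) =
      mixedTransferChain A (fun j => B (m + j)) n * mixedTransferChain A B m := by
  induction n with
  | zero => simp [mixedTransferChain]
  | succ n ih => rw [← add_assoc, mixedTransferChain, ih, mixedTransferChain, mul_assoc]

lemma mixedTransferChain_mul (A : ι → Matrix κ κ ℂ) {B : ℕ → ι → Matrix κ' κ' ℂ} {L : ℕ}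
    (hB : ∀ j, B (L + j) = B j) (k : ℕ) :
    mixedTransferChain A B (k * L) = mixedTransferChain A B L ^ k := by
  induction k with
  | zero => simp [mixedTransferChain]
  | succ k ih =>
    rw [add_mul, one_mul, add_comm, mixedTransferChain_add, funext hB, ih, pow_succ]

variable [DecidableEq κ] [DecidableEq κ']

lemma mixedTransferChain_apply (A : ι → Matrix κ κ ℂ) (B : ℕ → ι → Matrix κ' κ' ℂ) (n : ℕ)
    (X : Matrix κ κ' ℂ) : mixedTransferChain A B n X =
      ∑ s : Fin n → ι, (word (fun _ => A) s)ᴴ * X * word B s := by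
  induction n with
  | zero => simp [mixedTransferChain, word]
  | succ n ih =>
    rw [mixedTransferChain, Module.End.mul_apply, ih, mixedTransfer_apply,
      ← (Fin.snocEquiv fun _ => ι).sum_comp, Fintype.sum_prod_type]
    simp only [word_snocEquiv, Matrix.conjTranspose_mul, Matrix.mul_sum,
      Matrix.sum_mul, Matrix.mul_assoc]

lemma trace_end_matrix (f : Module.End ℂ (Matrix κ κ' ℂ)) :
    LinearMap.trace ℂ _ f = ∑ i, ∑ j, (f (Matrix.single i j 1)) i j := by
  rw [LinearMap.trace_eq_matrix_trace ℂ (Matrix.stdBasis ℂ κ κ')]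
  simp only [Matrix.trace, Matrix.diag, LinearMap.toMatrix_apply, Fintype.sum_prod_type,
    Matrix.stdBasis_eq_single]
  rfl

lemma trace_mixedTransferChain (A : ι → Matrix κ κ ℂ) (B : ℕ → ι → Matrix κ' κ' ℂ) (n : ℕ) :
    LinearMap.trace ℂ _ (mixedTransferChain A B n) =
      ∑ s : Fin n → ι, star (word (fun _ => A) s).trace * (word B s).trace := by
  have hsandwich (P : Matrix κ κ ℂ) (Q : Matrix κ' κ' ℂ) :
      ∑ i, ∑ j, (Pᴴ * (Matrix.single i j 1 : Matrix κ κ' ℂ) * Q) i j = star P.trace * Q.trace := by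
    rw [← Matrix.trace_conjTranspose, Matrix.trace, Matrix.trace, Finset.sum_mul_sum]
    refine Finset.sum_congr rfl fun i _ => Finset.sum_congr rfl fun j _ => ?_
    simp [Matrix.mul_apply, Matrix.single_apply, ite_and]
  simp only [trace_end_matrix, mixedTransferChain_apply, Matrix.sum_apply, ← hsandwich]
  exact (Finset.sum_congr rfl fun i _ => Finset.sum_comm).trans Finset.sum_comm

lemma Primitive.tendsto_trace {A : ι → Matrix κ κ ℂ} {ρ : Matrix κ κ ℂ} (h : Primitive A ρ) :
    Tendsto (fun n => LinearMap.trace ℂ _ (mixedTransfer A A ^ n)) atTop (𝓝 1) := by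
  have hsum : ∑ i, ∑ j, ((ρ * Matrix.single i j 1).trace • (1 : Matrix κ κ ℂ)) i j = 1 := by
    simpa [Matrix.one_apply, Matrix.trace, Matrix.mul_apply, Matrix.single_apply, ite_and]
      using h.trace_eq
  rw [← hsum]
  simp only [trace_end_matrix]
  exact tendsto_finsetSum _ fun i _ => tendsto_finsetSum _ fun j _ =>
    ((h.tendsto_mixedTransfer_pow (Matrix.single i j 1)).apply_nhds i).apply_nhds j

lemma exists_eventually_hasDominantEigenline_mixedTransfer {A₀ : ι → Matrix κ κ ℂ}
    {B : ι → Matrix κ' κ' ℂ} {ρ : Matrix κ' κ' ℂ} (hA : ∑ s, (A₀ s)ᴴ * A₀ s = 1)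
    (hB : Primitive B ρ)
    (htr : Tendsto (fun n => LinearMap.trace ℂ _ (mixedTransfer A₀ B ^ n)) atTop (𝓝 1)) {L : ℕ}
    (hL : 1 ≤ L) :
    ∃ N : ℕ, 1 ≤ N ∧ L ∣ N ∧ ∀ᶠ A in 𝓝 A₀, HasDominantEigenline (mixedTransfer A B ^ N) := by
  have hcont (X : Matrix κ κ' ℂ) : Continuous fun A : ι → Matrix κ κ ℂ => mixedTransfer A B X := by
    change Continuous fun A : ι → Matrix κ κ ℂ => ∑ s, (A s)ᴴ * X * B s
    fun_prop
  exact @exists_eventually_hasDominantEigenline (Matrix κ κ' ℂ)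
    Matrix.frobeniusNormedAddCommGroup Matrix.frobeniusNormedSpace _ _ _ _ hcont _
    (exists_norm_mixedTransfer_pow_le hA hB.posDef hB.fixed) htr _ hL

end Chain

section PhysMap

variable {ι ι' ι'' κ κ' E : Type*} [Fintype ι] [AddCommMonoid E] [Module ℂ E]

/-- The action of a matrix on the physical leg of a tensor whose legs are indexed by arbitrary
types; for `Fin`-indexed legs this is `physAct`. -/
def physMap (M : Matrix ι' ι ℂ) (A : ι → E) : ι' → E := fun s => ∑ s', M s s' • A s'

lemma physMap_mul [Fintype ι'] (M : Matrix ι'' ι' ℂ) (N : Matrix ι' ι ℂ) (A : ι → E) :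
    physMap (M * N) A = physMap M (physMap N A) := by
  funext s
  simp only [physMap, Matrix.mul_apply, Finset.smul_sum, Finset.sum_smul, smul_smul]
  exact Finset.sum_comm

variable [Fintype κ] [Fintype κ']

lemma physMap_smul_mul_mul (M : Matrix ι' ι ℂ) (c : ℂ) (P : Matrix κ κ ℂ) (A : ι → Matrix κ κ' ℂ)
    (Q : Matrix κ' κ' ℂ) :
    physMap M (fun s => c • (P * A s * Q)) = fun s => c • (P * physMap M A s * Q) := by
  funext s
  simp only [physMap, Matrix.mul_sum, Matrix.sum_mul, Finset.smul_sum, Matrix.mul_smul,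
    Matrix.smul_mul, smul_comm c]

variable [DecidableEq ι] [Fintype ι'] {M : Matrix ι' ι ℂ}

lemma mixedTransfer_physMap (hM : Mᴴ * M = 1) (A : ι → Matrix κ κ ℂ) (B : ι → Matrix κ' κ' ℂ) :
    mixedTransfer (physMap M A) (physMap M B) = mixedTransfer A B := by
  ext1 X
  calc mixedTransfer (physMap M A) (physMap M B) X =
        ∑ r, ∑ s, ∑ s', (Mᴴ s r * M r s') • ((A s)ᴴ * X * B s') := by
        simp only [mixedTransfer_apply, physMap, Matrix.conjTranspose_sum,
          Matrix.conjTranspose_smul, Matrix.conjTranspose_apply, Matrix.sum_mul, Matrix.mul_sum,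
          Matrix.smul_mul, Matrix.mul_smul]
        refine Finset.sum_congr rfl fun r _ => ?_
        simp only [Finset.smul_sum, smul_smul]
        rw [Finset.sum_comm]
        simp only [mul_comm]
    _ = ∑ s, ∑ s', (Mᴴ * M) s s' • ((A s)ᴴ * X * B s') := by
        simp only [Matrix.mul_apply (M := Mᴴ), Finset.sum_smul]
        rw [Finset.sum_comm]
        exact Finset.sum_congr rfl fun s _ => Finset.sum_comm
    _ = mixedTransfer A B X := by simp [hM, Matrix.one_apply, mixedTransfer_apply]

lemma transferMap_physMap (hM : Mᴴ * M = 1) (A : ι → Matrix κ κ ℂ) :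
    transferMap (physMap M A) = transferMap A := by
  ext1 X
  refine Matrix.ext_iff_trace_mul_left.2 fun Y => ?_
  rw [trace_mul_transferMap, trace_mul_transferMap, mixedTransfer_physMap hM]

end PhysMap

section Push

variable {Γ Γ' ι κ κ' : Type*} [Fintype ι] [DecidableEq ι] [Fintype κ] [DecidableEq κ]
  [Fintype κ'] [DecidableEq κ']

lemma coe_conjTranspose_mul_self (v : Matrix.unitaryGroup κ ℂ) : v.1ᴴ * v.1 = 1 :=
  Matrix.mem_unitaryGroup_iff'.1 v.2

lemma coe_mul_conjTranspose_self (v : Matrix.unitaryGroup κ ℂ) : v.1 * v.1ᴴ = 1 :=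
  Matrix.mem_unitaryGroup_iff.1 v.2

lemma norm_eq_one_of_mul_mul_eq_smul {v : Matrix.unitaryGroup κ ℂ} {w : Matrix.unitaryGroup κ' ℂ}
    {y : Matrix κ κ' ℂ} (hy : y ≠ 0) {c : ℂ} (h : v.1 * y * w.1ᴴ = c • y) : ‖c‖ = 1 := by
  have htrace : (yᴴ * y).trace ≠ 0 := mt Matrix.trace_conjTranspose_mul_self_eq_zero_iff.1 hy
  have hconj : (v.1 * y * w.1ᴴ)ᴴ * (v.1 * y * w.1ᴴ) = w.1 * (yᴴ * y) * w.1ᴴ := by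
    calc _ = w.1 * (yᴴ * (v.1ᴴ * v.1) * y) * w.1ᴴ := by
          simp only [Matrix.conjTranspose_mul, Matrix.conjTranspose_conjTranspose, Matrix.mul_assoc]
      _ = _ := by rw [coe_conjTranspose_mul_self, Matrix.mul_one]
  have hisometry := congrArg Matrix.trace hconj
  rw [h, Matrix.trace_mul_comm (w.1 * _), ← Matrix.mul_assoc, coe_conjTranspose_mul_self,
    Matrix.one_mul, Matrix.conjTranspose_smul, Matrix.smul_mul, Matrix.mul_smul, smul_smul,
    Matrix.trace_smul, smul_eq_mul, mul_eq_right₀ htrace, Complex.star_def, Complex.conj_mul']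
    at hisometry
  exact (pow_eq_one_iff_of_nonneg (norm_nonneg c) two_ne_zero).1 (by exact_mod_cast hisometry)

/-- Projective unitary representations with multiplier `ω`. -/
def IsProjectiveRep {G : Type*} [Mul G] (ω : G → G → Circle) (v : G → Matrix.unitaryGroup κ ℂ) :
    Prop :=
  ∀ g k, (v g).1 * (v k).1 = (ω g k : ℂ) • (v (g * k)).1

/-- The push-through condition `U_γ · A = φ(γ) v(γ)† A v(τ γ)` for a family of symmetries indexed by
an arbitrary type `Γ`, on which translation by one site acts by `τ`. Apart from `Γ = G` and
`τ = T`, it is used for pairs of group elements and for group elements at a given site. -/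
def PushesTo (τ : Γ → Γ) (U : Γ → Matrix.unitaryGroup ι ℂ) (v : Γ → Matrix.unitaryGroup κ ℂ)
    (φ : Γ → Circle) (A : ι → Matrix κ κ ℂ) : Prop :=
  ∀ γ s, physMap (U γ).1 A s = (φ γ : ℂ) • ((v γ).1ᴴ * A s * (v (τ γ)).1)

namespace PushesTo

variable {τ : Γ → Γ} {U U' : Γ → Matrix.unitaryGroup ι ℂ} {A : ι → Matrix κ κ ℂ}
  {B : ι → Matrix κ' κ' ℂ} {v v' : Γ → Matrix.unitaryGroup κ ℂ}
  {w : Γ → Matrix.unitaryGroup κ' ℂ} {φ φ' ψ : Γ → Circle}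

lemma comp (h : PushesTo τ U v φ A) {σ : Γ' → Γ} {τ' : Γ' → Γ'} (hσ : Function.Semiconj σ τ' τ) :
    PushesTo τ' (U ∘ σ) (v ∘ σ) (φ ∘ σ) A := fun γ s => by
  simp only [Function.comp_apply, h (σ γ) s, hσ γ]

lemma mul (h : PushesTo τ U v φ A) (h' : PushesTo τ U' v' φ' A) :
    PushesTo τ (U * U') (v * v') (φ * φ') A := fun γ s => by
  have hU : ((U * U') γ).1 = (U γ).1 * (U' γ).1 := rfl
  rw [hU, physMap_mul, funext (h' γ), physMap_smul_mul_mul]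
  simp only [h γ s, Pi.mul_apply, Circle.coe_mul, Submonoid.coe_mul, Matrix.conjTranspose_mul,
    Matrix.mul_smul, Matrix.smul_mul, smul_smul, mul_comm (φ' γ : ℂ), Matrix.mul_assoc]

lemma mixedTransfer_conj (hA : PushesTo τ U v φ A) (hB : PushesTo τ U w ψ B) (γ : Γ)
    (X : Matrix κ κ' ℂ) : mixedTransfer A B ((v γ).1 * X * (w γ).1ᴴ) =
      ((φ γ / ψ γ : Circle) : ℂ) • ((v (τ γ)).1 * mixedTransfer A B X * (w (τ γ)).1ᴴ) := by
  have hphys : mixedTransfer A B X = ((ψ γ / φ γ : Circle) : ℂ) •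
      ((v (τ γ)).1ᴴ * mixedTransfer A B ((v γ).1 * X * (w γ).1ᴴ) * (w (τ γ)).1) := by
    have h := DFunLike.congr_fun (mixedTransfer_physMap (coe_conjTranspose_mul_self (U γ)) A B) X
    rw [← h]
    simp only [mixedTransfer_apply, hA γ _, hB γ _, Matrix.conjTranspose_smul,
      Matrix.conjTranspose_mul, Matrix.conjTranspose_conjTranspose, Matrix.smul_mul,
      Matrix.mul_smul, smul_smul, Matrix.mul_sum, Matrix.sum_mul, Finset.smul_sum,
      Matrix.mul_assoc, div_eq_mul_inv, Circle.coe_mul, Circle.coe_inv_eq_conj, Complex.star_def]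
  simp only [hphys, Matrix.mul_smul, Matrix.smul_mul, smul_smul, ← Circle.coe_mul,
    div_mul_div_cancel, div_self', Circle.coe_one, one_smul, Matrix.mul_assoc _ _ (w _).1ᴴ,
    coe_mul_conjTranspose_self, Matrix.mul_one]
  rw [← Matrix.mul_assoc (v (τ γ)).1, coe_mul_conjTranspose_self, Matrix.one_mul]

lemma mixedTransfer_pow_conj (hA : PushesTo τ U v φ A) (hB : PushesTo τ U w ψ B) (n : ℕ) (γ : Γ)
    (X : Matrix κ κ' ℂ) :
    ∃ p : Circle, (mixedTransfer A B ^ n) ((v γ).1 * X * (w γ).1ᴴ) =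
      (p : ℂ) • ((v (τ^[n] γ)).1 * (mixedTransfer A B ^ n) X * (w (τ^[n] γ)).1ᴴ) := by
  induction n with
  | zero => exact ⟨1, by simp⟩
  | succ n ih =>
    obtain ⟨p, hp⟩ := ih
    refine ⟨p * (φ (τ^[n] γ) / ψ (τ^[n] γ)), ?_⟩
    rw [pow_succ', Module.End.mul_apply, Module.End.mul_apply, hp, map_smul,
      mixedTransfer_conj hA hB, smul_smul, Function.iterate_succ_apply', Circle.coe_mul]

lemma exists_circle_of_forall_eq_smul (hA : PushesTo τ U v φ A) (hB : PushesTo τ U w ψ B)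
    {y : Matrix κ κ' ℂ} (hy : y ≠ 0) {ν : ℂ} (hν : ν ≠ 0) (hyν : mixedTransfer A B y = ν • y)
    (hscalar : ∀ γ, ∃ z : ℂ, (v γ).1 * y * (w γ).1ᴴ = z • y) :
    ∃ z : Γ → Circle, (∀ γ, (v γ).1 * y = (z γ : ℂ) • (y * (w γ).1)) ∧
      ∀ γ, ψ γ * z γ = φ γ * z (τ γ) := by
  have hcircle (γ : Γ) : ∃ z : Circle, (v γ).1 * y * (w γ).1ᴴ = (z : ℂ) • y := by
    obtain ⟨z, hz⟩ := hscalar γ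
    exact ⟨⟨z, mem_sphere_zero_iff_norm.2 (norm_eq_one_of_mul_mul_eq_smul hy hz)⟩, hz⟩
  choose z hz using hcircle
  refine ⟨z, fun γ => ?_, fun γ => ?_⟩
  · rw [← Matrix.smul_mul, ← hz, Matrix.mul_assoc _ _ (w γ).1, coe_conjTranspose_mul_self,
      Matrix.mul_one]
  · have hcomm := mixedTransfer_conj hA hB γ y
    rw [hz, map_smul, hyν, Matrix.mul_smul, Matrix.smul_mul, hz, smul_smul, smul_smul,
      smul_smul] at hcomm
    have hz_eq : (z γ : ℂ) = (φ γ / ψ γ : Circle) * z (τ γ) :=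
      mul_right_cancel₀ hν ((smul_left_injective ℂ hy hcomm).trans (by ring))
    rw [Circle.ext (hz_eq.trans (Circle.coe_mul _ _).symm), ← mul_assoc, mul_div_cancel]

lemma exists_circle_of_hasDominantEigenline (hA : PushesTo τ U v φ A) (hB : PushesTo τ U w ψ B)
    {N : ℕ} (hN : 1 ≤ N) (hτ : τ^[N] = id) (hdom : HasDominantEigenline (mixedTransfer A B ^ N)) :
    ∃ y : Matrix κ κ' ℂ, y ≠ 0 ∧
      ∃ z : Γ → Circle, (∀ γ, (v γ).1 * y = (z γ : ℂ) • (y * (w γ).1)) ∧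
        ∀ γ, ψ γ * z γ = φ γ * z (τ γ) := by
  obtain ⟨μ, y, hμ, hy, hμy, hdom⟩ := hdom
  obtain ⟨ν, hν⟩ := hdom μ (mixedTransfer A B y)
    (by rw [← Module.End.mul_apply, ← pow_succ, pow_succ', Module.End.mul_apply, hμy, map_smul]) rfl
  have hν0 : ν ≠ 0 := by
    rintro rfl
    refine smul_ne_zero hμ hy ?_
    rw [← hμy, ← Nat.sub_add_cancel hN, pow_succ, Module.End.mul_apply, hν, zero_smul, map_zero]
  refine ⟨y, hy, exists_circle_of_forall_eq_smul hA hB hy hν0 hν fun γ => ?_⟩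
  obtain ⟨p, hp⟩ := mixedTransfer_pow_conj hA hB N γ y
  rw [hτ, id, hμy, Matrix.mul_smul, Matrix.smul_mul, smul_smul] at hp
  exact hdom _ _ hp (by rw [norm_mul, Circle.norm_coe, one_mul])

lemma exists_circle_of_primitive {ρ : Matrix κ κ ℂ} (hρ : Primitive A ρ)
    (h : PushesTo τ U v φ A) (h' : PushesTo τ U v' φ' A) :
    ∃ z : Γ → Circle, (∀ γ, (v γ).1 = (z γ : ℂ) • (v' γ).1) ∧ ∀ γ, φ' γ * z γ = φ γ * z (τ γ) := by
  have := hρ.nonempty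
  have hscalar (γ : Γ) : ∃ c : ℂ, (v γ).1 * 1 * (v' γ).1ᴴ = c • 1 := by
    refine ⟨_, hρ.eq_smul_one_of_forall_mixedTransfer_eq_smul
      (X := fun n => (v (τ^[n] γ)).1 * 1 * (v' (τ^[n] γ)).1ᴴ)
      (a := fun n => (φ (τ^[n] γ) / φ' (τ^[n] γ) : Circle)) (fun n => ?_)
      (fun n => Circle.norm_coe _) fun n => ?_⟩
    · rw [Matrix.mul_one]
      exact coe_conjTranspose_mul_self (v (τ^[n] γ) * (v' (τ^[n] γ))⁻¹)
    · rw [mixedTransfer_conj h h', mixedTransfer_one hρ.left, Function.iterate_succ_apply']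
  simpa using exists_circle_of_forall_eq_smul h h' one_ne_zero one_ne_zero
    (by rw [mixedTransfer_one hρ.left, one_smul]) hscalar

lemma exists_isCrystallineCocycle {G : Type} [Group G] {T : MulAut G}
    {U : G →* Matrix.unitaryGroup ι ℂ} {v : G → Matrix.unitaryGroup κ ℂ} {φ : G → Circle}
    {ρ : Matrix κ κ ℂ} (hρ : Primitive A ρ) (h : PushesTo T U v φ A) :
    ∃ ω : G → G → Circle, IsProjectiveRep ω v ∧ IsCrystallineCocycle T ω φ := by
  have := hρ.nonempty
  have hfst : PushesTo (Prod.map T T) _ _ _ A := h.comp (σ := Prod.fst) fun _ => rfl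
  have hsnd : PushesTo (Prod.map T T) _ _ _ A := h.comp (σ := Prod.snd) fun _ => rfl
  have hmul : PushesTo (Prod.map T T) _ _ _ A := h.comp (σ := fun p : G × G => p.1 * p.2)
    fun p => (map_mul T p.1 p.2).symm
  have hU : (U ∘ Prod.fst) * (U ∘ Prod.snd) = U ∘ fun p : G × G => p.1 * p.2 :=
    funext fun p => (map_mul U p.1 p.2).symm
  obtain ⟨ω, hω, hφ⟩ := exists_circle_of_primitive hρ (hU ▸ hfst.mul hsnd) hmul
  have hω' : IsProjectiveRep (fun g k => ω (g, k)) v := fun g k => hω (g, k)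
  refine ⟨fun g k => ω (g, k), hω', ⟨?_, fun g k => hφ (g, k)⟩⟩
  have hv (h : G) : (v h).1 ≠ 0 := fun h0 => one_ne_zero <|
    (coe_mul_conjTranspose_self (v h)).symm.trans (by rw [h0, Matrix.zero_mul])
  refine isCocycle_of_mul_eq (s := fun h => (v h).1)
    (i := fun a : Circle => (a : ℂ) • (1 : Matrix κ κ ℂ))
    (fun a b h => by simp [smul_smul, mul_comm]) (fun a h => by simp) (fun h a b hab => ?_)
    fun g k => by simp [hω' g k]
  exact Circle.ext (smul_left_injective ℂ (hv h) (by simpa using hab))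

end PushesTo

end Push

section PushExists

variable {Γ ι κ : Type*} [Fintype ι] [Fintype κ] [DecidableEq κ] {A : ι → Matrix κ κ ℂ}

lemma word_physMap (M : ℕ → Matrix ι ι ℂ) (A : ι → Matrix κ κ ℂ) {n : ℕ}
    (s : Fin n → ι) : word (fun j => physMap (M j) A) s =
      ∑ s' : Fin n → ι, (∏ j : Fin n, M j (s j) (s' j)) • word (fun _ => A) s' := by
  induction n with
  | zero => simp [word]
  | succ n ih =>
    obtain ⟨⟨a, s⟩, rfl⟩ := (Fin.snocEquiv fun _ => ι).surjective s
    rw [word_snocEquiv, ih, ← (Fin.snocEquiv fun _ => ι).sum_comp, Fintype.sum_prod_type,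
      Finset.sum_comm, Matrix.sum_mul]
    refine Finset.sum_congr rfl fun s' _ => ?_
    rw [physMap, Matrix.mul_sum]
    refine Finset.sum_congr rfl fun b _ => ?_
    rw [word_snocEquiv, Fin.prod_univ_castSucc, Matrix.smul_mul, Matrix.mul_smul, smul_smul]
    simp [Fin.snocEquiv]

lemma trace_word_physMap (M : ℕ → Matrix ι ι ℂ) (A : ι → Matrix κ κ ℂ) {n : ℕ} (s : Fin n → ι) :
    (word (fun j => physMap (M j) A) s).trace =
      ∑ s' : Fin n → ι, (∏ j : Fin n, M j (s j) (s' j)) * (word (fun _ => A) s').trace := by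
  simp only [word_physMap, Matrix.trace_sum, Matrix.trace_smul, smul_eq_mul]

namespace Primitive

variable {ρ : Matrix κ κ ℂ} {L : ℕ}

/-- Otherwise the traces of the powers of the transfer map of one period would tend to zero,
whereas up to phases they are the traces of the powers of `mixedTransfer A A`. -/
lemma exists_eigenvector_mixedTransferChain (hρ : Primitive A ρ) {B : ℕ → ι → Matrix κ κ ℂ}
    (hL : 1 ≤ L) (hB : ∀ j, B (L + j) = B j)
    (hword : ∀ k, 1 ≤ k → ∃ θ : Circle, ∀ s : Fin (k * L) → ι,
      (word B s).trace = θ * (word (fun _ => A) s).trace) :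
    ∃ (μ : ℂ) (x : Matrix κ κ ℂ), x ≠ 0 ∧ mixedTransferChain A B L x = μ • x ∧ 1 ≤ ‖μ‖ := by
  by_contra! hcon
  have hzero := (@tendsto_trace_pow_zero_of_eigenvalues (Matrix κ κ ℂ)
    Matrix.frobeniusNormedAddCommGroup Matrix.frobeniusNormedSpace _ _
    fun μ x hx hμx => hcon μ x hx hμx).norm
  have hone := (hρ.tendsto_trace.comp (tendsto_id.atTop_mul_const' (by omega : 0 < L))).norm
  rw [norm_zero] at hzero
  rw [norm_one] at hone
  refine zero_ne_one (tendsto_nhds_unique hzero (hone.congr' ?_))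
  filter_upwards [eventually_ge_atTop 1] with k hk
  obtain ⟨θ, hθ⟩ := hword k hk
  rw [Function.comp_apply, id, ← mixedTransferChain_mul A hB, ← mixedTransferChain_const,
    trace_mixedTransferChain, trace_mixedTransferChain]
  simp only [hθ, mul_left_comm _ (θ : ℂ)]
  rw [← Finset.mul_sum, norm_mul, Circle.norm_coe, one_mul]

end Primitive

lemma exists_smul_mem_unitaryGroup {J : Type*} {Y : J → Matrix κ κ ℂ} {c : ℂ}
    (hY : ∀ j, (Y j)ᴴ * Y j = c • 1) {j₀ : J} (hj₀ : Y j₀ ≠ 0) :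
    ∃ r : ℂ, ∀ j, r • Y j ∈ Matrix.unitaryGroup κ ℂ := by
  have : Nonempty κ := by
    by_contra h
    rw [not_nonempty_iff] at h
    exact hj₀ (Subsingleton.elim _ _)
  have hc : c ≠ 0 := by
    rintro rfl
    exact hj₀ (Matrix.conjTranspose_mul_self_eq_zero.1 (by rw [hY, zero_smul]))
  have hnonneg : 0 ≤ c := by
    simpa [hY] using (Matrix.posSemidef_conjTranspose_mul_self (Y j₀)).diag_nonneg
      (i := Classical.arbitrary κ)
  have hnorm : (‖c‖ : ℂ) = c := Complex.norm_of_nonneg' hnonneg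
  refine ⟨((√‖c‖)⁻¹ : ℝ), fun j => Matrix.mem_unitaryGroup_iff'.2 ?_⟩
  rw [Matrix.star_eq_conjTranspose, Matrix.conjTranspose_smul, Matrix.smul_mul, Matrix.mul_smul,
    smul_smul, hY, smul_smul, Complex.star_def, Complex.conj_ofReal, ← Complex.ofReal_mul,
    ← mul_inv, Real.mul_self_sqrt (norm_nonneg c), Complex.ofReal_inv, hnorm, inv_mul_cancel₀ hc,
    one_smul]

variable [DecidableEq ι]

lemma PushesTo.word_physMap_eq {Γ : Type*} {τ : Γ → Γ} {U : Γ → Matrix.unitaryGroup ι ℂ}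
    {v : Γ → Matrix.unitaryGroup κ ℂ} {φ : Γ → Circle} (h : PushesTo τ U v φ A) (γ : Γ) {n : ℕ}
    (s : Fin n → ι) : word (fun j => physMap (U (τ^[j] γ)).1 A) s =
      ((∏ j : Fin n, φ (τ^[j] γ) : Circle) : ℂ) •
        ((v γ).1ᴴ * word (fun _ => A) s * (v (τ^[n] γ)).1) := by
  induction n with
  | zero => simp [word, coe_conjTranspose_mul_self]
  | succ n ih =>
    obtain ⟨⟨a, s⟩, rfl⟩ := (Fin.snocEquiv fun _ => ι).surjective s
    rw [word_snocEquiv, word_snocEquiv, ih, h, Fin.prod_univ_castSucc, Circle.coe_mul,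
      Matrix.smul_mul, Matrix.mul_smul, smul_smul, Function.iterate_succ_apply']
    simp only [Fin.val_castSucc, Fin.val_last]
    congr 1
    simp only [← Matrix.mul_assoc]
    rw [Matrix.mul_assoc _ _ (v _).1ᴴ, coe_mul_conjTranspose_self, Matrix.mul_one]

namespace Primitive

variable {ρ : Matrix κ κ ℂ} {L : ℕ} {U : ℕ → Matrix.unitaryGroup ι ℂ}

/-- The weighted norms of the images of `x` decrease along the chain and do not decrease over a
period, so they are constant. -/
lemma exists_intertwining_sequence (hρ : Primitive A ρ) (hL : 1 ≤ L) (hU : ∀ j, U (L + j) = U j)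
    {μ : ℂ} {x : Matrix κ κ ℂ} (hx : x ≠ 0)
    (hμx : mixedTransferChain A (fun j => physMap (U j).1 A) L x = μ • x) (hμ : 1 ≤ ‖μ‖) :
    ‖μ‖ = 1 ∧ ∃ Y : ℕ → Matrix κ κ ℂ, Y 0 ≠ 0 ∧ Y L = μ • Y 0 ∧
      ∀ j s, A s * Y (j + 1) = Y j * physMap (U j).1 A s := by
  let Y (j : ℕ) := mixedTransferChain A (fun j => physMap (U j).1 A) j x
  have hfix (j : ℕ) : transferMap (physMap (U j).1 A) ρ = ρ := by
    rw [transferMap_physMap (coe_conjTranspose_mul_self _), hρ.fixed]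
  have hanti : Antitone fun j => weightedNormSq ρ (Y j) := antitone_nat_of_succ_le fun j =>
    weightedNormSq_mixedTransfer_le hρ.left hρ.posDef (hfix j) (Y j)
  have hperiod (j : ℕ) : weightedNormSq ρ (Y (L + j)) = ‖μ‖ ^ 2 * weightedNormSq ρ (Y j) := by
    simp only [Y, mixedTransferChain_add, hU, Module.End.mul_apply, hμx, map_smul,
      weightedNormSq_smul]
  refine ⟨le_antisymm ?_ hμ, Y, hx, hμx, fun j s =>
    mul_mixedTransfer_eq_of_weightedNormSq_le hρ.left hρ.posDef (hfix j) ?_ s⟩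
  · have hpos : 0 < weightedNormSq ρ (Y 0) :=
      lt_of_not_ge (mt (weightedNormSq_le_zero_iff hρ.posDef).1 hx)
    have hle : weightedNormSq ρ (Y (L + 0)) ≤ weightedNormSq ρ (Y 0) := hanti (Nat.zero_le _)
    rw [hperiod] at hle
    exact (sq_le_one_iff₀ (norm_nonneg μ)).1 (le_of_mul_le_mul_right (by rwa [one_mul]) hpos)
  · calc weightedNormSq ρ (Y j) ≤ ‖μ‖ ^ 2 * weightedNormSq ρ (Y j) :=
          le_mul_of_one_le_left (weightedNormSq_nonneg hρ.posDef _) (one_le_pow₀ hμ)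
      _ ≤ weightedNormSq ρ (Y (j + 1)) := by
          rw [← hperiod]
          exact hanti (by omega)

lemma exists_conjTranspose_mul_self_eq_smul_one (hρ : Primitive A ρ) (hL : 1 ≤ L)
    {Y : ℕ → Matrix κ κ ℂ} (hY : ∀ j s, A s * Y (j + 1) = Y j * physMap (U j).1 A s) {μ : ℂ}
    (hμ : ‖μ‖ = 1) (hYL : Y L = μ • Y 0) : ∃ c : ℂ, ∀ j, (Y j)ᴴ * Y j = c • 1 := by
  have hstep (j : ℕ) : mixedTransfer A A ((Y j)ᴴ * Y j) = (Y (j + 1))ᴴ * Y (j + 1) := by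
    rw [← mixedTransfer_physMap (coe_conjTranspose_mul_self (U j)) A A, mixedTransfer_apply]
    calc _ = ∑ s, (Y j * physMap (U j).1 A s)ᴴ * (Y j * physMap (U j).1 A s) := by
          simp only [Matrix.conjTranspose_mul, Matrix.mul_assoc]
      _ = ∑ s, (Y (j + 1))ᴴ * ((A s)ᴴ * A s) * Y (j + 1) := by
          simp only [← hY, Matrix.conjTranspose_mul, Matrix.mul_assoc]
      _ = _ := by rw [← Matrix.sum_mul, ← Matrix.mul_sum, hρ.left, Matrix.mul_one]
  have hpow (j : ℕ) : (mixedTransfer A A ^ j) ((Y 0)ᴴ * Y 0) = (Y j)ᴴ * Y j := by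
    induction j with
    | zero => rfl
    | succ j ih => rw [pow_succ', Module.End.mul_apply, ih, hstep]
  have hfix : (mixedTransfer A A ^ L) ((Y 0)ᴴ * Y 0) = (Y 0)ᴴ * Y 0 := by
    rw [hpow, hYL, Matrix.conjTranspose_smul, Matrix.smul_mul, Matrix.mul_smul, smul_smul,
      Complex.star_def, Complex.conj_mul', hμ]
    simp
  obtain ⟨c, hc⟩ : ∃ c : ℂ, (Y 0)ᴴ * Y 0 = c • 1 :=
    ⟨_, hρ.eq_smul_one_of_mixedTransfer_pow_eq hL hfix⟩
  refine ⟨c, fun j => (hpow j).symm.trans ?_⟩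
  rw [hc, map_smul, Module.End.pow_apply, Function.iterate_fixed (mixedTransfer_one hρ.left)]

lemma exists_bond_unitaries (hρ : Primitive A ρ) (hL : 1 ≤ L) (hU : ∀ j, U (L + j) = U j)
    (hword : ∀ k, 1 ≤ k → ∃ θ : Circle, ∀ s : Fin (k * L) → ι,
      (word (fun j => physMap (U j).1 A) s).trace = θ * (word (fun _ => A) s).trace) :
    ∃ V : ℕ → Matrix.unitaryGroup κ ℂ, ∀ j s,
      physMap (U j).1 A s = (V j).1ᴴ * A s * (V (j + 1)).1 := by
  obtain ⟨μ, x, hx, hμx, hμ⟩ := hρ.exists_eigenvector_mixedTransferChain hL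
    (B := fun j => physMap (U j).1 A) (fun j => by simp only [hU]) hword
  obtain ⟨hμ_norm, Y, hY₀, hYL, hY⟩ := hρ.exists_intertwining_sequence hL hU hx hμx hμ
  obtain ⟨c, hc⟩ := hρ.exists_conjTranspose_mul_self_eq_smul_one hL hY hμ_norm hYL
  obtain ⟨r, hr⟩ := exists_smul_mem_unitaryGroup hc hY₀
  refine ⟨fun j => ⟨_, hr j⟩, fun j s => ?_⟩
  calc physMap (U j).1 A s = (r • Y j)ᴴ * (r • Y j) * physMap (U j).1 A s := by
        rw [← Matrix.star_eq_conjTranspose, Matrix.mem_unitaryGroup_iff'.1 (hr j), Matrix.one_mul]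
    _ = (r • Y j)ᴴ * A s * (r • Y (j + 1)) := by
        rw [Matrix.mul_assoc, Matrix.mul_assoc, Matrix.smul_mul, ← hY]
        simp only [Matrix.mul_smul]

end Primitive

variable {G : Type} [Group G] {T : MulAut G} {L d χ : ℕ} {U : G →* Matrix.unitaryGroup (Fin d) ℂ}
  {A : MPSTensor d χ}

lemma iterate_mulAut_eq_pow (T : MulAut G) (n : ℕ) (g : G) : T^[n] g = (T ^ n) g := by
  induction n with
  | zero => rfl
  | succ n ih => rw [Function.iterate_succ_apply', ih, pow_succ', MulAut.mul_apply]

lemma iterate_mulAut_mul_eq_id (hT : T ^ L = 1) (k : ℕ) : T^[k * L] = id := by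
  funext g
  rw [iterate_mulAut_eq_pow, mul_comm, pow_mul, hT, one_pow, MulAut.one_apply, id]

lemma PushesTo.isSymmetric {v : G → Matrix.unitaryGroup (Fin χ) ℂ} {φ : G → Circle}
    (hT : T ^ L = 1) (h : PushesTo T U v φ A) : IsSymmetric T L U A := by
  intro k _ g
  refine ⟨∏ j : Fin (k * L), φ (T^[j] g), fun s => ?_⟩
  simp only [← iterate_mulAut_eq_pow]
  refine (trace_word_physMap (fun j => (U (T^[j] g)).1) A s).symm.trans ?_
  rw [h.word_physMap_eq (U := U) g s, Matrix.trace_smul, iterate_mulAut_mul_eq_id hT, id,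
    Matrix.trace_mul_comm, ← Matrix.mul_assoc, coe_mul_conjTranspose_self, Matrix.one_mul]
  rfl

lemma pushThrough_iff_pushesTo {S : SymMPS T L} {v : G → Matrix.unitaryGroup (Fin S.χ) ℂ}
    {φ : G → Circle} : S.PushThrough v φ ↔ PushesTo T S.U v φ S.A := by
  refine ⟨fun h g s => h 0 g s, fun h j g s => ?_⟩
  rw [pow_succ', MulAut.mul_apply]
  exact h ((T ^ j) g) s

lemma Primitive.exists_pushesTo {ρ : Matrix (Fin χ) (Fin χ) ℂ} (hρ : Primitive A ρ) (hL : 1 ≤ L)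
    (hT : T ^ L = 1) (hsymm : IsSymmetric T L U A) : ∃ v φ, PushesTo T U v φ A := by
  have hbond (g : G) : ∃ V : ℕ → Matrix.unitaryGroup (Fin χ) ℂ, ∀ j s,
      physMap (U ((T ^ j) g)).1 A s = (V j).1ᴴ * A s * (V (j + 1)).1 :=
    hρ.exists_bond_unitaries hL (fun j => by rw [pow_add, hT, one_mul]) fun k hk =>
      (hsymm k hk g).imp fun θ hθ s => (trace_word_physMap _ A s).trans (hθ s)
  choose V hV using hbond
  let site (p : G × ℕ) : G × ℕ := (p.1, p.2 + 1)
  have hnext : PushesTo site (fun p => U ((T ^ (p.2 + 1)) p.1)) (fun p => V p.1 (p.2 + 1)) 1 A :=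
    fun p s => by simpa using hV p.1 (p.2 + 1) s
  have htranslate :
      PushesTo site (fun p => U ((T ^ (p.2 + 1)) p.1)) (fun p => V (T p.1) p.2) 1 A :=
    fun p s => by simpa [pow_succ] using hV (T p.1) p.2 s
  obtain ⟨z, hz, -⟩ := hnext.exists_circle_of_primitive hρ htranslate
  refine ⟨fun g => V g 0, fun g => z (g, 0), fun g s => ?_⟩
  have hfirst : (V g 1).1 = (z (g, 0) : ℂ) • (V (T g) 0).1 := hz (g, 0)
  rw [← Matrix.mul_smul, ← hfirst]
  exact hV g 0 s

end PushExists

section Class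

open groupCohomology

variable {ι ι' κ κ' : Type*} [Fintype ι] [Fintype ι'] [Fintype κ] [Fintype κ'] [DecidableEq ι]
  [DecidableEq ι'] [DecidableEq κ] [DecidableEq κ']

omit [DecidableEq ι'] in
lemma Primitive.physMap {A : ι → Matrix κ κ ℂ} {ρ : Matrix κ κ ℂ} (h : Primitive A ρ)
    {M : Matrix ι' ι ℂ} (hM : Mᴴ * M = 1) : Primitive (physMap M A) ρ where
  left := by
    simpa [mixedTransfer_apply, h.left] using
      DFunLike.congr_fun (mixedTransfer_physMap hM A A) 1
  posDef := h.posDef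
  trace_eq := h.trace_eq
  tendsto := by rw [transferMap_physMap hM]; exact h.tendsto

lemma PushesTo.physMap {Γ : Type*} {τ : Γ → Γ} {U : Γ → Matrix.unitaryGroup ι ℂ}
    {R : Γ → Matrix.unitaryGroup ι' ℂ} {v : Γ → Matrix.unitaryGroup κ ℂ} {φ : Γ → Circle}
    {A : ι → Matrix κ κ ℂ} (h : PushesTo τ U v φ A) {M : Matrix ι' ι ℂ}
    (hM : ∀ γ, (R γ).1 * M = M * (U γ).1) : PushesTo τ R v φ (physMap M A) := fun γ s => by
  rw [← physMap_mul, hM, physMap_mul, funext (h γ), physMap_smul_mul_mul]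

/-- Agreement of all amplitudes on periodic chains; for `Fin`-indexed legs this is `SameStates`. -/
def SameTraces (A : ι → Matrix κ κ ℂ) (B : ι → Matrix κ' κ' ℂ) : Prop :=
  ∀ n, 1 ≤ n → ∀ s : Fin n → ι, (word (fun _ => A) s).trace = (word (fun _ => B) s).trace

omit [DecidableEq ι] in
lemma tendsto_trace_mixedTransfer_of_sameTraces {A : ι → Matrix κ κ ℂ} {B : ι → Matrix κ' κ' ℂ}
    {ρ : Matrix κ' κ' ℂ} (hB : Primitive B ρ) (h : SameTraces A B) :
    Tendsto (fun n => LinearMap.trace ℂ _ (mixedTransfer A B ^ n)) atTop (𝓝 1) := by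
  refine hB.tendsto_trace.congr' ?_
  filter_upwards [eventually_ge_atTop 1] with n hn
  rw [← mixedTransferChain_const, ← mixedTransferChain_const, trace_mixedTransferChain,
    trace_mixedTransferChain]
  simp only [h n hn]

variable {G : Type} [Group G] {T : MulAut G} {L : ℕ} {U : G → Matrix.unitaryGroup ι ℂ}
  {A : ι → Matrix κ κ ℂ} {B : ι → Matrix κ' κ' ℂ} {x x' : H2 (U1 (FullGroup T))}

/-- Some push-through data of `A` encode the class `x`: `SymMPS.HasCrystallineClass` for tensors
whose legs are indexed by arbitrary types. -/
def HasClass (T : MulAut G) (U : G → Matrix.unitaryGroup ι ℂ) (A : ι → Matrix κ κ ℂ)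
    (x : H2 (U1 (FullGroup T))) : Prop :=
  ∃ (v : G → Matrix.unitaryGroup κ ℂ) (φ : G → Circle) (ω : G → G → Circle),
    PushesTo T U v φ A ∧ IsProjectiveRep ω v ∧ Encodes T ω φ x

lemma SymMPS.hasCrystallineClass_iff_hasClass {S : SymMPS T L} :
    S.HasCrystallineClass x ↔ HasClass T S.U S.A x := by
  constructor
  · rintro ⟨v, φ, c, hpush, hmul, htranslate, hc⟩
    exact ⟨v, φ, _, pushThrough_iff_pushesTo.1 hpush, hmul, _, ⟨c, rfl, hc⟩, fun _ _ => rfl,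
      htranslate⟩
  · rintro ⟨v, φ, ω, hpush, hmul, f, ⟨c, rfl, hc⟩, hω, htranslate⟩
    exact ⟨v, φ, c, pushThrough_iff_pushesTo.2 hpush, fun g k => by rw [hω, hmul], htranslate, hc⟩

namespace HasClass

lemma physMap (h : HasClass T U A x) {R : G → Matrix.unitaryGroup ι' ℂ} {M : Matrix ι' ι ℂ}
    (hM : ∀ g, (R g).1 * M = M * (U g).1) : HasClass T R (physMap M A) x := by
  obtain ⟨v, φ, ω, hpush, hω⟩ := h
  exact ⟨v, φ, ω, hpush.physMap hM, hω⟩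

lemma eq_of_hasDominantEigenline (hA : HasClass T U A x) (hB : HasClass T U B x') {N : ℕ}
    (hN : 1 ≤ N) (hT : T^[N] = id) (hdom : HasDominantEigenline (mixedTransfer A B ^ N)) :
    x = x' := by
  obtain ⟨v, φ, ω, hv, hω, hx⟩ := hA
  obtain ⟨w, ψ, η, hw, hη, hx'⟩ := hB
  obtain ⟨y, hy, z, hz, hφ⟩ := hv.exists_circle_of_hasDominantEigenline hw hN hT hdom
  refine (hx.eq_iff hx').2 ⟨z, funext₂ fun a b => ?_, funext fun g => ?_⟩
  · have hleft : (v a).1 * (v b).1 * y = ((ω a b * z (a * b) : Circle) : ℂ) •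
        (y * (w (a * b)).1) := by
      rw [hω, Matrix.smul_mul, hz, smul_smul, Circle.coe_mul]
    have hright : (v a).1 * (v b).1 * y = ((z b * z a * η a b : Circle) : ℂ) •
        (y * (w (a * b)).1) := by
      rw [Matrix.mul_assoc, hz, Matrix.mul_smul, ← Matrix.mul_assoc, hz, Matrix.smul_mul,
        Matrix.mul_assoc, hη, Matrix.mul_smul, smul_smul, smul_smul, Circle.coe_mul, Circle.coe_mul]
    have hyw : y * (w (a * b)).1 ≠ 0 := fun h0 => hy <| by
      rw [← Matrix.mul_one y, ← coe_mul_conjTranspose_self (w (a * b)), ← Matrix.mul_assoc, h0,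
        Matrix.zero_mul]
    have hzω := Circle.ext (smul_left_injective ℂ hyw (hleft.symm.trans hright))
    rw [Pi.mul_apply, Pi.mul_apply, coboundary, mul_div_assoc', eq_div_iff_mul_eq', hzω,
      mul_comm (z b)]
    exact mul_comm _ _
  · rw [Pi.mul_apply, Pi.div_apply, Function.comp_apply, mul_div_assoc', eq_div_iff_mul_eq',
      mul_comm, hφ, mul_comm]

end HasClass

lemma eventually_forall_hasClass_eq {A₀ : ι → Matrix κ κ ℂ}
    {ρ : Matrix κ' κ' ℂ} (hL : 1 ≤ L) (hT : T ^ L = 1) (hA₀ : ∑ s, (A₀ s)ᴴ * A₀ s = 1)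
    (hρ : Primitive B ρ) (hAB : SameTraces A₀ B) :
    ∀ᶠ A in 𝓝 A₀, ∀ x x', HasClass T U A x → HasClass T U B x' → x = x' := by
  obtain ⟨N, hN, ⟨k, rfl⟩, hdom⟩ := exists_eventually_hasDominantEigenline_mixedTransfer hA₀ hρ
    (tendsto_trace_mixedTransfer_of_sameTraces hρ hAB) hL
  filter_upwards [hdom] with A hdom x x' hx hx'
  exact hx.eq_of_hasDominantEigenline hx' hN (mul_comm L k ▸ iterate_mulAut_mul_eq_id hT k) hdom

lemma HasClass.unique (h : HasClass T U A x) (h' : HasClass T U A x') {ρ : Matrix κ κ ℂ}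
    (hρ : Primitive A ρ) (hL : 1 ≤ L) (hT : T ^ L = 1) : x = x' :=
  (eventually_forall_hasClass_eq hL hT hρ.left hρ fun _ _ _ => rfl).self_of_nhds x x' h h'

lemma PushesTo.exists_encodes {U : G →* Matrix.unitaryGroup ι ℂ}
    {v : G → Matrix.unitaryGroup κ ℂ} {φ : G → Circle} {ρ : Matrix κ κ ℂ} (h : PushesTo T U v φ A)
    (hρ : Primitive A ρ) :
    ∃ ω x, IsProjectiveRep ω v ∧ Encodes T ω φ x := by
  obtain ⟨ω, hω, hcocycle⟩ := h.exists_isCrystallineCocycle hρ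
  obtain ⟨x, hx⟩ := hcocycle.exists_encodes
  exact ⟨ω, x, hω, hx⟩

lemma existsUnique_hasClass {d χ : ℕ} {U : G →* Matrix.unitaryGroup (Fin d) ℂ} {A : MPSTensor d χ}
    (hL : 1 ≤ L) (hT : T ^ L = 1) (hA : IsCanonicalInjective A) (hsymm : IsSymmetric T L U A) :
    ∃! x, HasClass T U A x := by
  obtain ⟨ρ, hρ⟩ := hA.exists_primitive
  obtain ⟨v, φ, hpush⟩ := hρ.exists_pushesTo hL hT hsymm
  obtain ⟨ω, x, hω, hx⟩ := hpush.exists_encodes hρ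
  exact ⟨x, ⟨v, φ, ω, hpush, hω, hx⟩, fun x' hx' => hx'.unique ⟨v, φ, ω, hpush, hω, hx⟩ hρ hL hT⟩

end Class

section Invariance

open groupCohomology Set

variable {G : Type} [Group G] {T : MulAut G} {L : ℕ}

lemma sum_conjTranspose_mul_self_eq_one_of_mem_closure {d χ : ℕ} {A : MPSTensor d χ}
    (hA : A ∈ closure {A : MPSTensor d χ | IsCanonicalInjective A}) : ∑ s, (A s)ᴴ * A s = 1 := by
  refine closure_minimal (s := {A : MPSTensor d χ | IsCanonicalInjective A})
    (t := {A : MPSTensor d χ | ∑ s, (A s)ᴴ * A s = 1}) (fun A h => h.left_canonical) ?_ hA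
  exact isClosed_eq (continuous_finsetSum _ fun s _ =>
    (continuous_apply s).matrix_conjTranspose.matrix_mul (continuous_apply s)) continuous_const

lemma exists_hasClass_of_path {d χ : ℕ} {R : G →* Matrix.unitaryGroup (Fin d) ℂ}
    {A : ℝ → MPSTensor d χ} (hL : 1 ≤ L) (hT : T ^ L = 1) (hcont : ContinuousOn A (Icc 0 1))
    (hA : ∀ t ∈ Ioo (0 : ℝ) 1, IsCanonicalInjective (A t) ∧ IsSymmetric T L R (A t)) :
    ∃ x, ∀ t ∈ Icc (0 : ℝ) 1, ∀ {χ' : ℕ} {B : MPSTensor d χ'} {ρ : Matrix (Fin χ') (Fin χ') ℂ},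
      Primitive B ρ → SameTraces (A t) B → ∀ y, HasClass T R B y → y = x := by
  have hclass (t : ℝ) : ∃ x, t ∈ Ioo (0 : ℝ) 1 → HasClass T R (A t) x := by
    by_cases ht : t ∈ Ioo (0 : ℝ) 1
    · exact (existsUnique_hasClass hL hT (hA t ht).1 (hA t ht).2).exists.imp fun _ h _ => h
    · exact ⟨0, fun h => absurd h ht⟩
  choose X hX using hclass
  have hne {t : ℝ} (ht : t ∈ Icc (0 : ℝ) 1) : (𝓝[Ioo 0 1] t).NeBot := by
    rwa [← mem_closure_iff_nhdsWithin_neBot, closure_Ioo zero_ne_one]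
  have hlocal {t : ℝ} (ht : t ∈ Icc (0 : ℝ) 1) {χ' : ℕ} {B : MPSTensor d χ'}
      {ρ : Matrix (Fin χ') (Fin χ') ℂ} (hρ : Primitive B ρ) (hAB : SameTraces (A t) B) {y}
      (hy : HasClass T R B y) : ∀ᶠ t' in 𝓝[Ioo 0 1] t, y = X t' := by
    have htendsto : Tendsto A (𝓝[Ioo 0 1] t) (𝓝 (A t)) :=
      (hcont t ht).mono_left (nhdsWithin_mono _ Ioo_subset_Icc_self)
    have := hne ht
    have hleft := sum_conjTranspose_mul_self_eq_one_of_mem_closure <|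
      mem_closure_of_tendsto htendsto <| eventually_nhdsWithin_of_forall fun t ht => (hA t ht).1
    filter_upwards [htendsto.eventually (eventually_forall_hasClass_eq (U := R) hL hT hleft hρ hAB),
      self_mem_nhdsWithin] with t' h ht'
    exact (h _ _ (hX t' ht') hy).symm
  have hconst {t t' : ℝ} (ht : t ∈ Ioo (0 : ℝ) 1) (ht' : t' ∈ Ioo (0 : ℝ) 1) : X t = X t' := by
    refine isPreconnected_Ioo.induction₂ (fun t t' => X t = X t') (fun t ht => ?_)
      (fun _ _ _ _ _ _ => Eq.trans) (fun _ _ _ _ => Eq.symm) ht ht'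
    obtain ⟨ρ, hρ⟩ := (hA t ht).1.exists_primitive
    exact hlocal (Ioo_subset_Icc_self ht) hρ (fun _ _ _ => rfl) (hX t ht)
  refine ⟨X (1 / 2), fun t ht χ' B ρ hρ hAB y hy => ?_⟩
  have := hne ht
  obtain ⟨t', hyt', ht'⟩ := ((hlocal ht hρ hAB hy).and self_mem_nhdsWithin).exists
  exact hyt'.trans (hconst ht' (by norm_num))

lemma Deformation.hasClass_eq {S₀ S₁ : SymMPS T L} (h : Deformation S₀ S₁) (hL : 1 ≤ L)
    (hT : T ^ L = 1) {x₀ x₁ : H2 (U1 (FullGroup T))} (h₀ : HasClass T S₀.U S₀.A x₀)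
    (h₁ : HasClass T S₁.U S₁.A x₁) : x₀ = x₁ := by
  obtain ⟨d, χ, R, J₀, J₁, A, hJ₀, hJ₁, hR₀, hR₁, hcont, hA, hs₀, hs₁⟩ := h
  obtain ⟨x, hx⟩ := exists_hasClass_of_path hL hT hcont hA
  obtain ⟨ρ₀, hρ₀⟩ := S₀.injective.exists_primitive
  obtain ⟨ρ₁, hρ₁⟩ := S₁.injective.exists_primitive
  exact (hx 0 (by simp) (hρ₀.physMap hJ₀) hs₀ x₀ (h₀.physMap hR₀)).trans
    (hx 1 (by simp) (hρ₁.physMap hJ₁) hs₁ x₁ (h₁.physMap hR₁)).symm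

/-- The class in `H²(G ⋊ ℤ, U(1))` of a phase. -/
def crystallineClass (hL : 1 ≤ L) (hT : T ^ L = 1) (p : Phase T L) : H2 (U1 (FullGroup T)) :=
  have hclass (S : SymMPS T L) := existsUnique_hasClass hL hT S.injective S.symmetric
  Quot.lift (fun S => (hclass S).choose) (fun S₀ S₁ h =>
    h.hasClass_eq hL hT (hclass S₀).choose_spec.1 (hclass S₁).choose_spec.1) p

lemma hasClass_iff_crystallineClass_eq (hL : 1 ≤ L) (hT : T ^ L = 1) (S : SymMPS T L)
    (x : H2 (U1 (FullGroup T))) :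
    HasClass T S.U S.A x ↔ crystallineClass hL hT S.phase = x := by
  have hclass := existsUnique_hasClass hL hT S.injective S.symmetric
  exact ⟨fun h => hclass.unique hclass.choose_spec.1 h, fun h => h ▸ hclass.choose_spec.1⟩

end Invariance

section Reindex

lemma map_word {ι M N : Type*} [Monoid M] [Monoid N] (f : M →* N) (A : ℕ → ι → M) {n : ℕ}
    (s : Fin n → ι) : word (fun k i => f (A k i)) s = f (word A s) := by
  rw [word, word, map_list_prod, List.map_ofFn]
  rfl

variable {ι ι' κ κ' : Type*} [Fintype ι] [Fintype ι'] [Fintype κ] [Fintype κ'] [DecidableEq ι]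
  [DecidableEq ι'] [DecidableEq κ] [DecidableEq κ']

/-- Renaming of the indices of unitary matrices. -/
def reindexUnitary (f : κ' ≃ κ) : Matrix.unitaryGroup κ ℂ →* Matrix.unitaryGroup κ' ℂ where
  toFun v := ⟨v.1.submatrix f f, by
    rw [Matrix.mem_unitaryGroup_iff, Matrix.star_eq_conjTranspose, Matrix.conjTranspose_submatrix,
      Matrix.submatrix_mul_equiv, coe_mul_conjTranspose_self, Matrix.submatrix_one_equiv]⟩
  map_one' := Subtype.ext (Matrix.submatrix_one_equiv f)
  map_mul' v w := Subtype.ext (Matrix.submatrix_mul_equiv v.1 w.1 f f f).symm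

lemma coe_reindexUnitary (f : κ' ≃ κ) (v : Matrix.unitaryGroup κ ℂ) :
    (reindexUnitary f v).1 = v.1.submatrix f f := rfl

/-- Renaming of the physical and the bond indices of a tensor, used to pass from arbitrary finite
index types to `Fin`. -/
def reindexTensor (e : ι' ≃ ι) (f : κ' ≃ κ) (A : ι → Matrix κ κ ℂ) : ι' → Matrix κ' κ' ℂ :=
  fun s => (A (e s)).submatrix f f

omit [Fintype κ] [Fintype κ'] [DecidableEq κ] [DecidableEq κ'] in
lemma submatrix_sum {α : Type*} (t : Finset α) (f : κ' ≃ κ) (M : α → Matrix κ κ ℂ) :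
    (∑ a ∈ t, M a).submatrix f f = ∑ a ∈ t, (M a).submatrix f f :=
  map_sum (Matrix.reindexLinearEquiv ℂ ℂ f.symm f.symm) M t

omit [DecidableEq κ] [DecidableEq κ'] in
lemma trace_submatrix (f : κ' ≃ κ) (M : Matrix κ κ ℂ) : (M.submatrix f f).trace = M.trace :=
  f.sum_comp fun i => M i i

omit [DecidableEq ι] [DecidableEq ι'] [DecidableEq κ] [DecidableEq κ'] in
lemma transferMap_reindexTensor (e : ι' ≃ ι) (f : κ' ≃ κ) (A : ι → Matrix κ κ ℂ)
    (X : Matrix κ κ ℂ) :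
    transferMap (reindexTensor e f A) (X.submatrix f f) = (transferMap A X).submatrix f f := by
  simp only [transferMap_apply, reindexTensor, Matrix.conjTranspose_submatrix,
    Matrix.submatrix_mul_equiv, submatrix_sum]
  exact e.sum_comp fun s => (A s * X * (A s)ᴴ).submatrix f f

omit [DecidableEq ι] [DecidableEq ι'] in
lemma Primitive.reindex {A : ι → Matrix κ κ ℂ} {ρ : Matrix κ κ ℂ} (h : Primitive A ρ)
    (e : ι' ≃ ι) (f : κ' ≃ κ) : Primitive (reindexTensor e f A) (ρ.submatrix f f) where
  left := by
    simp only [reindexTensor, Matrix.conjTranspose_submatrix, Matrix.submatrix_mul_equiv]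
    rw [e.sum_comp fun s => ((A s)ᴴ * A s).submatrix f f, ← submatrix_sum, h.left,
      Matrix.submatrix_one_equiv]
  posDef := h.posDef.submatrix f.injective
  trace_eq := by rw [trace_submatrix, h.trace_eq]
  tendsto X := by
    obtain ⟨Y, rfl⟩ : ∃ Y : Matrix κ κ ℂ, Y.submatrix f f = X :=
      ⟨X.submatrix f.symm f.symm, by simp⟩
    have hpow (n : ℕ) : (transferMap (reindexTensor e f A) ^ n) (Y.submatrix f f) =
        ((transferMap A ^ n) Y).submatrix f f := by
      induction n with
      | zero => simp
      | succ n ih =>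
        rw [pow_succ', Module.End.mul_apply, ih, transferMap_reindexTensor, ← Module.End.mul_apply,
          ← pow_succ']
    simp only [hpow, trace_submatrix]
    exact ((continuous_id.matrix_submatrix f f).tendsto _).comp (h.tendsto Y)

lemma PushesTo.reindex {Γ : Type*} {τ : Γ → Γ} {U : Γ → Matrix.unitaryGroup ι ℂ}
    {v : Γ → Matrix.unitaryGroup κ ℂ} {φ : Γ → Circle} {A : ι → Matrix κ κ ℂ}
    (h : PushesTo τ U v φ A) (e : ι' ≃ ι) (f : κ' ≃ κ) :
    PushesTo τ (reindexUnitary e ∘ U) (reindexUnitary f ∘ v) φ (reindexTensor e f A) := by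
  intro g s
  have hsum : ModulatedMPS.physMap ((U g).1.submatrix e e) (reindexTensor e f A) s =
      (ModulatedMPS.physMap (U g).1 A (e s)).submatrix f f := by
    simp only [ModulatedMPS.physMap, submatrix_sum]
    exact e.sum_comp fun s' => ((U g).1 (e s) s' • A s').submatrix f f
  simp only [Function.comp_apply, coe_reindexUnitary, hsum, h g, reindexTensor,
    Matrix.conjTranspose_submatrix, Matrix.submatrix_mul_equiv]
  rfl

omit [Fintype ι] [Fintype ι'] [DecidableEq ι] [DecidableEq ι'] in
lemma trace_word_reindexTensor (e : ι' ≃ ι) (f : κ' ≃ κ) (A : ι → Matrix κ κ ℂ) {n : ℕ}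
    (s : Fin n → ι') :
    (word (fun _ => reindexTensor e f A) s).trace = (word (fun _ => A) (e ∘ s)).trace := by
  rw [← trace_submatrix f]
  exact congrArg Matrix.trace <|
    map_word ((Matrix.reindexAlgEquiv ℂ ℂ f.symm).toRingEquiv.toRingHom.toMonoidHom)
      (fun _ => A) (e ∘ s)

variable {G : Type} [Group G] {T : MulAut G} {L : ℕ} {A : ι → Matrix κ κ ℂ}

lemma HasClass.reindex {U : G → Matrix.unitaryGroup ι ℂ} {x : groupCohomology.H2 (U1 (FullGroup T))}
    (h : HasClass T U A x) (e : ι' ≃ ι) (f : κ' ≃ κ) :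
    HasClass T (reindexUnitary e ∘ U) (reindexTensor e f A) x := by
  obtain ⟨v, φ, ω, hpush, hω, hx⟩ := h
  refine ⟨_, φ, ω, hpush.reindex e f, fun g k => ?_, hx⟩
  simp only [Function.comp_apply, coe_reindexUnitary, Matrix.submatrix_mul_equiv, hω g k]
  rfl

/-- The symmetric MPS given by a primitive tensor with push-through data, after naming its indices
by `e` and `f`. -/
def SymMPS.ofTensor {U : G →* Matrix.unitaryGroup ι ℂ} {ρ : Matrix κ κ ℂ}
    {v : G → Matrix.unitaryGroup κ ℂ} {φ : G → Circle} (hT : T ^ L = 1) (hA : Primitive A ρ)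
    (h : PushesTo T U v φ A) {d χ : ℕ} (e : Fin d ≃ ι) (f : Fin χ ≃ κ) : SymMPS T L where
  d := d
  χ := χ
  U := (reindexUnitary e).comp U
  A := reindexTensor e f A
  injective := (hA.reindex e f).isCanonicalInjective
  symmetric := (h.reindex e f).isSymmetric hT

lemma deformation_of_path {S₀ S₁ : SymMPS T L} (hT : T ^ L = 1)
    (R : G →* Matrix.unitaryGroup ι ℂ) (J₀ : Matrix ι (Fin S₀.d) ℂ) (J₁ : Matrix ι (Fin S₁.d) ℂ)
    (A : ℝ → ι → Matrix κ κ ℂ) (hJ₀ : J₀ᴴ * J₀ = 1) (hJ₁ : J₁ᴴ * J₁ = 1)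
    (hR₀ : ∀ g, (R g).1 * J₀ = J₀ * (S₀.U g).1) (hR₁ : ∀ g, (R g).1 * J₁ = J₁ * (S₁.U g).1)
    (hcont : ContinuousOn A (Set.Icc 0 1))
    (hprim : ∀ t ∈ Set.Ioo (0 : ℝ) 1, ∃ ρ, Primitive (A t) ρ)
    (hpush : ∀ t ∈ Set.Ioo (0 : ℝ) 1, ∃ v φ, PushesTo T R v φ (A t))
    (hs₀ : SameTraces (A 0) (physMap J₀ S₀.A)) (hs₁ : SameTraces (A 1) (physMap J₁ S₁.A)) :
    Deformation S₀ S₁ := by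
  obtain e := (Fintype.equivFin ι).symm
  obtain f := (Fintype.equivFin κ).symm
  have hisometry {d : ℕ} {J : Matrix ι (Fin d) ℂ} (hJ : Jᴴ * J = 1) :
      (J.submatrix e id)ᴴ * J.submatrix e id = 1 := by
    rw [Matrix.conjTranspose_submatrix, Matrix.submatrix_mul_equiv, hJ, Matrix.submatrix_id_id]
  have hequivariant {d : ℕ} {J : Matrix ι (Fin d) ℂ} {U : G →* Matrix.unitaryGroup (Fin d) ℂ}
      (hJ : ∀ g, (R g).1 * J = J * (U g).1) (g : G) :
      (reindexUnitary e (R g)).1 * J.submatrix e id = J.submatrix e id * (U g).1 := by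
    rw [coe_reindexUnitary, Matrix.submatrix_mul_equiv, hJ]
    rfl
  have hstates {S : SymMPS T L} {J : Matrix ι (Fin S.d) ℂ} {B : ι → Matrix κ κ ℂ}
      (h : SameTraces B (physMap J S.A)) :
      SameStates (reindexTensor e f B) (physAct (J.submatrix e id) S.A) :=
    fun n hn s => (trace_word_reindexTensor e f B s).trans (h n hn (e ∘ s))
  refine ⟨_, _, (reindexUnitary e).comp R, J₀.submatrix e id, J₁.submatrix e id,
    fun t => reindexTensor e f (A t), hisometry hJ₀, hisometry hJ₁, hequivariant hR₀,
    hequivariant hR₁, ?_, fun t ht => ?_, hstates hs₀, hstates hs₁⟩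
  · exact continuousOn_pi.2 fun s =>
      (continuous_id.matrix_submatrix f f).comp_continuousOn (continuousOn_pi.1 hcont (e s))
  · obtain ⟨ρ, hρ⟩ := hprim t ht
    obtain ⟨v, φ, h⟩ := hpush t ht
    exact ⟨(hρ.reindex e f).isCanonicalInjective, (h.reindex e f).isSymmetric hT⟩

end Reindex

section ProjectiveRep

open scoped Kronecker

variable {κ κ' : Type*} [Fintype κ] [Fintype κ'] [DecidableEq κ] [DecidableEq κ']

/-- Multiplication of a unitary matrix by a phase. -/
def phaseMul (c : Circle) (v : Matrix.unitaryGroup κ ℂ) : Matrix.unitaryGroup κ ℂ :=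
  ⟨(c : ℂ) • v.1, Unitary.smul_mem_of_mem
    (Unitary.mem_iff.2 ⟨by simp [Complex.conj_mul', Circle.norm_coe],
      by simp [Complex.mul_conj', Circle.norm_coe]⟩) v.2⟩

lemma coe_phaseMul (c : Circle) (v : Matrix.unitaryGroup κ ℂ) :
    (phaseMul c v).1 = (c : ℂ) • v.1 := rfl

/-- The tensor product of unitary matrices. -/
def kroneckerUnitary :
    Matrix.unitaryGroup κ ℂ × Matrix.unitaryGroup κ' ℂ →* Matrix.unitaryGroup (κ × κ') ℂ where
  toFun p := ⟨p.1.1 ⊗ₖ p.2.1, Matrix.kronecker_mem_unitary p.1.2 p.2.2⟩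
  map_one' := Subtype.ext Matrix.one_kronecker_one
  map_mul' p q := Subtype.ext (Matrix.mul_kronecker_mul p.1.1 q.1.1 p.2.1 q.2.1)

lemma coe_kroneckerUnitary (p : Matrix.unitaryGroup κ ℂ × Matrix.unitaryGroup κ' ℂ) :
    (kroneckerUnitary p).1 = p.1.1 ⊗ₖ p.2.1 := rfl

namespace IsProjectiveRep

variable {G : Type*} [Group G] {ω η : G → G → Circle} {v : G → Matrix.unitaryGroup κ ℂ}
  {w : G → Matrix.unitaryGroup κ' ℂ}

lemma mul_coboundary (h : IsProjectiveRep ω v) (z : G → Circle) :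
    IsProjectiveRep (ω * coboundary z) fun g => phaseMul (z g) (v g) := fun g k => by
  have hz : ((coboundary z g k : Circle) : ℂ) * z (g * k) = z g * z k := by
    rw [← Circle.coe_mul, ← Circle.coe_mul, coboundary, div_mul_cancel]
  simp only [coe_phaseMul, Matrix.smul_mul, Matrix.mul_smul, smul_smul, h g k, Pi.mul_apply,
    Circle.coe_mul, mul_assoc, hz]
  congr 1
  ring

lemma map_star (h : IsProjectiveRep ω v) :
    IsProjectiveRep ω⁻¹ fun g => Matrix.UnitaryGroup.map_star (v g) := fun g k => by
  have hstar := congrArg (fun M => Matrix.map M (starRingEnd ℂ)) (h g k)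
  simp only [Matrix.map_mul, Matrix.map_smul' _ _ _ (map_mul (starRingEnd ℂ)),
    ← Circle.coe_inv_eq_conj] at hstar
  exact hstar

lemma kronecker (h : IsProjectiveRep ω v) (h' : IsProjectiveRep η w) :
    IsProjectiveRep (ω * η) fun g => kroneckerUnitary (v g, w g) := fun g k => by
  simp only [coe_kroneckerUnitary, ← Matrix.mul_kronecker_mul, h g k, h' g k,
    Matrix.smul_kronecker, Matrix.kronecker_smul, smul_smul, Pi.mul_apply, Circle.coe_mul,
    mul_comm (η g k : ℂ)]

lemma comp {H : Type*} [Group H] (h : IsProjectiveRep ω v) (f : H →* G) :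
    IsProjectiveRep (fun g k => ω (f g) (f k)) (v ∘ f) := fun g k => by
  simp only [Function.comp_apply, h (f g) (f k), map_mul]

/-- A projective representation with trivial multiplier is a representation. -/
def toMonoidHom (h : IsProjectiveRep 1 v) : G →* Matrix.unitaryGroup κ ℂ :=
  MonoidHom.mk' v fun g k => Subtype.ext (by simp [h g k])

end IsProjectiveRep

end ProjectiveRep

section Blocks

variable {Γ ι ι' κ κ' : Type*} [Fintype ι] [Fintype ι'] [Fintype κ] [Fintype κ'] [DecidableEq ι]
  [DecidableEq ι'] [DecidableEq κ] [DecidableEq κ']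

/-- The push-through condition for tensors with different left and right bond spaces. -/
def PushesBetween (τ : Γ → Γ) (U : Γ → Matrix.unitaryGroup ι ℂ)
    (v : Γ → Matrix.unitaryGroup κ ℂ) (w : Γ → Matrix.unitaryGroup κ' ℂ) (φ : Γ → Circle)
    (M : ι → Matrix κ κ' ℂ) : Prop :=
  ∀ γ s, physMap (U γ).1 M s = (φ γ : ℂ) • ((v γ).1ᴴ * M s * (w (τ γ)).1)

/-- Block diagonal unitary matrices. -/
def blockUnitary : Matrix.unitaryGroup ι ℂ × Matrix.unitaryGroup ι' ℂ →*
    Matrix.unitaryGroup (ι ⊕ ι') ℂ where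
  toFun p := ⟨Matrix.fromBlocks p.1.1 0 0 p.2.1, by
    rw [Matrix.mem_unitaryGroup_iff, Matrix.star_eq_conjTranspose, Matrix.fromBlocks_conjTranspose,
      Matrix.fromBlocks_multiply]
    simp [coe_mul_conjTranspose_self, Matrix.fromBlocks_one]⟩
  map_one' := Subtype.ext Matrix.fromBlocks_one
  map_mul' p q := Subtype.ext (by simp [Matrix.fromBlocks_multiply])

lemma coe_blockUnitary (p : Matrix.unitaryGroup ι ℂ × Matrix.unitaryGroup ι' ℂ) :
    (blockUnitary p).1 = Matrix.fromBlocks p.1.1 0 0 p.2.1 := rfl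

variable {τ : Γ → Γ} {U : Γ → Matrix.unitaryGroup ι ℂ} {U' : Γ → Matrix.unitaryGroup ι' ℂ}
  {v : Γ → Matrix.unitaryGroup κ ℂ} {w : Γ → Matrix.unitaryGroup κ' ℂ} {φ : Γ → Circle}

lemma pushesBetween_zero : PushesBetween τ U v w φ (0 : ι → Matrix κ κ' ℂ) :=
  fun γ s => by simp [physMap]

lemma PushesBetween.smul {M : ι → Matrix κ κ' ℂ} (h : PushesBetween τ U v w φ M) (c : ℂ) :
    PushesBetween τ U v w φ (c • M) := fun γ s => by
  have hphys : physMap (U γ).1 (c • M) s = c • physMap (U γ).1 M s := by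
    simp only [physMap, Pi.smul_apply, smul_comm _ c, Finset.smul_sum]
  rw [hphys, h γ s, Pi.smul_apply, Matrix.mul_smul, Matrix.smul_mul, smul_comm]

lemma PushesBetween.sumElim {M : ι → Matrix κ κ' ℂ} {M' : ι' → Matrix κ κ' ℂ}
    (h : PushesBetween τ U v w φ M) (h' : PushesBetween τ U' v w φ M') :
    PushesBetween τ (fun γ => blockUnitary (U γ, U' γ)) v w φ (Sum.elim M M') := by
  rintro γ (s | s)
  · simpa [physMap, coe_blockUnitary] using h γ s
  · simpa [physMap, coe_blockUnitary] using h' γ s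

omit [Fintype κ] [Fintype κ'] [DecidableEq κ] [DecidableEq κ'] in
lemma sum_fromBlocks {α : Type*} (t : Finset α) (a : α → Matrix κ κ ℂ) (b : α → Matrix κ κ' ℂ)
    (c : α → Matrix κ' κ ℂ) (d : α → Matrix κ' κ' ℂ) :
    ∑ x ∈ t, Matrix.fromBlocks (a x) (b x) (c x) (d x) =
      Matrix.fromBlocks (∑ x ∈ t, a x) (∑ x ∈ t, b x) (∑ x ∈ t, c x) (∑ x ∈ t, d x) := by
  ext (i | i) (j | j) <;> simp [Matrix.sum_apply]

lemma pushesTo_fromBlocks {a : ι → Matrix κ κ ℂ} {b : ι → Matrix κ κ' ℂ} {c : ι → Matrix κ' κ ℂ}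
    {d : ι → Matrix κ' κ' ℂ} (ha : PushesBetween τ U v v φ a) (hb : PushesBetween τ U v w φ b)
    (hc : PushesBetween τ U w v φ c) (hd : PushesBetween τ U w w φ d) :
    PushesTo τ U (fun γ => blockUnitary (v γ, w γ)) φ
      (fun s => Matrix.fromBlocks (a s) (b s) (c s) (d s)) := by
  intro γ s
  have hphys : physMap (U γ).1 (fun s => Matrix.fromBlocks (a s) (b s) (c s) (d s)) s =
      Matrix.fromBlocks (physMap (U γ).1 a s) (physMap (U γ).1 b s) (physMap (U γ).1 c s)
        (physMap (U γ).1 d s) := by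
    simp only [physMap, Matrix.fromBlocks_smul, sum_fromBlocks]
  simp only [hphys, ha γ s, hb γ s, hc γ s, hd γ s, coe_blockUnitary,
    Matrix.fromBlocks_conjTranspose, Matrix.fromBlocks_multiply, Matrix.fromBlocks_smul,
    Matrix.conjTranspose_zero, Matrix.zero_mul, Matrix.mul_zero, add_zero, zero_add]

end Blocks

section UnitTensor

open scoped Kronecker

variable {κ κ' : Type*} [Fintype κ] [Fintype κ'] [DecidableEq κ] [DecidableEq κ']

/-- The tensor whose matrices are the matrix units. Its physical leg is the tensor product of its
two bond legs, so it intertwines any two projective representations on the bonds. -/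
def unitTensor (κ κ' : Type*) [DecidableEq κ] [DecidableEq κ'] : κ × κ' → Matrix κ κ' ℂ :=
  fun p => Matrix.single p.1 p.2 1

variable {G : Type} [Group G] {T : MulAut G} {ω : G → G → Circle} {φ : G → Circle}
  {v : G → Matrix.unitaryGroup κ ℂ} {w : G → Matrix.unitaryGroup κ' ℂ}

/-- The representation `φ ⊗ v̄ ⊗ (w ∘ T)` on the physical space of the matrix units. It is linear
because `φ` trivializes the difference between the multipliers of `w ∘ T` and of `v`. -/
def bondRep (hφ : IsCrystallineCocycle T ω φ) (hv : IsProjectiveRep ω v)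
    (hw : IsProjectiveRep ω w) : G →* Matrix.unitaryGroup (κ × κ') ℂ :=
  have hmultiplier : (ω⁻¹ * fun g k => ω (T g) (T k)) * coboundary φ = 1 := funext₂ fun g k => by
    have h := hφ.translate g k
    simp only [Pi.mul_apply, Pi.inv_apply, coboundary, Pi.one_apply]
    rw [mul_div_assoc', div_eq_one, inv_mul_eq_div, div_mul_eq_mul_div, div_eq_iff_eq_mul, h,
      mul_comm]
  (hmultiplier ▸ (hv.map_star.kronecker (hw.comp T.toMonoidHom)).mul_coboundary φ).toMonoidHom

lemma coe_bondRep (hφ : IsCrystallineCocycle T ω φ) (hv : IsProjectiveRep ω v)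
    (hw : IsProjectiveRep ω w) (g : G) : (bondRep hφ hv hw g).1 =
      (φ g : ℂ) • (((v g).1.map star) ⊗ₖ (w (T g)).1) := by
  rw [bondRep]
  rfl

lemma pushesBetween_unitTensor (hφ : IsCrystallineCocycle T ω φ) (hv : IsProjectiveRep ω v)
    (hw : IsProjectiveRep ω w) : PushesBetween T (bondRep hφ hv hw) v w φ (unitTensor κ κ') := by
  rintro g ⟨a, b⟩
  ext i j
  rw [physMap, coe_bondRep, Matrix.sum_apply, Fintype.sum_eq_single (i, j)]
  · simp [unitTensor, Matrix.mul_apply, Matrix.single_apply, ite_and]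
  · rintro ⟨i', j'⟩ hne
    rw [unitTensor, Matrix.smul_apply, Matrix.single_apply, if_neg, smul_zero]
    rintro ⟨rfl, rfl⟩
    exact hne rfl

end UnitTensor

section Interpolation

lemma posDef_fromBlocks_zero {κ₀ κ₁ : Type*} [Finite κ₀] [Finite κ₁] {X : Matrix κ₀ κ₀ ℂ}
    {W : Matrix κ₁ κ₁ ℂ} (hX : X.PosDef) (hW : W.PosDef) :
    (Matrix.fromBlocks X 0 0 W).PosDef := by
  classical
  cases nonempty_fintype κ₀
  cases nonempty_fintype κ₁
  have := hX.isUnit.invertible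
  have hpsd : (Matrix.fromBlocks X 0 0ᴴ W).PosSemidef := by
    rw [Matrix.PosDef.fromBlocks₁₁ _ _ hX]
    simpa using hW.posSemidef
  rw [Matrix.conjTranspose_zero] at hpsd
  exact hpsd.posDef_iff_isUnit.2 (Matrix.isUnit_fromBlocks_zero₂₁.2 ⟨hX.isUnit, hW.isUnit⟩)

variable {ι ι₀ ι₁ κ₀ κ₁ : Type*} [Fintype ι₀] [Fintype ι₁] [Fintype κ₀] [Fintype κ₁]
  [DecidableEq κ₀] [DecidableEq κ₁]

lemma sum_unitTensor_mul_mul_conjTranspose (W : Matrix κ₁ κ₁ ℂ) :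
    ∑ p, unitTensor κ₀ κ₁ p * W * (unitTensor κ₀ κ₁ p)ᴴ = W.trace • 1 := by
  ext i j
  simp only [unitTensor, Matrix.conjTranspose_single, Matrix.single_mul_mul_single, star_one,
    Fintype.sum_prod_type, Matrix.sum_apply, Matrix.single_apply, one_mul, mul_one, ite_and]
  simp [Matrix.one_apply, Matrix.trace]

lemma sum_conjTranspose_unitTensor_mul :
    ∑ p, (unitTensor κ₀ κ₁ p)ᴴ * unitTensor κ₀ κ₁ p = (Fintype.card κ₀ : ℂ) • 1 := by
  ext i j
  simp only [unitTensor, Matrix.conjTranspose_single, Matrix.single_mul_single_same, star_one,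
    Fintype.sum_prod_type, Matrix.sum_apply, Matrix.single_apply, mul_one, ite_and]
  by_cases h : i = j <;> simp [h]

lemma eq_smul_one_of_smul_unitTensor_mul_eq {P : Matrix κ₀ κ₀ ℂ} {S : Matrix κ₁ κ₁ ℂ} {μ : ℂ}
    (h : ∀ x, μ • (unitTensor κ₀ κ₁ x * S) = P * unitTensor κ₀ κ₁ x) (b : κ₁) :
    P = (μ * S b b) • 1 := by
  ext i a
  have hentry : μ * (if a = i then S b b else 0) = P i a := by
    simpa [unitTensor, Matrix.mul_apply, Matrix.single_apply, ite_and] using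
      congrFun₂ (h (a, b)) i b
  rw [← hentry, Matrix.smul_apply, Matrix.one_apply, smul_eq_mul]
  simp only [eq_comm (a := a), mul_ite, mul_one, mul_zero]

omit [Fintype κ₁] in
lemma eq_zero_of_mul_unitTensor_eq_zero [Nonempty κ₁] {R : Matrix κ₁ κ₀ ℂ}
    (h : ∀ x, R * unitTensor κ₀ κ₁ x = 0) : R = 0 := by
  obtain ⟨b⟩ := ‹Nonempty κ₁›
  ext i a
  simpa [unitTensor] using congrFun₂ (h (a, b)) i b

/-- The tensors `p A₀` and `r A₁` on two diagonal blocks, and matrix units with weights `q` and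
`s` on the off-diagonal blocks. The off-diagonal blocks connect the two tensors, and have their own
physical levels, so that they do not interfere with `A₀` and `A₁`. -/
def interpolation (A₀ : ι₀ → Matrix κ₀ κ₀ ℂ) (A₁ : ι₁ → Matrix κ₁ κ₁ ℂ) (p q r s : ℝ) :
    (ι₀ ⊕ κ₀ × κ₁) ⊕ (ι₁ ⊕ κ₁ × κ₀) → Matrix (κ₀ ⊕ κ₁) (κ₀ ⊕ κ₁) ℂ := fun x =>
  Matrix.fromBlocks (Sum.elim (Sum.elim ((p : ℂ) • A₀) 0) 0 x)
    (Sum.elim (Sum.elim 0 ((q : ℂ) • unitTensor κ₀ κ₁)) 0 x)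
    (Sum.elim 0 (Sum.elim 0 ((s : ℂ) • unitTensor κ₁ κ₀)) x)
    (Sum.elim 0 (Sum.elim ((r : ℂ) • A₁) 0) x)

variable {A₀ : ι₀ → Matrix κ₀ κ₀ ℂ} {A₁ : ι₁ → Matrix κ₁ κ₁ ℂ} {p q r s : ℝ}

lemma sum_conjTranspose_interpolation_mul (h₀ : ∑ s, (A₀ s)ᴴ * A₀ s = 1)
    (h₁ : ∑ s, (A₁ s)ᴴ * A₁ s = 1) (hps : p ^ 2 + s ^ 2 * Fintype.card κ₁ = 1)
    (hqr : q ^ 2 * Fintype.card κ₀ + r ^ 2 = 1) :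
    ∑ x, (interpolation A₀ A₁ p q r s x)ᴴ * interpolation A₀ A₁ p q r s x = 1 := by
  have hps' : (p : ℂ) * p + s * s * Fintype.card κ₁ = 1 := by
    rw [← pow_two, ← pow_two]
    exact_mod_cast hps
  have hqr' : (q : ℂ) * q * Fintype.card κ₀ + r * r = 1 := by
    rw [← pow_two, ← pow_two]
    exact_mod_cast hqr
  simp only [interpolation, Matrix.fromBlocks_conjTranspose, Matrix.fromBlocks_multiply,
    sum_fromBlocks, Fintype.sum_sum_type, Sum.elim_inl, Sum.elim_inr, Pi.zero_apply, Pi.smul_apply,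
    Matrix.conjTranspose_zero, Matrix.zero_mul, Matrix.mul_zero, add_zero, zero_add,
    Matrix.conjTranspose_smul, Matrix.smul_mul, Matrix.mul_smul, smul_smul, ← Finset.smul_sum, h₀,
    h₁, sum_conjTranspose_unitTensor_mul, Finset.sum_const_zero, Complex.star_def,
    Complex.conj_ofReal, ← add_smul, hps', hqr', one_smul, smul_zero, Matrix.fromBlocks_one]

lemma transferMap_interpolation (X : Matrix κ₀ κ₀ ℂ) (W : Matrix κ₁ κ₁ ℂ) :
    transferMap (interpolation A₀ A₁ p q r s) (Matrix.fromBlocks X 0 0 W) = Matrix.fromBlocks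
      (((p ^ 2 : ℝ) : ℂ) • transferMap A₀ X + (((q ^ 2 : ℝ) : ℂ) * W.trace) • 1) 0 0
      (((r ^ 2 : ℝ) : ℂ) • transferMap A₁ W + (((s ^ 2 : ℝ) : ℂ) * X.trace) • 1) := by
  simp only [transferMap_apply, interpolation, Matrix.fromBlocks_conjTranspose,
    Matrix.fromBlocks_multiply, sum_fromBlocks, Fintype.sum_sum_type, Sum.elim_inl, Sum.elim_inr,
    Pi.zero_apply, Pi.smul_apply, Matrix.conjTranspose_zero, Matrix.zero_mul, Matrix.mul_zero,
    add_zero, zero_add, Matrix.conjTranspose_smul, Matrix.smul_mul, Matrix.mul_smul, smul_smul,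
    ← Finset.smul_sum, sum_unitTensor_mul_mul_conjTranspose, Finset.sum_const_zero,
    Complex.star_def, Complex.conj_ofReal, Complex.ofReal_mul, pow_two]

omit [Fintype ι₁] in
lemma exists_eq_smul_one_of_intertwines_interpolation [Nonempty κ₀] [Nonempty κ₁]
    (h₀ : ∑ s, (A₀ s)ᴴ * A₀ s = 1) (hp : p ≠ 0) (hq : q ≠ 0) (hs : s ≠ 0) {μ : ℂ}
    {X : Matrix (κ₀ ⊕ κ₁) (κ₀ ⊕ κ₁) ℂ}
    (h : ∀ x, μ • (interpolation A₀ A₁ p q r s x * X) = X * interpolation A₀ A₁ p q r s x) :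
    ∃ c : ℂ, X = c • 1 := by
  obtain ⟨P, Q, R, S, rfl⟩ : ∃ P Q R S, X = Matrix.fromBlocks P Q R S :=
    ⟨_, _, _, _, (Matrix.fromBlocks_toBlocks X).symm⟩
  have hp' : (p : ℂ) ≠ 0 := Complex.ofReal_ne_zero.2 hp
  have hq' : (q : ℂ) ≠ 0 := Complex.ofReal_ne_zero.2 hq
  have hs' : (s : ℂ) ≠ 0 := Complex.ofReal_ne_zero.2 hs
  have hdiag (x : ι₀) := h (.inl (.inl x))
  have hupper (x : κ₀ × κ₁) := h (.inl (.inr x))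
  have hlower (x : κ₁ × κ₀) := h (.inr (.inr x))
  simp only [interpolation, Sum.elim_inl, Sum.elim_inr, Pi.zero_apply, Pi.smul_apply,
    Matrix.fromBlocks_multiply, Matrix.fromBlocks_smul, Matrix.zero_mul, Matrix.mul_zero, add_zero,
    zero_add, smul_zero, Matrix.fromBlocks_inj, Matrix.smul_mul, Matrix.mul_smul, smul_comm μ,
    smul_right_inj hp', smul_right_inj hq', smul_right_inj hs', eq_comm (a := (0 : Matrix _ _ ℂ)),
    smul_eq_zero, hp', hq', hs', false_or] at hdiag hupper hlower
  obtain ⟨a⟩ := ‹Nonempty κ₀›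
  obtain ⟨b⟩ := ‹Nonempty κ₁›
  have hR : R = 0 := eq_zero_of_mul_unitTensor_eq_zero fun x => (hupper x).2.2.2
  have hQ : Q = 0 := eq_zero_of_mul_unitTensor_eq_zero fun x => (hlower x).1
  have hP : P = (μ * S b b) • 1 :=
    eq_smul_one_of_smul_unitTensor_mul_eq (fun x => (hupper x).2.1) b
  have hS : S = (μ * P a a) • 1 :=
    eq_smul_one_of_smul_unitTensor_mul_eq (fun x => (hlower x).2.2.1) a
  replace hP : P = P a a • 1 := by
    rw [congrFun₂ hP a a]
    simpa using hP
  obtain ⟨x, hx⟩ : ∃ x, A₀ x ≠ 0 := by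
    by_contra! hzero
    simp [hzero] at h₀
  have hμ : (μ * P a a) • A₀ x = P a a • A₀ x := by
    have hx := (hdiag x).1
    rw [hP] at hx
    simpa [smul_smul] using hx
  refine ⟨P a a, ?_⟩
  rw [hR, hQ, hS, smul_left_injective ℂ hx hμ, ← Matrix.fromBlocks_one, Matrix.fromBlocks_smul,
    smul_zero, smul_zero, ← hP]

omit [DecidableEq κ₀] [DecidableEq κ₁] in
lemma trace_fromBlocks (P : Matrix κ₀ κ₀ ℂ) (Q : Matrix κ₀ κ₁ ℂ) (R : Matrix κ₁ κ₀ ℂ)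
    (S : Matrix κ₁ κ₁ ℂ) : (Matrix.fromBlocks P Q R S).trace = P.trace + S.trace := by
  simp [Matrix.trace]

/-- In the basis of the two blocks, the fixed point is a combination of the solutions of
`X = 1 + p² 𝔼₀(X)` and `W = 1 + r² 𝔼₁(W)`. -/
lemma exists_primitive_interpolation {ρ₀ : Matrix κ₀ κ₀ ℂ} {ρ₁ : Matrix κ₁ κ₁ ℂ}
    (h₀ : Primitive A₀ ρ₀) (h₁ : Primitive A₁ ρ₁) (hp : p ≠ 0) (hq : q ≠ 0) (hs : s ≠ 0)
    (hps : p ^ 2 + s ^ 2 * Fintype.card κ₁ = 1) (hqr : q ^ 2 * Fintype.card κ₀ + r ^ 2 = 1) :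
    ∃ ρ, Primitive (interpolation A₀ A₁ p q r s) ρ := by
  have hne₀ := h₀.nonempty
  have hne₁ := h₁.nonempty
  have hp₁ : 0 < 1 - p ^ 2 := by
    rw [← hps, add_sub_cancel_left]
    positivity
  have hr₁ : 0 < 1 - r ^ 2 := by
    rw [← hqr, add_sub_cancel_right]
    positivity
  obtain ⟨X, hX, hXeq, hXtr⟩ :=
    h₀.exists_posDef_eq_one_add_smul_transferMap (sq_nonneg p) (sub_pos.1 hp₁)
  obtain ⟨W, hW, hWeq, hWtr⟩ :=
    h₁.exists_posDef_eq_one_add_smul_transferMap (sq_nonneg r) (sub_pos.1 hr₁)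
  let D : ℝ := (1 - p ^ 2) + (1 - r ^ 2)
  let a : ℝ := q ^ 2 * (1 - p ^ 2) / D
  let b : ℝ := s ^ 2 * (1 - r ^ 2) / D
  have hD : (D : ℂ) ≠ 0 := Complex.ofReal_ne_zero.2 (add_pos hp₁ hr₁).ne'
  have haX : (a : ℂ) * X.trace = ((1 - r ^ 2 : ℝ) : ℂ) / D := by
    rw [← hqr]
    push_cast [a, ← hXtr]
    ring
  have hbW : (b : ℂ) * W.trace = ((1 - p ^ 2 : ℝ) : ℂ) / D := by
    rw [← hps]
    push_cast [b, ← hWtr]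
    ring
  refine ⟨Matrix.fromBlocks ((a : ℂ) • X) 0 0 ((b : ℂ) • W),
    primitive_of_forall_intertwiner_eq_smul_one
      (sum_conjTranspose_interpolation_mul h₀.left h₁.left hps hqr)
      (posDef_fromBlocks_zero (hX.smul ?_) (hW.smul ?_)) ?_ ?_ fun μ Z hZ =>
        exists_eq_smul_one_of_intertwines_interpolation h₀.left hp hq hs hZ⟩
  · exact_mod_cast (by positivity : 0 < a)
  · exact_mod_cast (by positivity : 0 < b)
  · rw [trace_fromBlocks, Matrix.trace_smul, Matrix.trace_smul, smul_eq_mul, smul_eq_mul, haX, hbW,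
      ← add_div, div_eq_one_iff_eq hD]
    push_cast [D]
    ring
  · rw [transferMap_interpolation, Matrix.trace_smul, Matrix.trace_smul, smul_eq_mul, smul_eq_mul,
      haX, hbW, map_smul, map_smul, mul_div_assoc', mul_div_assoc', ← Complex.ofReal_mul,
      ← Complex.ofReal_mul, ← Complex.ofReal_div, ← Complex.ofReal_div, smul_comm _ (a : ℂ),
      smul_comm _ (b : ℂ), ← smul_add, ← smul_add, add_comm _ (1 : Matrix κ₀ κ₀ ℂ),
      add_comm _ (1 : Matrix κ₁ κ₁ ℂ), ← hXeq, ← hWeq]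

lemma sameTraces_fromBlocks_upper (P : ι → Matrix κ₀ κ₀ ℂ) (Q : ι → Matrix κ₀ κ₁ ℂ) :
    SameTraces (fun s => Matrix.fromBlocks (P s) (Q s) 0 0) P := by
  intro n hn s
  suffices h : ∃ Z, word (fun _ s => Matrix.fromBlocks (P s) (Q s) 0 0) s =
      Matrix.fromBlocks (word (fun _ => P) s) Z 0 0 by
    obtain ⟨Z, hZ⟩ := h
    rw [hZ, trace_fromBlocks, Matrix.trace_zero, add_zero]
  induction n, hn using Nat.le_induction with
  | base => exact ⟨Q (s 0), by simp [word]⟩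
  | succ n _ ih =>
    obtain ⟨Z, hZ⟩ := ih fun i => s i.castSucc
    refine ⟨word (fun _ => P) (fun i => s i.castSucc) * Q (s (Fin.last n)), ?_⟩
    simp only [word_succ_last, hZ, Matrix.fromBlocks_multiply, Matrix.mul_zero, Matrix.zero_mul,
      add_zero]

lemma sameTraces_fromBlocks_lower (P : ι → Matrix κ₁ κ₁ ℂ) (Q : ι → Matrix κ₁ κ₀ ℂ) :
    SameTraces (fun s => Matrix.fromBlocks 0 0 (Q s) (P s)) P := by
  have hswap : (fun s => Matrix.fromBlocks 0 0 (Q s) (P s)) = reindexTensor (Equiv.refl ι)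
      (Equiv.sumComm κ₀ κ₁) fun s => Matrix.fromBlocks (P s) (Q s) 0 0 :=
    funext fun s => (Matrix.fromBlocks_submatrix_sum_swap_sum_swap _ _ _ _).symm
  rw [hswap]
  intro n hn s
  rw [trace_word_reindexTensor]
  exact sameTraces_fromBlocks_upper P Q n hn s

omit [Fintype ι₀] [Fintype ι₁] [Fintype κ₀] [Fintype κ₁] in
lemma continuous_interpolation {X : Type*} [TopologicalSpace X] {p q r s : X → ℝ}
    (hp : Continuous p) (hq : Continuous q) (hr : Continuous r) (hs : Continuous s) :
    Continuous fun t => interpolation A₀ A₁ (p t) (q t) (r t) (s t) := by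
  refine continuous_pi fun x => Continuous.matrix_fromBlocks ?_ ?_ ?_ ?_ <;>
    rcases x with (x | x) | (x | x) <;>
    simp only [Sum.elim_inl, Sum.elim_inr, Pi.zero_apply, Pi.smul_apply] <;> fun_prop

end Interpolation

section Connect

variable {ι₀ ι₁ κ₀ κ₁ : Type*} [Fintype ι₀] [Fintype ι₁] [Fintype κ₀] [Fintype κ₁]
  [DecidableEq ι₀] [DecidableEq ι₁] [DecidableEq κ₀] [DecidableEq κ₁]
  {A₀ : ι₀ → Matrix κ₀ κ₀ ℂ} {A₁ : ι₁ → Matrix κ₁ κ₁ ℂ}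

/-- The path of left-canonical interpolations from `A₀` to `A₁`. The coefficients are the solutions
of the left-canonical condition for which the weight of `A₁` grows linearly. -/
def interpolationPath (A₀ : ι₀ → Matrix κ₀ κ₀ ℂ) (A₁ : ι₁ → Matrix κ₁ κ₁ ℂ) (t : ℝ) :
    (ι₀ ⊕ κ₀ × κ₁) ⊕ (ι₁ ⊕ κ₁ × κ₀) → Matrix (κ₀ ⊕ κ₁) (κ₀ ⊕ κ₁) ℂ :=
  interpolation A₀ A₁ √(1 - t) √((1 - t) / Fintype.card κ₀) √t √(t / Fintype.card κ₁)

omit [DecidableEq ι₀] [DecidableEq ι₁] in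
lemma exists_primitive_interpolationPath {ρ₀ : Matrix κ₀ κ₀ ℂ} {ρ₁ : Matrix κ₁ κ₁ ℂ}
    (h₀ : Primitive A₀ ρ₀) (h₁ : Primitive A₁ ρ₁) {t : ℝ} (ht : t ∈ Set.Ioo 0 1) :
    ∃ ρ, Primitive (interpolationPath A₀ A₁ t) ρ := by
  have hne₀ := h₀.nonempty
  have hne₁ := h₁.nonempty
  have ht₀ : 0 < t := ht.1
  have ht₁ : 0 < 1 - t := sub_pos.2 ht.2
  refine exists_primitive_interpolation h₀ h₁ (Real.sqrt_ne_zero'.2 ht₁)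
    (Real.sqrt_ne_zero'.2 (by positivity)) (Real.sqrt_ne_zero'.2 (by positivity)) ?_ ?_
  · rw [Real.sq_sqrt ht₁.le, Real.sq_sqrt (by positivity), div_mul_cancel₀ _ (by simp),
      sub_add_cancel]
  · rw [Real.sq_sqrt ht₀.le, Real.sq_sqrt (by positivity), div_mul_cancel₀ _ (by simp),
      sub_add_cancel]

omit [Fintype ι₁] [DecidableEq ι₁] in
lemma sameTraces_interpolationPath_zero : SameTraces (interpolationPath A₀ A₁ 0)
    (physMap (Matrix.fromRows (Matrix.fromRows 1 0) 0) A₀) := by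
  convert sameTraces_fromBlocks_upper _ (Sum.elim (Sum.elim 0
    ((√(1 / Fintype.card κ₀) : ℂ) • unitTensor κ₀ κ₁)) 0) using 2 with x
  rcases x with (x | x) | (x | x) <;>
    simp [interpolationPath, interpolation, physMap, Matrix.one_apply]

omit [Fintype ι₀] [DecidableEq ι₀] in
lemma sameTraces_interpolationPath_one : SameTraces (interpolationPath A₀ A₁ 1)
    (physMap (Matrix.fromRows 0 (Matrix.fromRows 1 0)) A₁) := by
  convert sameTraces_fromBlocks_lower _ (Sum.elim 0 (Sum.elim 0
    ((√(1 / Fintype.card κ₁) : ℂ) • unitTensor κ₁ κ₀))) using 2 with x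
  rcases x with (x | x) | (x | x) <;>
    simp [interpolationPath, interpolation, physMap, Matrix.one_apply]

variable {G : Type} [Group G] {T : MulAut G} {L : ℕ} {ω : G → G → Circle} {φ : G → Circle}
  {v₀ : G → Matrix.unitaryGroup κ₀ ℂ} {v₁ : G → Matrix.unitaryGroup κ₁ ℂ}

/-- The representation on the physical space of an interpolation. -/
def interpolationRep (U₀ : G →* Matrix.unitaryGroup ι₀ ℂ) (U₁ : G →* Matrix.unitaryGroup ι₁ ℂ)
    (hφ : IsCrystallineCocycle T ω φ) (hv₀ : IsProjectiveRep ω v₀) (hv₁ : IsProjectiveRep ω v₁) :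
    G →* Matrix.unitaryGroup ((ι₀ ⊕ κ₀ × κ₁) ⊕ (ι₁ ⊕ κ₁ × κ₀)) ℂ :=
  blockUnitary.comp ((blockUnitary.comp (U₀.prod (bondRep hφ hv₀ hv₁))).prod
    (blockUnitary.comp (U₁.prod (bondRep hφ hv₁ hv₀))))

lemma pushesTo_interpolation {U₀ : G →* Matrix.unitaryGroup ι₀ ℂ}
    {U₁ : G →* Matrix.unitaryGroup ι₁ ℂ} (hφ : IsCrystallineCocycle T ω φ)
    (hv₀ : IsProjectiveRep ω v₀) (hv₁ : IsProjectiveRep ω v₁) (h₀ : PushesTo T U₀ v₀ φ A₀)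
    (h₁ : PushesTo T U₁ v₁ φ A₁) (p q r s : ℝ) :
    PushesTo T (interpolationRep U₀ U₁ hφ hv₀ hv₁) (fun g => blockUnitary (v₀ g, v₁ g)) φ
      (interpolation A₀ A₁ p q r s) :=
  pushesTo_fromBlocks
    (((PushesBetween.smul h₀ _).sumElim pushesBetween_zero).sumElim pushesBetween_zero)
    ((pushesBetween_zero.sumElim ((pushesBetween_unitTensor hφ hv₀ hv₁).smul _)).sumElim
      pushesBetween_zero)
    (pushesBetween_zero.sumElim (pushesBetween_zero.sumElim
      ((pushesBetween_unitTensor hφ hv₁ hv₀).smul _)))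
    (pushesBetween_zero.sumElim ((PushesBetween.smul h₁ _).sumElim pushesBetween_zero))

lemma deformation_of_pushesTo {S₀ S₁ : SymMPS T L} (hT : T ^ L = 1)
    {v₀ : G → Matrix.unitaryGroup (Fin S₀.χ) ℂ} {v₁ : G → Matrix.unitaryGroup (Fin S₁.χ) ℂ}
    (hφ : IsCrystallineCocycle T ω φ) (hv₀ : IsProjectiveRep ω v₀) (hv₁ : IsProjectiveRep ω v₁)
    (h₀ : PushesTo T S₀.U v₀ φ S₀.A) (h₁ : PushesTo T S₁.U v₁ φ S₁.A) : Deformation S₀ S₁ := by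
  obtain ⟨ρ₀, hρ₀⟩ := S₀.injective.exists_primitive
  obtain ⟨ρ₁, hρ₁⟩ := S₁.injective.exists_primitive
  have hR (g : G) : (interpolationRep S₀.U S₁.U hφ hv₀ hv₁ g).1 = Matrix.fromBlocks
      (Matrix.fromBlocks (S₀.U g).1 0 0 (bondRep hφ hv₀ hv₁ g).1) 0 0
      (Matrix.fromBlocks (S₁.U g).1 0 0 (bondRep hφ hv₁ hv₀ g).1) := rfl
  refine deformation_of_path hT (interpolationRep S₀.U S₁.U hφ hv₀ hv₁) _ _
    (interpolationPath S₀.A S₁.A) ?_ ?_ (fun g => ?_) (fun g => ?_)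
    (continuous_interpolation (by fun_prop) (by fun_prop) (by fun_prop) (by fun_prop)).continuousOn
    (fun t ht => exists_primitive_interpolationPath hρ₀ hρ₁ ht)
    (fun t _ => ⟨_, φ, pushesTo_interpolation hφ hv₀ hv₁ h₀ h₁ _ _ _ _⟩)
    sameTraces_interpolationPath_zero sameTraces_interpolationPath_one
  · simp [Matrix.conjTranspose_fromRows_eq_fromCols_conjTranspose, Matrix.fromCols_mul_fromRows]
  · simp [Matrix.conjTranspose_fromRows_eq_fromCols_conjTranspose, Matrix.fromCols_mul_fromRows]
  · simp [hR, Matrix.fromBlocks_mul_fromRows, Matrix.fromRows_mul]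
  · simp [hR, Matrix.fromBlocks_mul_fromRows, Matrix.fromRows_mul]

end Connect

section CompleteInvariant

variable {ι κ : Type*} [Fintype ι] [Fintype κ] [DecidableEq ι] [DecidableEq κ]

lemma PushesTo.rescale {Γ : Type*} {τ : Γ → Γ} {U : Γ → Matrix.unitaryGroup ι ℂ}
    {v : Γ → Matrix.unitaryGroup κ ℂ} {φ : Γ → Circle} {A : ι → Matrix κ κ ℂ}
    (h : PushesTo τ U v φ A) (z : Γ → Circle) :
    PushesTo τ U (fun γ => phaseMul (z γ) (v γ)) (φ * (z / z ∘ τ)) A := by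
  intro γ s
  have hphase : φ γ = φ γ * (z γ / z (τ γ)) * (z (τ γ) * (z γ)⁻¹) := by
    rw [mul_assoc, ← div_eq_mul_inv, div_mul_div_cancel, div_self', mul_one]
  have hcoe : (φ γ : ℂ) = φ γ * (z γ / z (τ γ) : Circle) * (z (τ γ) * (z γ)⁻¹ : Circle) := by
    rw [← Circle.coe_mul, ← Circle.coe_mul, ← hphase]
  rw [h γ s, hcoe]
  simp only [coe_phaseMul, Matrix.conjTranspose_smul, Matrix.smul_mul, Matrix.mul_smul, smul_smul,
    Pi.mul_apply, Pi.div_apply, Function.comp_apply, Complex.star_def, Circle.coe_inv_eq_conj,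
    Circle.coe_mul, mul_assoc]

variable {G : Type} [Group G] {T : MulAut G} {L : ℕ}

lemma phase_eq_of_hasClass {S₀ S₁ : SymMPS T L} (hT : T ^ L = 1)
    {x : groupCohomology.H2 (U1 (FullGroup T))} (h₀ : HasClass T S₀.U S₀.A x)
    (h₁ : HasClass T S₁.U S₁.A x) : S₀.phase = S₁.phase := by
  obtain ⟨v₀, φ₀, ω₀, hpush₀, hv₀, he₀⟩ := h₀
  obtain ⟨v₁, φ₁, ω₁, hpush₁, hv₁, he₁⟩ := h₁
  obtain ⟨z, rfl, rfl⟩ := (he₀.eq_iff he₁).1 rfl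
  exact Quot.sound <| deformation_of_pushesTo hT he₀.isCrystallineCocycle hv₀
    (hv₁.mul_coboundary z) hpush₀ (hpush₁.rescale z)

lemma crystallineClass_injective (hL : 1 ≤ L) (hT : T ^ L = 1) :
    Function.Injective (crystallineClass (T := T) hL hT) := by
  refine Quot.ind fun S₀ => Quot.ind fun S₁ h => phase_eq_of_hasClass hT
    ((hasClass_iff_crystallineClass_eq hL hT S₀ _).2 h)
    ((hasClass_iff_crystallineClass_eq hL hT S₁ _).2 rfl)

end CompleteInvariant

section Stack

open scoped Kronecker

variable {ι ι' κ κ' : Type*} [Fintype ι] [Fintype ι'] [Fintype κ] [Fintype κ']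

/-- The stack of two tensors: tensor product on physical and on virtual legs. -/
def stackTensor (A : ι → Matrix κ κ ℂ) (B : ι' → Matrix κ' κ' ℂ) :
    ι × ι' → Matrix (κ × κ') (κ × κ') ℂ :=
  fun p => A p.1 ⊗ₖ B p.2

omit [Fintype κ] [Fintype κ'] in
lemma sum_stackTensor (A : ι → Matrix κ κ ℂ) (B : ι' → Matrix κ' κ' ℂ) :
    ∑ p, stackTensor A B p = (∑ s, A s) ⊗ₖ ∑ s, B s := by
  ext i j
  simp only [stackTensor, Matrix.sum_apply, Matrix.kroneckerMap_apply, Fintype.sum_prod_type,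
    Finset.sum_mul_sum]

omit [Fintype κ] [Fintype κ'] in
lemma physMap_stackTensor (M : Matrix ι ι ℂ) (N : Matrix ι' ι' ℂ) (A : ι → Matrix κ κ ℂ)
    (B : ι' → Matrix κ' κ' ℂ) (p : ι × ι') :
    physMap (M ⊗ₖ N) (stackTensor A B) p = physMap M A p.1 ⊗ₖ physMap N B p.2 := by
  rw [physMap, physMap, physMap, ← sum_stackTensor]
  simp only [stackTensor, Matrix.kroneckerMap_apply, Matrix.smul_kronecker,
    Matrix.kronecker_smul, smul_smul, mul_comm]

lemma transferMap_stackTensor (A : ι → Matrix κ κ ℂ) (B : ι' → Matrix κ' κ' ℂ)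
    (X : Matrix κ κ ℂ) (Y : Matrix κ' κ' ℂ) :
    transferMap (stackTensor A B) (X ⊗ₖ Y) = transferMap A X ⊗ₖ transferMap B Y := by
  rw [transferMap_apply, transferMap_apply, transferMap_apply, ← sum_stackTensor]
  simp only [stackTensor, Matrix.conjTranspose_kronecker, ← Matrix.mul_kronecker_mul]

lemma transferMap_stackTensor_pow (A : ι → Matrix κ κ ℂ) (B : ι' → Matrix κ' κ' ℂ)
    (X : Matrix κ κ ℂ) (Y : Matrix κ' κ' ℂ) (n : ℕ) :
    (transferMap (stackTensor A B) ^ n) (X ⊗ₖ Y) =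
      (transferMap A ^ n) X ⊗ₖ (transferMap B ^ n) Y := by
  induction n with
  | zero => rfl
  | succ n ih => simp only [pow_succ', Module.End.mul_apply, ih, transferMap_stackTensor]

variable [DecidableEq κ] [DecidableEq κ']

lemma sum_smul_single_kronecker_single (Z : Matrix (κ × κ') (κ × κ') ℂ) :
    ∑ i, ∑ j, Z i j • (Matrix.single i.1 j.1 1 ⊗ₖ Matrix.single i.2 j.2 1) = Z := by
  simp only [Matrix.single_kronecker_single, Prod.mk.eta, Matrix.smul_single, mul_one,
    smul_eq_mul]
  exact (Matrix.matrix_eq_sum_single Z).symm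

lemma Primitive.stack {A : ι → Matrix κ κ ℂ} {B : ι' → Matrix κ' κ' ℂ} {ρ : Matrix κ κ ℂ}
    {σ : Matrix κ' κ' ℂ} (hA : Primitive A ρ) (hB : Primitive B σ) :
    Primitive (stackTensor A B) (ρ ⊗ₖ σ) where
  left := by
    have h := sum_stackTensor (fun s => (A s)ᴴ * A s) (fun s => (B s)ᴴ * B s)
    rw [hA.left, hB.left, Matrix.one_kronecker_one] at h
    simpa only [stackTensor, Matrix.conjTranspose_kronecker, ← Matrix.mul_kronecker_mul] using h
  posDef := hA.posDef.kronecker hB.posDef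
  trace_eq := by rw [Matrix.trace_kronecker, hA.trace_eq, hB.trace_eq, one_mul]
  tendsto Z := by
    have hproduct (X : Matrix κ κ ℂ) (Y : Matrix κ' κ' ℂ) :
        Tendsto (fun n => (transferMap (stackTensor A B) ^ n) (X ⊗ₖ Y)) atTop
          (𝓝 ((X ⊗ₖ Y).trace • ρ ⊗ₖ σ)) := by
      simp only [transferMap_stackTensor_pow, Matrix.trace_kronecker]
      rw [mul_smul, ← Matrix.kronecker_smul, ← Matrix.smul_kronecker]
      refine tendsto_pi_nhds.2 fun i => tendsto_pi_nhds.2 fun j => ?_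
      exact (((hA.tendsto X).apply_nhds i.1).apply_nhds j.1).mul
        (((hB.tendsto Y).apply_nhds i.2).apply_nhds j.2)
    rw [← sum_smul_single_kronecker_single Z]
    simp only [map_sum, map_smul, Matrix.trace_sum, Matrix.trace_smul, Finset.sum_smul, smul_assoc]
    exact tendsto_finsetSum _ fun i _ => tendsto_finsetSum _ fun j _ => (hproduct _ _).const_smul _

variable [DecidableEq ι] [DecidableEq ι']

lemma PushesTo.stack {Γ : Type*} {τ : Γ → Γ} {U : Γ → Matrix.unitaryGroup ι ℂ}
    {U' : Γ → Matrix.unitaryGroup ι' ℂ} {v : Γ → Matrix.unitaryGroup κ ℂ}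
    {v' : Γ → Matrix.unitaryGroup κ' ℂ} {φ φ' : Γ → Circle} {A : ι → Matrix κ κ ℂ}
    {B : ι' → Matrix κ' κ' ℂ} (hA : PushesTo τ U v φ A) (hB : PushesTo τ U' v' φ' B) :
    PushesTo τ (fun γ => kroneckerUnitary (U γ, U' γ)) (fun γ => kroneckerUnitary (v γ, v' γ))
      (φ * φ') (stackTensor A B) := fun γ p => by
  simp only [coe_kroneckerUnitary, physMap_stackTensor, hA γ, hB γ, stackTensor, Pi.mul_apply,
    Circle.coe_mul, Matrix.smul_kronecker, Matrix.kronecker_smul, smul_smul,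
    mul_comm (φ' γ : ℂ), Matrix.mul_kronecker_mul, Matrix.conjTranspose_kronecker]

variable {G : Type} [Group G] {T : MulAut G} {L : ℕ}

lemma isStack_iff {S₁ S₂ S : SymMPS T L} : IsStack S₁ S₂ S ↔
    ∃ (e : Fin S.d ≃ Fin S₁.d × Fin S₂.d) (f : Fin S.χ ≃ Fin S₁.χ × Fin S₂.χ),
      reindexTensor e f (stackTensor S₁.A S₂.A) = S.A ∧
        ∀ g, reindexUnitary e (kroneckerUnitary (S₁.U g, S₂.U g)) = S.U g := by
  constructor
  · rintro ⟨e, f, hA, hU⟩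
    refine ⟨e.symm, f.symm, ?_, fun g => Subtype.ext ?_⟩
    · ext s i j
      have hentry := hA (e.symm s).1 (e.symm s).2 (f.symm i).1 (f.symm i).2 (f.symm j).1
        (f.symm j).2
      simpa [reindexTensor, stackTensor] using hentry.symm
    · ext s t
      have hentry := hU g (e.symm s).1 (e.symm s).2 (e.symm t).1 (e.symm t).2
      simpa [coe_reindexUnitary, coe_kroneckerUnitary] using hentry.symm
  · rintro ⟨e, f, hA, hU⟩
    refine ⟨e.symm, f.symm, fun a b i k j l => ?_, fun g a b a' b' => ?_⟩
    · simp [← hA, reindexTensor, stackTensor]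
    · simp [← hU, coe_reindexUnitary, coe_kroneckerUnitary]

lemma IsStack.exists_pushThrough {S₁ S₂ S : SymMPS T L} (h : IsStack S₁ S₂ S)
    {v₁ : G →* Matrix.unitaryGroup (Fin S₁.χ) ℂ} {v₂ : G →* Matrix.unitaryGroup (Fin S₂.χ) ℂ}
    {φ₁ φ₂ : G → Circle} (h₁ : S₁.PushThrough v₁ φ₁) (h₂ : S₂.PushThrough v₂ φ₂) :
    ∃ v : G →* Matrix.unitaryGroup (Fin S.χ) ℂ, S.PushThrough v (φ₁ * φ₂) := by
  obtain ⟨e, f, hA, hU⟩ := isStack_iff.1 h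
  have hpush := ((pushThrough_iff_pushesTo.1 h₁).stack (pushThrough_iff_pushesTo.1 h₂)).reindex e f
  rw [hA, show reindexUnitary e ∘ (fun g => kroneckerUnitary (S₁.U g, S₂.U g)) = S.U from
    funext hU] at hpush
  exact ⟨((reindexUnitary f).comp kroneckerUnitary).comp (v₁.prod v₂),
    pushThrough_iff_pushesTo.2 hpush⟩

theorem exists_isStack (hL : 1 ≤ L) (hT : T ^ L = 1) (S₁ S₂ : SymMPS T L) :
    ∃ S, IsStack S₁ S₂ S := by
  obtain ⟨ρ₁, hρ₁⟩ := S₁.injective.exists_primitive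
  obtain ⟨ρ₂, hρ₂⟩ := S₂.injective.exists_primitive
  obtain ⟨v₁, φ₁, hpush₁⟩ := hρ₁.exists_pushesTo hL hT S₁.symmetric
  obtain ⟨v₂, φ₂, hpush₂⟩ := hρ₂.exists_pushesTo hL hT S₂.symmetric
  exact ⟨SymMPS.ofTensor (U := kroneckerUnitary.comp (S₁.U.prod S₂.U)) hT (hρ₁.stack hρ₂)
    (hpush₁.stack hpush₂) finProdFinEquiv.symm finProdFinEquiv.symm,
    isStack_iff.2 ⟨finProdFinEquiv.symm, finProdFinEquiv.symm, rfl, fun _ => rfl⟩⟩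

end Stack

section Realization

variable {κ : Type*} [Fintype κ] [DecidableEq κ]

lemma primitive_smul_unitTensor {c : ℝ} (hc : c ^ 2 * Fintype.card κ = 1) :
    Primitive ((c : ℂ) • unitTensor κ κ) (((c ^ 2 : ℝ) : ℂ) • (1 : Matrix κ κ ℂ)) := by
  have hpos : 0 < c ^ 2 := (sq_nonneg c).lt_of_ne' fun h => by simp [h] at hc
  have hc0 : (c : ℂ) ≠ 0 := fun h => by simp_all
  have hone : ((c ^ 2 : ℝ) : ℂ) * Fintype.card κ = 1 := by exact_mod_cast hc
  have : Nonempty κ := Fintype.card_pos_iff.1 <| Nat.pos_of_ne_zero fun h => by simp [h] at hc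
  have hstar : star (c : ℂ) = c := Complex.conj_ofReal c
  have hsq : (c : ℂ) * c = ((c ^ 2 : ℝ) : ℂ) := by rw [← Complex.ofReal_mul, pow_two]
  refine primitive_of_forall_intertwiner_eq_smul_one ?_ (Matrix.PosDef.one.smul ?_) ?_ ?_
    fun μ X hX => ⟨μ * X (Classical.arbitrary κ) (Classical.arbitrary κ),
      eq_smul_one_of_smul_unitTensor_mul_eq (fun x => ?_) _⟩
  · simp only [Pi.smul_apply, Matrix.conjTranspose_smul, Matrix.smul_mul, Matrix.mul_smul,
      smul_smul, ← Finset.smul_sum, sum_conjTranspose_unitTensor_mul, hstar, hsq, hone, one_smul]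
  · exact_mod_cast hpos
  · rw [Matrix.trace_smul, Matrix.trace_one, smul_eq_mul, hone]
  · have hsum := sum_unitTensor_mul_mul_conjTranspose (κ₀ := κ) (1 : Matrix κ κ ℂ)
    simp only [Matrix.mul_one, Matrix.trace_one] at hsum
    rw [map_smul, transferMap_apply]
    simp only [Pi.smul_apply, Matrix.conjTranspose_smul, Matrix.smul_mul, Matrix.mul_smul,
      smul_smul, ← Finset.smul_sum, hstar, hsq, hsum, hone, mul_one]
  · have hx := hX x
    simp only [Pi.smul_apply, Matrix.smul_mul, Matrix.mul_smul, smul_comm μ] at hx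
    exact smul_right_injective _ hc0 hx

variable {G : Type} [Group G] {T : MulAut G} {L : ℕ} {ω : G → G → Circle} {φ : G → Circle}
  {v : G → Matrix.unitaryGroup κ ℂ} {x : groupCohomology.H2 (U1 (FullGroup T))}

/-- The twisted left regular representation `δ_k ↦ ω(g, k) δ_{gk}`. -/
def twistedRegular [Fintype G] [DecidableEq G] (ω : G → G → Circle) (g : G) :
    Matrix.unitaryGroup G ℂ :=
  ⟨Matrix.of fun h k => if h = g * k then (ω g k : ℂ) else 0, by
    rw [Matrix.mem_unitaryGroup_iff', Matrix.star_eq_conjTranspose]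
    ext i j
    by_cases hij : i = j
    · subst hij
      simp [Matrix.mul_apply, Complex.conj_mul', Circle.norm_coe]
    · simp [Matrix.mul_apply, hij, Ne.symm hij]⟩

lemma coe_twistedRegular_apply [Fintype G] [DecidableEq G] (ω : G → G → Circle) (g h k : G) :
    (twistedRegular ω g).1 h k = if h = g * k then (ω g k : ℂ) else 0 := rfl

lemma isProjectiveRep_twistedRegular [Fintype G] [DecidableEq G] (hω : IsCocycle ω) :
    IsProjectiveRep ω (twistedRegular ω) := fun g h => by
  ext i k
  have hcocycle : (ω (g * h) k : ℂ) * ω g h = ω h k * ω g (h * k) := by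
    exact congrArg Subtype.val (hω g h k)
  by_cases hi : i = g * (h * k)
  · simpa [hi, Matrix.mul_apply, coe_twistedRegular_apply, mul_assoc, mul_comm] using hcocycle.symm
  · simp [Matrix.mul_apply, coe_twistedRegular_apply, mul_assoc, hi]

lemma exists_hasClass_of_isProjectiveRep [Nonempty κ] (hT : T ^ L = 1) (hv : IsProjectiveRep ω v)
    (hx : Encodes T ω φ x) : ∃ S : SymMPS T L, HasClass T S.U S.A x := by
  have hcard : (√(Fintype.card κ))⁻¹ ^ 2 * Fintype.card κ = 1 := by
    rw [inv_pow, Real.sq_sqrt (Nat.cast_nonneg _), inv_mul_cancel₀ (by simp)]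
  have hpush := (pushesBetween_unitTensor hx.isCrystallineCocycle hv hv).smul
    ((√(Fintype.card κ))⁻¹ : ℝ)
  exact ⟨SymMPS.ofTensor hT (primitive_smul_unitTensor hcard) hpush (Fintype.equivFin _).symm
    (Fintype.equivFin _).symm, HasClass.reindex ⟨v, φ, ω, hpush, hv, hx⟩ _ _⟩

lemma exists_hasClass_character (hT : T ^ L = 1) {χ : G →* Circle} (hx : Encodes T 1 χ x) :
    ∃ S : SymMPS T L, HasClass T S.U S.A x :=
  exists_hasClass_of_isProjectiveRep (κ := Unit) (v := 1) hT (fun _ _ => by simp) hx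

theorem crystallineClass_surjective [Finite G] (hL : 1 ≤ L) (hT : T ^ L = 1) :
    Function.Surjective (crystallineClass (T := T) hL hT) := fun x => by
  classical
  have := Fintype.ofFinite G
  obtain ⟨ω, φ, hx⟩ := exists_encodes x
  obtain ⟨S, hS⟩ := exists_hasClass_of_isProjectiveRep hT
    (isProjectiveRep_twistedRegular hx.isCrystallineCocycle.isCocycle) hx
  exact ⟨S.phase, (hasClass_iff_crystallineClass_eq hL hT S x).1 hS⟩

end Realization

section WeakIndex

variable {G : Type} [Group G] {T : MulAut G} {L : ℕ}

lemma IsProjectiveRep.eq_one {κ : Type*} [Fintype κ] [DecidableEq κ] [Nonempty κ]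
    {ω : G → G → Circle} {v : G →* Matrix.unitaryGroup κ ℂ} (h : IsProjectiveRep ω v) : ω = 1 := by
  ext g k
  have hne : (v (g * k)).1 ≠ 0 := fun h0 => one_ne_zero <| by
    rw [← coe_mul_conjTranspose_self (v (g * k)), h0, Matrix.zero_mul]
  have hsmul : (ω g k : ℂ) • (v (g * k)).1 = (1 : ℂ) • (v (g * k)).1 := by
    rw [← h g k, map_mul, one_smul, Submonoid.coe_mul]
  exact smul_left_injective ℂ hne hsmul

lemma SymMPS.PushThrough.encodes_crystallineClass {S : SymMPS T L}
    {v : G →* Matrix.unitaryGroup (Fin S.χ) ℂ} {φ : G → Circle} (h : S.PushThrough v φ)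
    (hL : 1 ≤ L) (hT : T ^ L = 1) : Encodes T 1 φ (crystallineClass hL hT S.phase) := by
  obtain ⟨ρ, hρ⟩ := S.injective.exists_primitive
  have hpush := pushThrough_iff_pushesTo.1 h
  obtain ⟨ω, x, hω, hx⟩ := hpush.exists_encodes hρ
  have := hρ.nonempty
  obtain rfl := hω.eq_one
  rwa [(hasClass_iff_crystallineClass_eq hL hT S x).1 ⟨_, φ, 1, hpush, hω, hx⟩]

lemma hasWeakIndex_iff (hL : 1 ≤ L) (hT : T ^ L = 1) {S : SymMPS T L} {x : WeakSPTGroup T} :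
    S.HasWeakIndex x ↔ crystallineClass hL hT S.phase = inflation T (.ofMul x) := by
  constructor
  · rintro ⟨v, χ, h, rfl⟩
    exact (h.encodes_crystallineClass hL hT).unique (encodes_inflation χ)
  · intro h
    obtain ⟨v, φ, ω, hpush, hv, hx⟩ := (hasClass_iff_crystallineClass_eq hL hT S _).2 rfl
    obtain ⟨z, χ, hω, hφ⟩ := hx.exists_character ((H2pullback_inl_eq_zero_iff _).2 ⟨_, h.symm⟩)
    have hlinear := hv.mul_coboundary z
    have hpush' := hpush.rescale z
    have htwist := hx.mul_coboundary z
    rw [hω] at hlinear htwist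
    rw [hφ] at hpush' htwist
    refine ⟨hlinear.toMonoidHom, χ, pushThrough_iff_pushesTo.2 hpush',
      Additive.ofMul.injective (inflation_injective ?_)⟩
    rw [← h]
    exact (encodes_inflation χ).unique htwist

lemma isWeak_iff_exists_hasWeakIndex (hL : 1 ≤ L) (hT : T ^ L = 1) {S : SymMPS T L} :
    S.IsWeak ↔ ∃ x, S.HasWeakIndex x := by
  constructor
  · rintro ⟨v, φ, h⟩
    have hφ := (h.encodes_crystallineClass hL hT).isCrystallineCocycle
    exact ⟨_, v, MonoidHom.mk' φ (isCrystallineCocycle_one_left_iff.1 hφ), h, rfl⟩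
  · rintro ⟨_, v, χ, h, -⟩
    exact ⟨v, χ, h⟩

lemma isWeak_congr (hL : 1 ≤ L) (hT : T ^ L = 1) {S S' : SymMPS T L} (h : S.phase = S'.phase) :
    S.IsWeak ↔ S'.IsWeak := by
  simp only [isWeak_iff_exists_hasWeakIndex hL hT, hasWeakIndex_iff hL hT, h]

lemma exists_inflation_eq_crystallineClass (hL : 1 ≤ L) (hT : T ^ L = 1) (p : WeakPhase T L) :
    ∃ x, crystallineClass hL hT p.1 = inflation T (.ofMul x) := by
  obtain ⟨_, S, hS, rfl⟩ := p
  obtain ⟨x, hx⟩ := (isWeak_iff_exists_hasWeakIndex hL hT).1 hS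
  exact ⟨x, (hasWeakIndex_iff hL hT).1 hx⟩

/-- The weak SPT index of a weak phase. -/
def weakIndex (hL : 1 ≤ L) (hT : T ^ L = 1) (p : WeakPhase T L) : WeakSPTGroup T :=
  (exists_inflation_eq_crystallineClass hL hT p).choose

lemma crystallineClass_eq_inflation_weakIndex (hL : 1 ≤ L) (hT : T ^ L = 1) (p : WeakPhase T L) :
    crystallineClass hL hT p.1 = inflation T (.ofMul (weakIndex hL hT p)) :=
  (exists_inflation_eq_crystallineClass hL hT p).choose_spec

lemma hasWeakIndex_iff_weakIndex_eq (hL : 1 ≤ L) (hT : T ^ L = 1) {S : SymMPS T L} (h : S.IsWeak)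
    {x : WeakSPTGroup T} : S.HasWeakIndex x ↔ weakIndex hL hT (S.weakPhase h) = x := by
  rw [hasWeakIndex_iff hL hT, show S.phase = (S.weakPhase h).1 from rfl,
    crystallineClass_eq_inflation_weakIndex, inflation_injective.eq_iff,
    Additive.ofMul.injective.eq_iff]

theorem weakIndex_bijective (hL : 1 ≤ L) (hT : T ^ L = 1) :
    Function.Bijective (weakIndex (T := T) hL hT) := by
  refine ⟨fun p q hpq => Subtype.ext (crystallineClass_injective hL hT ?_), fun x => ?_⟩
  · rw [crystallineClass_eq_inflation_weakIndex, crystallineClass_eq_inflation_weakIndex, hpq]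
  · obtain ⟨χ, rfl⟩ := QuotientGroup.mk_surjective x
    obtain ⟨S, hS⟩ := exists_hasClass_character hT (encodes_inflation χ)
    have hindex := (hasWeakIndex_iff hL hT).2 ((hasClass_iff_crystallineClass_eq hL hT S _).1 hS)
    have hweak := (isWeak_iff_exists_hasWeakIndex hL hT).2 ⟨_, hindex⟩
    exact ⟨S.weakPhase hweak, (hasWeakIndex_iff_weakIndex_eq hL hT hweak).1 hindex⟩

lemma IsStack.hasWeakIndex_mul {S₁ S₂ S : SymMPS T L} (h : IsStack S₁ S₂ S)
    {x₁ x₂ : WeakSPTGroup T} (h₁ : S₁.HasWeakIndex x₁) (h₂ : S₂.HasWeakIndex x₂) :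
    S.HasWeakIndex (x₁ * x₂) := by
  obtain ⟨v₁, φ₁, hpush₁, rfl⟩ := h₁
  obtain ⟨v₂, φ₂, hpush₂, rfl⟩ := h₂
  obtain ⟨v, hpush⟩ := h.exists_pushThrough hpush₁ hpush₂
  exact ⟨v, φ₁ * φ₂, hpush, rfl⟩

theorem IsStack.exists_weakIndex_eq_mul {S₁ S₂ S : SymMPS T L} (h : IsStack S₁ S₂ S) (hL : 1 ≤ L)
    (hT : T ^ L = 1) (h₁ : S₁.IsWeak) (h₂ : S₂.IsWeak) :
    ∃ hS : S.IsWeak, weakIndex hL hT (S.weakPhase hS) =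
      weakIndex hL hT (S₁.weakPhase h₁) * weakIndex hL hT (S₂.weakPhase h₂) := by
  have hindex := h.hasWeakIndex_mul ((hasWeakIndex_iff_weakIndex_eq hL hT h₁).2 rfl)
    ((hasWeakIndex_iff_weakIndex_eq hL hT h₂).2 rfl)
  have hS := (isWeak_iff_exists_hasWeakIndex hL hT).2 ⟨_, hindex⟩
  exact ⟨hS, (hasWeakIndex_iff_weakIndex_eq hL hT hS).1 hindex⟩

theorem SymMPS.exists_pushThrough (hL : 1 ≤ L) (hT : T ^ L = 1) (S : SymMPS T L) :
    ∃ v φ, S.PushThrough v φ := by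
  obtain ⟨ρ, hρ⟩ := S.injective.exists_primitive
  obtain ⟨v, φ, hpush⟩ := hρ.exists_pushesTo hL hT S.symmetric
  exact ⟨v, φ, pushThrough_iff_pushesTo.2 hpush⟩

end WeakIndex

end ModulatedMPS

end

theorem mainTheorem10 {G : Type} [Group G] (T : MulAut G) (L : ℕ) (hL : 1 ≤ L)
    (hT : T ^ L = 1) :
    -- generalized push-through: every symmetric injective MPS has push-through data
    (∀ S : SymMPS T L, ∃ v φ, S.PushThrough v φ) ∧
    -- being a weak SPT (trivial strong class) only depends on the phase
    (∀ S S' : SymMPS T L, S.phase = S'.phase → (S.IsWeak ↔ S'.IsWeak)) ∧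
    -- stacking is always possible
    (∀ S₁ S₂ : SymMPS T L, ∃ S, IsStack S₁ S₂ S) ∧
    ∃ (w : WeakPhase T L ≃ WeakSPTGroup T)
      (κ : Phase T L → groupCohomology.H2 (U1 (FullGroup T)))
      (ι : Additive (WeakSPTGroup T) →+ groupCohomology.H2 (U1 (FullGroup T))),
      -- weak SPT phases are classified by the quotient, through the push-through phases
      (∀ (S : SymMPS T L) (h : S.IsWeak) (x : WeakSPTGroup T),
        S.HasWeakIndex x ↔ w (S.weakPhase h) = x) ∧
      -- the group law of the quotient is stacking
      (∀ S₁ S₂ S : SymMPS T L, IsStack S₁ S₂ S → ∀ (h₁ : S₁.IsWeak) (h₂ : S₂.IsWeak),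
        ∃ h : S.IsWeak,
          w (S.weakPhase h) = w (S₁.weakPhase h₁) * w (S₂.weakPhase h₂)) ∧
      -- all phases are classified by the crystalline class in `H²(G ⋊ ℤ, U(1))`
      (∀ (S : SymMPS T L) (x : groupCohomology.H2 (U1 (FullGroup T))),
        S.HasCrystallineClass x ↔ κ S.phase = x) ∧
      Function.Injective κ ∧
      (Finite G → Function.Surjective κ) ∧
      -- on weak phases it is given by `ι`, and there is an exact sequence
      -- `0 → H¹(G, U(1))/∼ → H²(G ⋊ ℤ, U(1)) → H²(G, U(1))^T → 0`
      (∀ (S : SymMPS T L) (h : S.IsWeak),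
        κ S.phase = ι (Additive.ofMul (w (S.weakPhase h)))) ∧
      Function.Injective ι ∧
      (∀ x : groupCohomology.H2 (U1 (FullGroup T)),
        H2pullback (SemidirectProduct.inl : G →* FullGroup T) x = 0 ↔ ∃ y, ι y = x) ∧
      (∀ z : groupCohomology.H2 (U1 G),
        H2pullback T.toMonoidHom z = z ↔
          ∃ x, H2pullback (SemidirectProduct.inl : G →* FullGroup T) x = z) := by
  refine ⟨SymMPS.exists_pushThrough hL hT, fun S S' => isWeak_congr hL hT, exists_isStack hL hT,
    Equiv.ofBijective _ (weakIndex_bijective hL hT), crystallineClass hL hT, inflation T,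
    fun S h x => hasWeakIndex_iff_weakIndex_eq hL hT h,
    fun S₁ S₂ S h h₁ h₂ => h.exists_weakIndex_eq_mul hL hT h₁ h₂,
    fun S x => S.hasCrystallineClass_iff_hasClass.trans
      (hasClass_iff_crystallineClass_eq hL hT S x),
    crystallineClass_injective hL hT, fun _ => crystallineClass_surjective hL hT,
    fun S h => crystallineClass_eq_inflation_weakIndex hL hT (S.weakPhase h),
    inflation_injective, H2pullback_inl_eq_zero_iff, H2pullback_eq_self_iff⟩
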